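/- **Setting.** Let $\prec$ be a total order on $\mathbb Z^k$ that is invariant under translations. For $S\subset\mathbb Z^k$, $\mathbf t\in\mathbb Z^k$ and $c\ge 0$ put $S^+=\{\mathbf u\in S:\mathbf u\succ\mathbf 0\}$, $(S)_{-\mathbf t}=\{\mathbf s-\mathbf t:\mathbf s\in S\}$, $K_c=[-c,c]^k\cap\mathbb Z^k$ and $S^{(\mathbf t,c)}=((S)_{-\mathbf t}\cap K_c)^+$. Let $\Lambda_n\subset\mathbb Z^k$ be finite with $|\Lambda_n|\to\infty$ and satisfy *Condition* $(\mathcal D^\Lambda)$: there are finitely or countably many pairwise different sets $\mathcal D_1,\mathcal D_2,\dots\subset\{\mathbf t:\mathbf t\succ\mathbf 0\}$ such that, for all $j$ and $p$, the limit $\lambda_{j,p}=\lim_n|\{\mathbf t\in\Lambda_n:\Lambda_n^{(\mathbf t,p)}=\mathcal D_j\cap K_p\}|/|\Lambda_n|$ exists, $\lambda_{j,p}\to\lambda_j>0$ as $p\to\infty$, and $\sum_j\lambda_j=1$. Let $(\mathbf X_{\mathbf t})_{\mathbf t\in\mathbb Z^k}$ be an $\mathbb R^d$-valued stationary random field that is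 regularly varying with index $\alpha>0$ (every finite-dimensional vector of the field is regularly varying with index $\alpha$), and let $a_n$ satisfy $|\Lambda_n|\,\mathbb P(|\mathbf X_{\mathbf 0}|>a_n)\to1$. Its tail field is a random field $(\mathbf Y_{\mathbf t})$ such that $\mathbb P(|\mathbf Y_{\mathbf 0}|>y)=y^{-\alpha}$ for $y\ge1$ and, conditionally on $|\mathbf X_{\mathbf 0}|>x$, the field $x^{-1}\mathbf X$ converges to $\mathbf Y$ in finite-dimensional distributions as $x\to\infty$; put $Y=|\mathbf Y_{\mathbf 0}|$ and $\mathbf\Theta_{\mathbf t}=\mathbf Y_{\mathbf t}/|\mathbf Y_{\mathbf 0}|$. *Condition* $(\mathrm{AC}^\Lambda_\succeq)$: with $R_{l,\Lambda}=\big(\bigcup_{\mathbf t\in\Lambda}(\Lambda)_{-\mathbf t}\big)^+\setminus K_l$, there are integers $r_n\to\infty$ with $k_n=\lfloor|\Lambda_n|/|\Lambda_{r_n}|\rfloor\to\infty$ such that for every $x>0$ $$\lim_{l\to\infty}\limsup_{n\to\infty}\mathbb P\Big(\max_{\mathbf i\in R_{l,\Lambda_{r_n}}}|\mathbf X_{\mathbf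 i}|>a_nx\,\Big|\,|\mathbf X_{\mathbf 0}|>a_nx\Big)=0 .$$ Assume this condition and fix such $(r_n)$ and $(k_n)$. For $\tau\in(0,\infty)$ let $u_n(\tau)$ denote any sequence with $|\Lambda_n|\,\mathbb P(|\mathbf X_{\mathbf 0}|>u_n(\tau))\to\tau$. Suprema over the empty set are $0$. **Theorem.** (1) For all $\tau\in(0,\infty)$ sequences $u_n(\tau)$ exist, and for all of them the limit $$\theta_b^\Lambda=\lim_{n\to\infty}\frac{\mathbb P(\max_{\mathbf t\in\Lambda_{r_n}}|\mathbf X_{\mathbf t}|>u_n(\tau))}{|\Lambda_{r_n}|\,\mathbb P(|\mathbf X_{\mathbf 0}|>u_n(\tau))}$$ exists, does not depend on $\tau$ or on the sequence, and is positive. Moreover $\sup_{\mathbf t\in\mathcal D_j}|\mathbf\Theta_{\mathbf t}|<\infty$ a.s. for every $j$, and $$\theta_b^\Lambda=\sum_j\lambda_j\,\mathbb P\Big(Y\sup_{\mathbf t\in\mathcal D_j}|\mathbf\Theta_{\mathbf t}|\le1\Big)=\sum_j\lambda_j\,\mathbb E\Big[\sup_{\mathbf t\in\mathcal D_j\cup\{\mathbf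 0\}}|\mathbf\Theta_{\mathbf t}|^\alpha-\sup_{\mathbf t\in\mathcal D_j}|\mathbf\Theta_{\mathbf t}|^\alpha\Big].$$ (2) For $D\subset\{\mathbf t:\mathbf t\succ\mathbf 0\}$ put $\mathcal G(D)=\{\mathbf z\in D\cup\{\mathbf 0\}:((D)_{-\mathbf z})^+=D\}$ and $\mathcal L(D)=\mathcal G(D)\cup-\mathcal G(D)$; let $\mathcal L_j=\mathcal L(\mathcal D_j)$ and $\Xi_j^*=\bigcup_{\mathbf z\in\mathcal D_j\cup\{\mathbf 0\}}\big(\mathbf z+\mathcal L(((\mathcal D_j)_{-\mathbf z})^+)\big)$. Suppose that $\Xi_j^*$ is a lattice (a subgroup of $\mathbb Z^k$, of any rank) for every $j$. Then for every $j$, almost surely, $\sum_{\mathbf t\in\Xi_j^*}|\mathbf\Theta_{\mathbf t}|^\alpha<\infty$, and there is exactly one $\mathbf T_j^*\in\mathcal L_j$ with $$|\mathbf\Theta_{\mathbf T_j^*}|>\sup_{\mathbf s\in\mathcal L_j,\,\mathbf s\prec\mathbf T_j^*}|\mathbf\Theta_{\mathbf s}|\quad\text{and}\quad|\mathbf\Theta_{\mathbf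 T_j^*}|=\sup_{\mathbf s\in\mathcal L_j,\,\mathbf s\succeq\mathbf T_j^*}|\mathbf\Theta_{\mathbf s}|.$$ With $\mathbf Q_{\Xi_j^*,\mathbf t}=\mathbf\Theta_{\mathbf t}\big/\big(\sum_{\mathbf s\in\Xi_j^*}|\mathbf\Theta_{\mathbf s}|^\alpha\big)^{1/\alpha}$, $$\theta_b^\Lambda=\sum_j\lambda_j\,\mathbb E\Big[\sup_{\mathbf t\in\Xi_j^*}|\mathbf Q_{\Xi_j^*,\mathbf t}|^\alpha\Big]=\sum_j\lambda_j\,\mathbb E\bigg[\frac{\sup_{\mathbf t\in\Xi_j^*}|\mathbf\Theta_{\mathbf t}|^\alpha}{\sum_{\mathbf s\in\Xi_j^*}|\mathbf\Theta_{\mathbf s}|^\alpha}\bigg]=\sum_j\lambda_j\,\mathbb E\big[|\mathbf\Theta_{\mathbf 0}|^\alpha\mathbf 1(\mathbf T_j^*=\mathbf 0)\big].$$ (3) In case (1) or (2), if for every $x>0$ $$\mathbb P\Big(\max_{\mathbf t\in\Lambda_n}|\mathbf X_{\mathbf t}|\le a_nx\Big)-\mathbb P\Big(\max_{\mathbf t\in\Lambda_{r_n}}|\mathbf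 X_{\mathbf t}|\le a_nx\Big)^{k_n}\to0,\qquad n\to\infty,$$ then the $\Lambda$-extremal index $\theta_X^\Lambda$ exists and equals $\theta_b^\Lambda$; that is, $\theta_b^\Lambda\in[0,1]$, and for every $\tau\in(0,\infty)$ there is a sequence $u_n(\tau)$ as above with $\mathbb P(\max_{\mathbf t\in\Lambda_n}|\mathbf X_{\mathbf t}|\le u_n(\tau))\to e^{-\theta_b^\Lambda\tau}$. -/

import Mathlib

open MeasureTheory ProbabilityTheory Filter Topology
open scoped ENNReal BoundedContinuousFunction

namespace ExtremalField

/-- The index set `ℤᵏ`. -/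
abbrev Site (k : ℕ) : Type := Fin k → ℤ

/-- The state space `ℝᵈ` with its Euclidean norm. -/
abbrev Vec (d : ℕ) : Type := EuclideanSpace ℝ (Fin d)

section Sets

variable {k : ℕ}

/-- A total (strict) order `≺` on `ℤᵏ` that is invariant under translations. -/
structure InvariantOrder (prec : Site k → Site k → Prop) : Prop where
  irrefl : ∀ s, ¬ prec s s
  trans : ∀ s t u, prec s t → prec t u → prec s u
  total : ∀ s t, s ≠ t → prec s t ∨ prec t s
  add_right : ∀ s t u, prec s t → prec (s + u) (t + u)

/-- The hypercube `K_c = [-c, c]ᵏ ∩ ℤᵏ`. -/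
def cube (k c : ℕ) : Set (Site k) := {u | ∀ i, |u i| ≤ (c : ℤ)}

/-- `S⁺ = {u ∈ S : u ≻ 0}`. -/
def upperPart (prec : Site k → Site k → Prop) (S : Set (Site k)) : Set (Site k) :=
  {u | u ∈ S ∧ prec 0 u}

/-- The translate `(S)_{-t} = {s - t : s ∈ S}`. -/
def shiftBack (S : Set (Site k)) (t : Site k) : Set (Site k) := {u | u + t ∈ S}

/-- `S^{(t,c)} = ((S)_{-t} ∩ K_c)⁺`. -/
def localPattern (prec : Site k → Site k → Prop) (S : Set (Site k)) (t : Site k) (c : ℕ) :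
    Set (Site k) :=
  upperPart prec (shiftBack S t ∩ cube k c)

/-- The proportion of points `t` of `Λ` whose local pattern in `K_p` is that of `D`. -/
noncomputable def patternFrequency (prec : Site k → Site k → Prop) (Λ : Finset (Site k))
    (D : Set (Site k)) (p : ℕ) : ℝ :=
  ({t : Site k | t ∈ Λ ∧ localPattern prec (↑Λ) t p = D ∩ cube k p}.ncard : ℝ) / (Λ.card : ℝ)

/-- The condition on the index sets `Λ_n`, with asymptotic patterns `D_i` (finitely or countably
many, pairwise different, contained in `{t : t ≻ 0}`) and weights `lam i = λ_i`. -/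
structure PatternCondition {ι : Type*} (prec : Site k → Site k → Prop)
    (Λ : ℕ → Finset (Site k)) (D : ι → Set (Site k)) (lam : ι → ℝ) : Prop where
  subset_pos : ∀ i, ∀ t ∈ D i, prec 0 t
  injective : Function.Injective D
  exists_limits : ∃ lamp : ι → ℕ → ℝ,
    (∀ i p, Tendsto (fun n => patternFrequency prec (Λ n) (D i) p) atTop (𝓝 (lamp i p))) ∧
    ∀ i, Tendsto (lamp i) atTop (𝓝 (lam i))
  weight_pos : ∀ i, 0 < lam i
  hasSum_weight : HasSum lam 1

/-- `G(D) = {z ∈ D ∪ {0} : ((D)_{-z})⁺ = D}`. -/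
def shiftStabilizer (prec : Site k → Site k → Prop) (D : Set (Site k)) : Set (Site k) :=
  {z | z ∈ insert 0 D ∧ upperPart prec (shiftBack D z) = D}

/-- `L(D) = G(D) ∪ -G(D)`. -/
def latticeOf (prec : Site k → Site k → Prop) (D : Set (Site k)) : Set (Site k) :=
  {z | z ∈ shiftStabilizer prec D ∨ -z ∈ shiftStabilizer prec D}

/-- `Ξ*(D)`: the union, over `z ∈ D ∪ {0}`, of the translates by `z` of `L(((D)_{-z})⁺)`.
Points `z` with the same `((D)_{-z})⁺` give the same translate, so that one representative of
each is enough. -/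
def fullPattern (prec : Site k → Site k → Prop) (D : Set (Site k)) : Set (Site k) :=
  {x | ∃ z ∈ insert 0 D, x - z ∈ latticeOf prec (upperPart prec (shiftBack D z))}

/-- A lattice in `ℤᵏ`, of any rank: an additive subgroup. -/
def IsLattice (S : Set (Site k)) : Prop := ∃ H : AddSubgroup (Site k), (H : Set (Site k)) = S

/-- `R_{l,Λ} = (⋃_{t ∈ Λ} (Λ)_{-t})⁺ \ K_l`. -/
def farDifferences (prec : Site k → Site k → Prop) (l : ℕ) (Λ : Finset (Site k)) :
    Set (Site k) :=
  upperPart prec (⋃ t ∈ Λ, shiftBack (↑Λ) t) \ cube k l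

/-- `t` is the value of the anchor `T*` of the configuration `x` on the lattice `L`: the norm
`|x_t|` is greater than the supremum over the sites of `L` before `t`, and equal to the supremum
over the sites of `L` from `t` on. -/
def IsAnchor {d : ℕ} (prec : Site k → Site k → Prop) (L : Set (Site k)) (x : Site k → Vec d)
    (t : Site k) : Prop :=
  t ∈ L ∧ (⨆ s ∈ {s | s ∈ L ∧ prec s t}, ‖x s‖ₑ) < ‖x t‖ₑ ∧
    ‖x t‖ₑ = ⨆ s ∈ {s | s ∈ L ∧ (s = t ∨ prec t s)}, ‖x s‖ₑ

/-- `‖x‖_{A,α} = (∑_{t ∈ A} |x_t|^α)^{1/α}`. -/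
noncomputable def clusterNorm {d : ℕ} (A : Set (Site k)) (α : ℝ) (x : Site k → Vec d) : ℝ :=
  (∑' t : A, ‖x t‖ ^ α) ^ (1 / α)

/-- The spectral cluster configuration `Q_A = Θ / ‖Θ‖_{A,α}`. -/
noncomputable def spectralCluster {d : ℕ} (A : Set (Site k)) (α : ℝ) (x : Site k → Vec d) :
    Site k → Vec d :=
  fun t => (clusterNorm A α x)⁻¹ • x t

end Sets

section Fields

variable {k d : ℕ} {Ω : Type*} [MeasurableSpace Ω]

/-- Strict stationarity of a random field: its law is invariant under all translations. -/
def IsStationaryField (P : Measure Ω) (X : Site k → Ω → Vec d) : Prop :=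
  ∀ s : Site k, P.map (fun ω (t : Site k) => X (t + s) ω) = P.map (fun ω (t : Site k) => X t ω)

/-- A random vector `Z` in a normed space `V` is regularly varying with index `α`: there is a
nonzero measure `μ` on `V \ {0}`, finite away from the origin and homogeneous of order `-α`, such
that `P(x⁻¹ Z ∈ ·) / P(|Z| > x)` converges to `μ` as `x → ∞`, tested on the bounded continuous
functions that vanish near the origin. -/
def IsRegularlyVaryingVector {V : Type*} [NormedAddCommGroup V] [NormedSpace ℝ V]
    [MeasurableSpace V] (P : Measure Ω) (Z : Ω → V) (α : ℝ) : Prop :=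
  ∃ μ : Measure V, μ ≠ 0 ∧ μ {0} = 0 ∧ (∀ ε : ℝ, 0 < ε → μ {z | ε ≤ ‖z‖} < ⊤) ∧
    (∀ c : ℝ, 0 < c → ∀ s : Set V, MeasurableSet s →
      μ {z | c⁻¹ • z ∈ s} = ENNReal.ofReal (c ^ (-α)) * μ s) ∧
    ∀ f : V →ᵇ ℝ, (∃ ε : ℝ, 0 < ε ∧ ∀ z, ‖z‖ < ε → f z = 0) →
      Tendsto (fun x : ℝ => (∫ ω, f (x⁻¹ • Z ω) ∂P) / P.real {ω | x < ‖Z ω‖}) atTop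
        (𝓝 (∫ z, f z ∂μ))

/-- A random field is regularly varying with index `α` if all its finite-dimensional vectors
are. -/
def IsRegularlyVarying (P : Measure Ω) (X : Site k → Ω → Vec d) (α : ℝ) : Prop :=
  ∀ F : Finset (Site k), F.Nonempty →
    IsRegularlyVaryingVector P (fun ω (t : F) => X t ω) α

/-- `Y`, on its own probability space, is a tail field of `X`: `|Y_0|` has the Pareto law of index
`α` on `[1, ∞)`, and conditionally on `|X_0| > x` the field `x⁻¹ X` converges to `Y` in
finite-dimensional distributions as `x → ∞`. -/
structure IsTailField {Ω' : Type*} [MeasurableSpace Ω'] (P : Measure Ω)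
    (X : Site k → Ω → Vec d) (α : ℝ) (P' : Measure Ω') (Y : Site k → Ω' → Vec d) : Prop where
  measurable : ∀ t, Measurable (Y t)
  pareto : ∀ y : ℝ, 1 ≤ y → P'.real {ω | y < ‖Y 0 ω‖} = y ^ (-α)
  tendsto_fdd : ∀ (F : Finset (Site k)) (f : (F → Vec d) →ᵇ ℝ),
    Tendsto (fun x : ℝ => ∫ ω, f (fun t => x⁻¹ • X t ω) ∂(P[|{ω | x < ‖X 0 ω‖}])) atTop
      (𝓝 (∫ ω, f (fun t => Y t ω) ∂P'))

/-- The spectral field `Θ_t = Y_t / |Y_0|`, as a random configuration. -/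
noncomputable def spectralField {Ω' : Type*} (Y : Site k → Ω' → Vec d) (ω : Ω') :
    Site k → Vec d :=
  fun t => ‖Y 0 ω‖⁻¹ • Y t ω

/-- `|Λ_n| P(|X_0| > u_n) → τ`. -/
def IsLevel (P : Measure Ω) (X : Site k → Ω → Vec d) (Λ : ℕ → Finset (Site k)) (τ : ℝ)
    (u : ℕ → ℝ) : Prop :=
  Tendsto (fun n => ((Λ n).card : ℝ) * P.real {ω | u n < ‖X 0 ω‖}) atTop (𝓝 τ)

/-- `k_n = ⌊|Λ_n| / |Λ_{r_n}|⌋` (division of natural numbers). -/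
def blockCount (Λ : ℕ → Finset (Site k)) (r : ℕ → ℕ) (n : ℕ) : ℕ :=
  (Λ n).card / (Λ (r n)).card

/-- The anti-clustering condition along the integer sequence `r`. The event inside the probability
is `max_{i ∈ R_{l,Λ_{r_n}}} |X_i| > a_n x`. -/
structure AntiClustering (P : Measure Ω) (X : Site k → Ω → Vec d)
    (prec : Site k → Site k → Prop) (Λ : ℕ → Finset (Site k)) (a : ℕ → ℝ) (r : ℕ → ℕ) :
    Prop where
  tendsto_r : Tendsto r atTop atTop
  tendsto_blockCount : Tendsto (blockCount Λ r) atTop atTop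
  tendsto_prob : ∀ x : ℝ, 0 < x →
    Tendsto (fun l : ℕ => limsup (fun n : ℕ =>
        (P[|{ω | a n * x < ‖X 0 ω‖}])
          {ω | ∃ i ∈ farDifferences prec l (Λ (r n)), a n * x < ‖X i ω‖}) atTop)
      atTop (𝓝 (0 : ℝ≥0∞))

/-- The mixing condition
`P(max_{Λ_n} |X_t| ≤ a_n x) - P(max_{Λ_{r_n}} |X_t| ≤ a_n x)^{k_n} → 0` for all `x > 0`. -/
def MaxMixing (P : Measure Ω) (X : Site k → Ω → Vec d) (Λ : ℕ → Finset (Site k))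
    (a : ℕ → ℝ) (r : ℕ → ℕ) : Prop :=
  ∀ x : ℝ, 0 < x →
    Tendsto (fun n => P.real {ω | ∀ t ∈ Λ n, ‖X t ω‖ ≤ a n * x}
        - P.real {ω | ∀ t ∈ Λ (r n), ‖X t ω‖ ≤ a n * x} ^ blockCount Λ r n) atTop (𝓝 0)

/-- `P(max_{t ∈ Λ_{r_n}} |X_t| > u_n) / (|Λ_{r_n}| P(|X_0| > u_n))`. -/
noncomputable def blockRatio (P : Measure Ω) (X : Site k → Ω → Vec d)
    (Λ : ℕ → Finset (Site k)) (r : ℕ → ℕ) (u : ℕ → ℝ) (n : ℕ) : ℝ :=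
  P.real {ω | ∃ t ∈ Λ (r n), u n < ‖X t ω‖} /
    (((Λ (r n)).card : ℝ) * P.real {ω | u n < ‖X 0 ω‖})

/-- `θ` is the block extremal index: for every `τ ∈ (0, ∞)` there are levels `u_n(τ)`, and for
every choice of them the block ratios converge to `θ`. -/
def IsBlockExtremalIndex (P : Measure Ω) (X : Site k → Ω → Vec d) (Λ : ℕ → Finset (Site k))
    (r : ℕ → ℕ) (θ : ℝ) : Prop :=
  ∀ τ : ℝ, 0 < τ → (∃ u : ℕ → ℝ, IsLevel P X Λ τ u) ∧
    ∀ u : ℕ → ℝ, IsLevel P X Λ τ u → Tendsto (blockRatio P X Λ r u) atTop (𝓝 θ)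

/-- `θ` is the extremal index of `X` along `Λ`: `θ ∈ [0, 1]` and for every `τ ∈ (0, ∞)` there are
levels `u_n(τ)` with `P(max_{t ∈ Λ_n} |X_t| ≤ u_n(τ)) → exp(-θ τ)`. -/
def IsExtremalIndex (P : Measure Ω) (X : Site k → Ω → Vec d) (Λ : ℕ → Finset (Site k))
    (θ : ℝ) : Prop :=
  θ ∈ Set.Icc (0 : ℝ) 1 ∧ ∀ τ : ℝ, 0 < τ → ∃ u : ℕ → ℝ, IsLevel P X Λ τ u ∧
    Tendsto (fun n => P.real {ω | ∀ t ∈ Λ n, ‖X t ω‖ ≤ u n}) atTop (𝓝 (Real.exp (-θ * τ)))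

end Fields

end ExtremalField

open ExtremalField

/-! Split the event of an exceedance of `x` in a finite block according to its last exceedance in
the order. By stationarity its probability is the sum, over the sites `t` of the block, of the
probability that `|X_0| > x` while the field is quiet on the later sites of the block as seen from
`t`. Anti-clustering allows these later sites to be cut off at a cube `K_p` for a relative error `ε`
per site, after which a summand depends only on the local pattern at `t`. Pattern frequencies
converge by assumption, and for a finite pattern the conditional probability of quiet converges by
regular variation alone. A finite set of patterns carries almost all the weight, so that `p → ∞`
gives `θ = ∑ λ_j π_j` (`exists_blockExtremalIndex`), without reference to a tail field. Positivity
is a counting argument: exceedances without a far later exceedance all lie within one translate of a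
cube (`card_mul_tailProb_le`).

Weak convergence identifies `π_j` with the probability that the tail field is at most `1` in norm on
`D_j`. All representations of this number come from the time change formula for the law of the tail
field (`IsTailField.isTailLaw`). At `t = 0` the formula makes the Pareto radius independent of the
direction; integrating the radius out turns probabilities of exceedance into moments of order `α`
(`IsTailLaw.setLIntegral_homogeneous`), which yields the formula with a difference of suprema.

In the lattice case a packing argument shows that a period of a tail of `D_j` has a multiple that is
a period of `D_j` (`PatternCondition.exists_nsmul_mem`), and this forces `D_j` to be the positive
part of a subgroup `H`. Anti-clustering leaves finitely many exceedances on `D_j`, hence on `H`, so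
last exceedance and anchor exist. Both are equivariant under `H`, and the time change exchanges
their roles: the last exceedance is at `0` as often as the anchor is. The same transport expresses
the integral of a scale and shift invariant function through configurations anchored at `0`, with
weight `∑ |x_t|^α / |x_0|^α` (`IsTailLaw.lintegral_invariant`). The function `1` gives summability,
and the quotient of the `α`-th power of the supremum by the sum gives the remaining formulas.

Under mixing, `k_n` almost independent blocks, each exceeding with probability about `θ τ / k_n`,
produce the limit `exp(-θ τ)`. -/

namespace ExtremalField

/-! ### Continuous approximations of indicators of half-lines -/

/-- The piecewise linear function that is `0` up to `a` and `1` from `b` on. -/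
noncomputable def ramp (a b r : ℝ) : ℝ := max 0 (min 1 ((r - a) / (b - a)))

lemma ramp_nonneg (a b r : ℝ) : 0 ≤ ramp a b r := le_max_left _ _

lemma ramp_le_one (a b r : ℝ) : ramp a b r ≤ 1 := max_le zero_le_one (min_le_left _ _)

lemma ramp_of_le {a b r : ℝ} (hab : a < b) (h : r ≤ a) : ramp a b r = 0 := by
  refine max_eq_left ((min_le_right _ _).trans ?_)
  exact div_nonpos_of_nonpos_of_nonneg (by linarith) (by linarith)

lemma ramp_of_ge {a b r : ℝ} (hab : a < b) (h : b ≤ r) : ramp a b r = 1 := by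
  have : 1 ≤ (r - a) / (b - a) := by rw [le_div_iff₀ (by linarith)]; linarith
  simp [ramp, this]

lemma continuous_ramp (a b : ℝ) : Continuous (ramp a b) := by unfold ramp; fun_prop

lemma indicator_le_ramp {a b r : ℝ} (hab : a < b) : (Set.Ioi b).indicator 1 r ≤ ramp a b r := by
  by_cases h : b < r
  · simp [h, ramp_of_ge hab h.le]
  · simp [h, ramp_nonneg]

lemma ramp_le_indicator {a b r : ℝ} (hab : a < b) : ramp a b r ≤ (Set.Ioi a).indicator 1 r := by
  by_cases h : a < r
  · simp [h, ramp_le_one]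
  · simp [h, ramp_of_le hab (not_lt.1 h)]

/-! ### Tails of regularly varying vectors -/

section Vector

variable {V : Type*} [NormedAddCommGroup V] [NormedSpace ℝ V] [MeasurableSpace V] [BorelSpace V]
  {Ω : Type*} [MeasurableSpace Ω] {P : Measure Ω} [IsProbabilityMeasure P]

lemma measureReal_le_integral_ramp {W : Type*} [MeasurableSpace W] {μ : Measure W} {g : W → ℝ}
    (hg : Measurable g) {a b : ℝ} (hab : a < b) (hfin : μ {w | a < g w} ≠ ⊤) :
    μ.real {w | b < g w} ≤ ∫ w, ramp a b (g w) ∂μ ∧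
      ∫ w, ramp a b (g w) ∂μ ≤ μ.real {w | a < g w} := by
  have hma : MeasurableSet {w | a < g w} := measurableSet_lt measurable_const hg
  have hmb : MeasurableSet {w | b < g w} := measurableSet_lt measurable_const hg
  have hfinb : μ {w | b < g w} ≠ ⊤ :=
    ne_top_of_le_ne_top hfin (measure_mono fun w hw => hab.trans hw)
  have hia : Integrable ({w | a < g w}.indicator (1 : W → ℝ)) μ :=
    (integrable_indicator_iff hma).2 (integrableOn_const (by simpa using hfin))
  have hib : Integrable ({w | b < g w}.indicator (1 : W → ℝ)) μ :=
    (integrable_indicator_iff hmb).2 (integrableOn_const (by simpa using hfinb))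
  have hle : ∀ w, ramp a b (g w) ≤ {w | a < g w}.indicator (1 : W → ℝ) w :=
    fun w => ramp_le_indicator hab
  have hir : Integrable (fun w => ramp a b (g w)) μ := by
    refine hia.mono' ((continuous_ramp a b).measurable.comp hg).aestronglyMeasurable ?_
    filter_upwards with w
    rw [Real.norm_of_nonneg (ramp_nonneg _ _ _)]
    exact hle w
  constructor
  · rw [← integral_indicator_one hmb]
    exact integral_mono hib hir fun w => indicator_le_ramp hab
  · rw [← integral_indicator_one hma]
    exact integral_mono hir hia hle

/-- A tail that vanishes at one point vanishes from there on, and then the limit measure integrates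
every test function to `0`. It would live at the origin, which it does not charge. -/
lemma IsRegularlyVaryingVector.tail_pos {Z : Ω → V} {α : ℝ}
    (h : IsRegularlyVaryingVector P Z α) (x : ℝ) : 0 < P.real {ω | x < ‖Z ω‖} := by
  obtain ⟨μ, hμ0, hμz, hfin, -, hlim⟩ := h
  by_contra hx
  have hx0 : P.real {ω | x < ‖Z ω‖} = 0 := le_antisymm (not_lt.1 hx) measureReal_nonneg
  have hev : ∀ y, x ≤ y → P.real {ω | y < ‖Z ω‖} = 0 := fun y hy =>
    le_antisymm (hx0 ▸ measureReal_mono fun ω (hω : y < _) => hy.trans_lt hω) measureReal_nonneg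
  have hnull : ∀ n : ℕ, μ {z | 2 / ((n : ℝ) + 1) < ‖z‖} = 0 := by
    intro n
    have hn : (0 : ℝ) < 1 / ((n : ℝ) + 1) := by positivity
    have hlt : 1 / ((n : ℝ) + 1) < 2 / ((n : ℝ) + 1) := by gcongr; norm_num
    have hf1 : μ {z | 1 / ((n : ℝ) + 1) < ‖z‖} ≠ ⊤ :=
      ne_top_of_le_ne_top (hfin _ hn).ne (measure_mono fun z hz => le_of_lt hz.out)
    let f : V →ᵇ ℝ := BoundedContinuousFunction.ofNormedAddCommGroup
      (fun z => ramp (1 / ((n : ℝ) + 1)) (2 / ((n : ℝ) + 1)) ‖z‖)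
      ((continuous_ramp _ _).comp continuous_norm) 1
      (fun z => by rw [Real.norm_of_nonneg (ramp_nonneg _ _ _)]; exact ramp_le_one _ _ _)
    have h1 := hlim f ⟨_, hn, fun z hz => ramp_of_le hlt hz.le⟩
    -- The quotients in the definition have denominator `0` from `x` on, and division by `0` is `0`.
    have h2 : ∫ z, f z ∂μ = 0 := by
      refine tendsto_nhds_unique (h1.congr' ?_) tendsto_const_nhds
      filter_upwards [eventually_ge_atTop x] with y hy
      simp [hev y hy]
    have h3 := (measureReal_le_integral_ramp (μ := μ) measurable_norm hlt hf1).1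
    have h4 : μ.real {z | 2 / ((n : ℝ) + 1) < ‖z‖} = 0 :=
      le_antisymm (h3.trans h2.le) measureReal_nonneg
    exact (measureReal_eq_zero_iff
      (ne_top_of_le_ne_top hf1 (measure_mono fun z hz => hlt.trans hz))).1 h4
  refine hμ0 (Measure.measure_univ_eq_zero.1 ?_)
  have hcov : (Set.univ : Set V) ⊆ {0} ∪ ⋃ n : ℕ, {z | 2 / ((n : ℝ) + 1) < ‖z‖} := by
    intro z _
    by_cases hz : z = 0
    · exact Or.inl hz
    · obtain ⟨n, hn⟩ := exists_nat_one_div_lt (half_pos (norm_pos_iff.2 hz))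
      refine Or.inr (Set.mem_iUnion.2 ⟨n, ?_⟩)
      have : (2 : ℝ) / (n + 1) = 2 * (1 / (n + 1)) := by ring
      change (2 : ℝ) / (n + 1) < ‖z‖
      linarith
  refine measure_mono_null hcov (measure_union_null hμz (measure_iUnion_null hnull))

/-- Tail ratios of positively homogeneous continuous functions of a regularly varying vector
converge, and the limits scale with exponent `-α`. -/
lemma IsRegularlyVaryingVector.exists_tendsto_ratio {Z : Ω → V} {α : ℝ} (hZ : Measurable Z)
    (h : IsRegularlyVaryingVector P Z α) {g : V → ℝ} (hg : Continuous g)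
    (hhom : ∀ c : ℝ, 0 < c → ∀ z, g (c • z) = c * g z) {C : ℝ} (hC : ∀ z, g z ≤ C * ‖z‖) :
    ∃ m : ℝ, ∀ c : ℝ, 0 < c →
      Tendsto (fun x : ℝ => P.real {ω | c * x < g (Z ω)} / P.real {ω | x < ‖Z ω‖}) atTop
        (𝓝 (c ^ (-α) * m)) := by
  have hpos := h.tail_pos
  obtain ⟨μ, hμ0, hμz, hfin, hscale, hlim⟩ := h
  -- Replacing `C` by a positive constant lets one divide by it: where `g` exceeds a positive level,
  -- the norm is bounded below, and there the limit measure is finite.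
  have hC' : ∀ z, g z ≤ (|C| + 1) * ‖z‖ := fun z => (hC z).trans
    (mul_le_mul_of_nonneg_right ((le_abs_self C).trans (by linarith)) (norm_nonneg z))
  have hC0 : 0 < |C| + 1 := by positivity
  have hsub : ∀ a : ℝ, {z | a < g z} ⊆ {z | a / (|C| + 1) ≤ ‖z‖} := by
    intro a z (hz : a < g z)
    change a / (|C| + 1) ≤ ‖z‖
    rw [div_le_iff₀ hC0, mul_comm]
    exact hz.le.trans (hC' z)
  have hfin' : ∀ a : ℝ, 0 < a → μ {z | a < g z} ≠ ⊤ := fun a ha =>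
    ne_top_of_le_ne_top (hfin _ (div_pos ha hC0)).ne (measure_mono (hsub a))
  refine ⟨μ.real {z | 1 < g z}, fun c hc => ?_⟩
  have hμc : ∀ c : ℝ, 0 < c → μ.real {z | c < g z} = c ^ (-α) * μ.real {z | 1 < g z} := by
    intro c hc
    have := hscale c hc {z | 1 < g z} (measurableSet_lt measurable_const hg.measurable)
    have hset : {z | c⁻¹ • z ∈ {z | 1 < g z}} = {z | c < g z} := by
      ext z
      simp only [Set.mem_ofPred_eq, hhom _ (inv_pos.2 hc)]
      rw [inv_mul_eq_div, one_lt_div hc]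
    rw [hset] at this
    rw [measureReal_def, this, ENNReal.toReal_mul, measureReal_def,
      ENNReal.toReal_ofReal (by positivity)]
  have hramp : ∀ a b : ℝ, 0 < a → a < b →
      Tendsto (fun x : ℝ => (∫ ω, ramp a b (g (x⁻¹ • Z ω)) ∂P) / P.real {ω | x < ‖Z ω‖}) atTop
        (𝓝 (∫ z, ramp a b (g z) ∂μ)) := by
    intro a b ha hab
    let f : V →ᵇ ℝ := BoundedContinuousFunction.ofNormedAddCommGroup
      (fun z => ramp a b (g z)) ((continuous_ramp _ _).comp hg) 1
      (fun z => by rw [Real.norm_of_nonneg (ramp_nonneg _ _ _)]; exact ramp_le_one _ _ _)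
    refine hlim f ⟨_, div_pos ha hC0, fun z hz => ramp_of_le hab ?_⟩
    rw [lt_div_iff₀ hC0, mul_comm] at hz
    exact (hC' z).trans hz.le
  have hbound : ∀ a b x : ℝ, a < b → 0 < x →
      P.real {ω | b * x < g (Z ω)} ≤ ∫ ω, ramp a b (g (x⁻¹ • Z ω)) ∂P ∧
      ∫ ω, ramp a b (g (x⁻¹ • Z ω)) ∂P ≤ P.real {ω | a * x < g (Z ω)} := by
    intro a b x hab hx
    have := measureReal_le_integral_ramp (μ := P) (g := fun ω => g (x⁻¹ • Z ω))
      (hg.measurable.comp (hZ.const_smul _)) hab (measure_ne_top _ _)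
    have hset : ∀ c : ℝ, {ω | c < g (x⁻¹ • Z ω)} = {ω | c * x < g (Z ω)} := by
      intro c
      ext ω
      simp only [Set.mem_ofPred_eq, hhom _ (inv_pos.2 hx)]
      rw [inv_mul_eq_div, lt_div_iff₀ hx]
    simpa only [hset] using this
  have hcont : ContinuousAt (fun c : ℝ => c ^ (-α) * μ.real {z | 1 < g z}) c :=
    (Real.continuousAt_rpow_const _ _ (Or.inl hc.ne')).mul continuousAt_const
  rw [tendsto_order]
  constructor
  · intro y hy
    -- The limit is continuous in `c`, so a ramp that rises between `c` and a nearby level loses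
    -- little mass; this replaces a null boundary condition.
    have h1 : ∀ᶠ b in 𝓝[>] c, y < b ^ (-α) * μ.real {z | 1 < g z} :=
      (hcont.tendsto.mono_left nhdsWithin_le_nhds).eventually_const_lt hy
    obtain ⟨b, hb, hcb⟩ := (h1.and self_mem_nhdsWithin).exists
    have hcb : c < b := hcb
    have h2 : y < ∫ z, ramp c b (g z) ∂μ :=
      hb.trans_le ((hμc b (hc.trans hcb)).symm.le.trans
        (measureReal_le_integral_ramp hg.measurable hcb (hfin' c hc)).1)
    filter_upwards [(hramp c b hc hcb).eventually_const_lt h2, eventually_gt_atTop 0]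
      with x hx hx0
    refine hx.trans_le ?_
    gcongr
    exact (hbound c b x hcb hx0).2
  · intro y hy
    have h1 : ∀ᶠ b in 𝓝[<] c, b ^ (-α) * μ.real {z | 1 < g z} < y :=
      (hcont.tendsto.mono_left nhdsWithin_le_nhds).eventually_lt_const hy
    obtain ⟨a, ⟨ha, hac⟩, ha0⟩ := ((h1.and self_mem_nhdsWithin).and
      (mem_nhdsWithin_of_mem_nhds (lt_mem_nhds hc))).exists
    have hac : a < c := hac
    have ha0 : 0 < a := ha0
    have h2 : ∫ z, ramp a c (g z) ∂μ < y :=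
      ((measureReal_le_integral_ramp hg.measurable hac (hfin' a ha0)).2.trans
        (hμc a ha0).le).trans_lt ha
    filter_upwards [(hramp a c ha0 hac).eventually_lt_const h2, eventually_gt_atTop 0]
      with x hx hx0
    refine lt_of_le_of_lt ?_ hx
    gcongr
    exact (hbound a c x hac hx0).1

end Vector

/-! ### Tail and quiet probabilities of a stationary field -/

section Field

variable {k d : ℕ} {Ω : Type*} [MeasurableSpace Ω]

/-- `P(|X_0| > x)`. -/
noncomputable def tailProb (P : Measure Ω) (X : Site k → Ω → Vec d) (x : ℝ) : ℝ :=
  P.real {ω | x < ‖X 0 ω‖}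

/-- `P(|X_0| > x, max_A |X| ≤ x)`. -/
noncomputable def quietProb (P : Measure Ω) (X : Site k → Ω → Vec d) (A : Set (Site k)) (x : ℝ) :
    ℝ :=
  P.real {ω | x < ‖X 0 ω‖ ∧ ∀ s ∈ A, ‖X s ω‖ ≤ x}

variable {P : Measure Ω} {X : Site k → Ω → Vec d} {α : ℝ}

lemma IsStationaryField.measure_shift (hXs : IsStationaryField P X) (hXm : ∀ t, Measurable (X t))
    {S : Set (Site k → Vec d)} (hS : MeasurableSet S) (s : Site k) :
    P {ω | (fun t => X (t + s) ω) ∈ S} = P {ω | (fun t => X t ω) ∈ S} := by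
  have h := congrArg (fun μ => μ S) (hXs s)
  rwa [Measure.map_apply (measurable_pi_lambda _ fun t => hXm _) hS,
    Measure.map_apply (measurable_pi_lambda _ fun t => hXm _) hS] at h

lemma IsStationaryField.tail_shift (hXs : IsStationaryField P X) (hXm : ∀ t, Measurable (X t))
    (t : Site k) (x : ℝ) : P.real {ω | x < ‖X t ω‖} = tailProb P X x := by
  have := hXs.measure_shift hXm (S := {z | x < ‖z 0‖})
    (measurableSet_lt measurable_const (measurable_pi_apply 0).norm) t
  simp only [Set.mem_ofPred_eq, zero_add] at this
  rw [tailProb, measureReal_def, this, measureReal_def]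

lemma measurableSet_tail (hXm : ∀ t, Measurable (X t)) (t : Site k) (x : ℝ) :
    MeasurableSet {ω | x < ‖X t ω‖} := measurableSet_lt measurable_const (hXm t).norm

lemma measurableSet_quiet (hXm : ∀ t, Measurable (X t)) (A : Set (Site k)) (x : ℝ) :
    MeasurableSet {ω | ∀ s ∈ A, ‖X s ω‖ ≤ x} := by
  simp only [Set.ofPred_forall]
  exact MeasurableSet.iInter fun s => MeasurableSet.iInter fun _ =>
    measurableSet_le (hXm s).norm measurable_const

lemma measurableSet_loud (hXm : ∀ t, Measurable (X t)) (A : Set (Site k)) (x : ℝ) :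
    MeasurableSet {ω | ∃ s ∈ A, x < ‖X s ω‖} := by
  convert (measurableSet_quiet hXm A x).compl using 1
  ext ω
  simp

lemma quietProb_nonneg (A : Set (Site k)) (x : ℝ) : 0 ≤ quietProb P X A x := measureReal_nonneg

variable [IsProbabilityMeasure P]

lemma tailProb_antitone : Antitone (tailProb P X) := fun _ _ hxy =>
  measureReal_mono fun _ hω => lt_of_le_of_lt hxy hω.out

lemma quietProb_le_tailProb (A : Set (Site k)) (x : ℝ) : quietProb P X A x ≤ tailProb P X x :=
  measureReal_mono fun _ hω => hω.1

lemma quietProb_anti {A B : Set (Site k)} (h : A ⊆ B) (x : ℝ) :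
    quietProb P X B x ≤ quietProb P X A x :=
  measureReal_mono fun _ hω => ⟨hω.1, fun s hs => hω.2 s (h hs)⟩

lemma tailProb_pos (hXrv : IsRegularlyVarying P X α) (x : ℝ) : 0 < tailProb P X x := by
  have := (hXrv {0} (Finset.singleton_nonempty _)).tail_pos x
  refine this.trans_le (measureReal_mono fun ω hω => ?_)
  refine lt_of_lt_of_le hω.out ((pi_norm_le_iff_of_nonneg (norm_nonneg _)).2 ?_)
  rintro ⟨t, ht⟩
  obtain rfl := Finset.mem_singleton.1 ht
  exact le_rfl

/-- This allows the norm of a finite-dimensional vector to be replaced by `|X_0|` as the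
normalization. The limit is positive because one of the `|F|` coordinates exceeds when the maximum
does, and all coordinates have the same tail: the ratio is at least `1 / |F|`. -/
lemma exists_tendsto_ratio_zero (hXm : ∀ t, Measurable (X t)) (hXs : IsStationaryField P X)
    (hXrv : IsRegularlyVarying P X α) {F : Finset (Site k)} (h0 : 0 ∈ F) :
    ∃ m : ℝ, 0 < m ∧ ∀ c : ℝ, 0 < c → Tendsto (fun x : ℝ => tailProb P X (c * x) /
      P.real {ω | x < ‖fun t : F => X t ω‖}) atTop (𝓝 (c ^ (-α) * m)) := by
  have hF := hXrv F ⟨0, h0⟩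
  obtain ⟨m, hm⟩ := hF.exists_tendsto_ratio (measurable_pi_lambda _ fun t => hXm _)
    (g := fun z => ‖z ⟨0, h0⟩‖) (by fun_prop)
    (fun c hc z => by simp [norm_smul, abs_of_pos hc]) (C := 1)
    (fun z => by rw [one_mul]; exact norm_le_pi_norm z _)
  refine ⟨m, ?_, hm⟩
  have hcard : (0 : ℝ) < F.card := by exact_mod_cast Finset.card_pos.2 ⟨0, h0⟩
  have h1 : Tendsto (fun x : ℝ => P.real {ω | x < ‖X 0 ω‖} /
      P.real {ω | x < ‖fun t : F => X t ω‖}) atTop (𝓝 m) := by simpa using hm 1 one_pos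
  refine (one_div_pos.2 hcard).trans_le (ge_of_tendsto h1 ?_)
  filter_upwards [eventually_ge_atTop 0] with x hx
  rw [div_le_div_iff₀ hcard (hF.tail_pos x), one_mul]
  have hsub : {ω | x < ‖fun t : F => X t ω‖} ⊆ ⋃ t ∈ F, {ω | x < ‖X t ω‖} := by
    intro ω hω
    by_contra hcon
    simp only [Set.mem_iUnion, Set.mem_ofPred_eq, not_exists, not_lt] at hcon
    exact absurd ((pi_norm_le_iff_of_nonneg hx).2 fun t : F => hcon t t.2) (not_le.2 hω.out)
  calc P.real {ω | x < ‖fun t : F => X t ω‖} ≤ P.real (⋃ t ∈ F, {ω | x < ‖X t ω‖}) :=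
        measureReal_mono hsub (measure_ne_top _ _)
    _ ≤ ∑ t ∈ F, P.real {ω | x < ‖X t ω‖} := measureReal_biUnion_finset_le _ _
    _ = tailProb P X x * F.card := by simp [hXs.tail_shift hXm, mul_comm]

lemma tendsto_tailProb_ratio (hXm : ∀ t, Measurable (X t)) (hXs : IsStationaryField P X)
    (hXrv : IsRegularlyVarying P X α) {c : ℝ} (hc : 0 < c) :
    Tendsto (fun x : ℝ => tailProb P X (c * x) / tailProb P X x) atTop (𝓝 (c ^ (-α))) := by
  obtain ⟨m, hm0, hm⟩ := exists_tendsto_ratio_zero hXm hXs hXrv (F := {0}) (by simp)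
  have h := (hm c hc).div (hm 1 one_pos) (by simpa using hm0.ne')
  simp only [Real.one_rpow, one_mul] at h
  rw [mul_div_cancel_right₀ _ hm0.ne'] at h
  refine h.congr fun x => ?_
  have := (hXrv {0} (Finset.singleton_nonempty _)).tail_pos x
  exact div_div_div_cancel_right₀ this.ne' _ _

/-- The complementary event within `|X_0| > x` is that the minimum of `|X_0|` and `max_A |X|`
exceeds `x`. This minimum is continuous and homogeneous, so the limit exists without any tail field.
-/
lemma exists_tendsto_quietProb (hXm : ∀ t, Measurable (X t)) (hXs : IsStationaryField P X)
    (hXrv : IsRegularlyVarying P X α) {A : Set (Site k)} (hA : A.Finite) :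
    ∃ π : ℝ, Tendsto (fun x : ℝ => quietProb P X A x / tailProb P X x) atTop (𝓝 π) := by
  classical
  lift A to Finset (Site k) using hA
  set F : Finset (Site k) := insert 0 A with hFdef
  have h0 : 0 ∈ F := Finset.mem_insert_self _ _
  have hAF : ∀ t ∈ A, t ∈ F := fun t ht => Finset.mem_insert_of_mem ht
  obtain ⟨m₀, hm₀, hlim₀⟩ := exists_tendsto_ratio_zero hXm hXs hXrv h0
  have hF := hXrv F ⟨0, h0⟩
  obtain ⟨m, hm⟩ := hF.exists_tendsto_ratio (measurable_pi_lambda _ fun t => hXm _)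
    (g := fun z => min ‖z ⟨0, h0⟩‖ ‖fun t : A => z ⟨t, hAF t t.2⟩‖) (by fun_prop)
    (fun c hc z => by
      rw [mul_min_of_nonneg _ _ hc.le]
      change min ‖c • z ⟨0, h0⟩‖ ‖c • fun t : A => z ⟨t, hAF t t.2⟩‖ = _
      simp only [norm_smul, Real.norm_of_nonneg hc.le]) (C := 1)
    (fun z => by rw [one_mul]; exact (min_le_left _ _).trans (norm_le_pi_norm z _))
  refine ⟨1 - m / m₀, ?_⟩
  have h1 := (hm 1 one_pos).div (hlim₀ 1 one_pos) (by simpa using hm₀.ne')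
  simp only [Real.one_rpow, one_mul] at h1
  refine (h1.const_sub 1).congr' ?_
  filter_upwards [eventually_ge_atTop 0] with x hx
  have hT := tailProb_pos hXrv x
  rw [Pi.div_apply, div_div_div_cancel_right₀ (hF.tail_pos x).ne', eq_div_iff hT.ne', sub_mul,
    div_mul_cancel₀ _ hT.ne', one_mul, sub_eq_iff_eq_add, tailProb, quietProb,
    ← measureReal_union]
  · congr 1
    ext ω
    have : (∀ s ∈ A, ‖X s ω‖ ≤ x) ↔ ‖fun t : A => X t ω‖ ≤ x := by
      rw [pi_norm_le_iff_of_nonneg hx]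
      exact ⟨fun h s => h s s.2, fun h s hs => h ⟨s, hs⟩⟩
    simp only [Set.mem_union, Set.mem_ofPred_eq, lt_min_iff, Finset.mem_coe, this]
    have := le_or_gt ‖fun t : A => X t ω‖ x
    tauto
  · rw [Set.disjoint_left]
    rintro ω ⟨-, h⟩ h'
    have h2 := (lt_min_iff.1 h'.out).2
    refine absurd ((pi_norm_le_iff_of_nonneg hx).2 fun t : A => h t t.2) (not_le.2 h2)
  · refine measurableSet_lt measurable_const (Measurable.min (hXm _).norm ?_)
    exact (measurable_pi_lambda _ fun t : A => hXm t).norm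

end Field

/-! ### Invariant orders and cubes -/

section Order

variable {k : ℕ} {prec : Site k → Site k → Prop}

lemma InvariantOrder.asymm (h : InvariantOrder prec) {s t : Site k} (hst : prec s t) :
    ¬ prec t s := fun hts => h.irrefl _ (h.trans _ _ _ hst hts)

lemma InvariantOrder.flip (h : InvariantOrder prec) : InvariantOrder fun s t => prec t s where
  irrefl := h.irrefl
  trans _ _ _ hst htu := h.trans _ _ _ htu hst
  total _ _ hst := h.total _ _ (Ne.symm hst)
  add_right _ _ _ hst := h.add_right _ _ _ hst

lemma InvariantOrder.sub_pos (h : InvariantOrder prec) {s t : Site k} :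
    prec 0 (t - s) ↔ prec s t := by
  constructor
  · intro hst; simpa using h.add_right _ _ s hst
  · intro hst; simpa [sub_eq_add_neg] using h.add_right _ _ (-s) hst

lemma InvariantOrder.add_pos (h : InvariantOrder prec) {s t : Site k} (hs : prec 0 s)
    (ht : prec 0 t) : prec 0 (s + t) :=
  h.trans _ _ _ ht (by simpa using h.add_right _ _ t hs)

lemma InvariantOrder.neg_pos (h : InvariantOrder prec) {s : Site k} :
    prec 0 (-s) ↔ prec s 0 := by
  rw [← h.sub_pos (s := s), zero_sub]

lemma InvariantOrder.exists_last (h : InvariantOrder prec) {S : Set (Site k)} (hf : S.Finite)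
    (hne : S.Nonempty) : ∃ t ∈ S, ∀ s ∈ S, s = t ∨ prec s t := by
  induction S, hf using Set.Finite.induction_on with
  | empty => exact absurd hne Set.not_nonempty_empty
  | @insert a S _ _ ih =>
    rcases S.eq_empty_or_nonempty with rfl | hS
    · exact ⟨a, by simp, by simp⟩
    · obtain ⟨t, ht, hmax⟩ := ih hS
      by_cases hat : prec t a
      · refine ⟨a, Set.mem_insert _ _, ?_⟩
        rintro s (rfl | hs)
        · exact Or.inl rfl
        · rcases hmax s hs with rfl | h'
          · exact Or.inr hat
          · exact Or.inr (h.trans _ _ _ h' hat)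
      · refine ⟨t, Set.mem_insert_of_mem _ ht, ?_⟩
        rintro s (rfl | hs)
        · by_cases hst : s = t
          · exact Or.inl hst
          · exact Or.inr ((h.total _ _ hst).resolve_right hat)
        · exact hmax s hs

lemma InvariantOrder.exists_first (h : InvariantOrder prec) {S : Set (Site k)} (hf : S.Finite)
    (hne : S.Nonempty) : ∃ t ∈ S, ∀ s ∈ S, s = t ∨ prec t s := h.flip.exists_last hf hne

lemma cube_finite (k c : ℕ) : (cube k c).Finite :=
  (Set.finite_Icc (fun _ : Fin k => -(c : ℤ)) fun _ => (c : ℤ)).subset fun _ hu =>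
    ⟨fun i => (abs_le.1 (hu i)).1, fun i => (abs_le.1 (hu i)).2⟩

lemma zero_mem_cube (k c : ℕ) : (0 : Site k) ∈ cube k c := fun i => by simp

lemma cube_mono {k c c' : ℕ} (h : c ≤ c') : cube k c ⊆ cube k c' := fun _ hu i =>
  (hu i).trans (by exact_mod_cast h)

lemma eventually_mem_cube (u : Site k) : ∀ᶠ p in atTop, u ∈ cube k p := by
  refine eventually_all.2 fun i => ?_
  filter_upwards [eventually_ge_atTop (u i).natAbs] with p hp
  rw [Int.abs_eq_natAbs]
  exact_mod_cast hp

end Order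

/-! ### Decomposition of a block by its last exceedance -/

section Block

variable {k d : ℕ} {Ω : Type*} [MeasurableSpace Ω] {P : Measure Ω} [IsProbabilityMeasure P]
  {X : Site k → Ω → Vec d} {α : ℝ} {prec : Site k → Site k → Prop}

/-- `P(|X_0| > x, max_{R_{l,Λ}} |X| > x)`. -/
noncomputable def farProb (P : Measure Ω) (X : Site k → Ω → Vec d)
    (prec : Site k → Site k → Prop) (l : ℕ) (L : Finset (Site k)) (x : ℝ) : ℝ :=
  P.real {ω | x < ‖X 0 ω‖ ∧ ∃ i ∈ farDifferences prec l L, x < ‖X i ω‖}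

omit [IsProbabilityMeasure P] in
lemma IsStationaryField.quiet_shift (hXs : IsStationaryField P X) (hXm : ∀ t, Measurable (X t))
    (A : Set (Site k)) (t : Site k) (x : ℝ) :
    P.real {ω | x < ‖X t ω‖ ∧ ∀ s ∈ A, ‖X (s + t) ω‖ ≤ x} = quietProb P X A x := by
  have hS : MeasurableSet {z : Site k → Vec d | x < ‖z 0‖ ∧ ∀ s ∈ A, ‖z s‖ ≤ x} := by
    exact (measurableSet_lt measurable_const (measurable_pi_apply 0).norm).inter
      (measurableSet_quiet (X := fun s (z : Site k → Vec d) => z s) measurable_pi_apply A x)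
  have := hXs.measure_shift hXm hS t
  simp only [Set.mem_ofPred_eq, zero_add] at this
  rw [quietProb, measureReal_def, this, measureReal_def]

/-- If there is an exceedance in the finite block, exactly one site carries the last one.
Stationarity moves this site to the origin. -/
lemma measureReal_exists_eq_sum (hprec : InvariantOrder prec) (hXm : ∀ t, Measurable (X t))
    (hXs : IsStationaryField P X) (L : Finset (Site k)) (x : ℝ) :
    P.real {ω | ∃ t ∈ L, x < ‖X t ω‖} =
      ∑ t ∈ L, quietProb P X (upperPart prec (shiftBack L t)) x := by
  have hset : {ω | ∃ t ∈ L, x < ‖X t ω‖} = ⋃ t ∈ L,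
      {ω | x < ‖X t ω‖ ∧ ∀ s ∈ upperPart prec (shiftBack L t), ‖X (s + t) ω‖ ≤ x} := by
    ext ω
    simp only [Set.mem_ofPred_eq, Set.mem_iUnion, exists_prop]
    constructor
    · rintro ⟨t, ht, hxt⟩
      obtain ⟨t', ⟨ht', hxt'⟩, hmax⟩ := hprec.exists_last
        (S := {t | t ∈ L ∧ x < ‖X t ω‖}) (L.finite_toSet.subset fun s hs => hs.1) ⟨t, ht, hxt⟩
      refine ⟨t', ht', hxt', fun s hs => not_lt.1 fun hlt => ?_⟩
      have hpos : prec t' (s + t') := by simpa using hprec.add_right _ _ t' hs.2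
      rcases hmax (s + t') ⟨hs.1, hlt⟩ with h | h
      · rw [h] at hpos; exact hprec.irrefl _ hpos
      · exact hprec.asymm hpos h
    · rintro ⟨t, ht, hxt, -⟩
      exact ⟨t, ht, hxt⟩
  rw [hset, measureReal_biUnion_finset]
  · exact Finset.sum_congr rfl fun t _ => hXs.quiet_shift hXm _ t x
  · intro t ht t' ht' hne
    have key : ∀ s ∈ L, ∀ s' ∈ L, prec s s' → ∀ ω,
        (x < ‖X s ω‖ ∧ ∀ v ∈ upperPart prec (shiftBack L s), ‖X (v + s) ω‖ ≤ x) →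
        ¬ x < ‖X s' ω‖ := by
      intro s _ s' hs' hss ω hω
      have := hω.2 (s' - s) ⟨by simpa [shiftBack] using hs', hprec.sub_pos.2 hss⟩
      simpa using this
    refine Set.disjoint_left.2 fun ω hω hω' => ?_
    rcases hprec.total t t' hne with h | h
    · exact key t ht t' ht' h ω hω hω'.1
    · exact key t' ht' t ht h ω hω' hω.1
  · intro t _
    exact (measurableSet_tail hXm t x).inter (measurableSet_quiet (fun s => hXm (s + t)) _ x)

lemma upperPart_diff_cube_subset {L : Finset (Site k)} {t : Site k} (ht : t ∈ L) (l : ℕ) :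
    upperPart prec (shiftBack L t) \ cube k l ⊆ farDifferences prec l L := fun _ hi =>
  ⟨⟨Set.mem_iUnion₂.2 ⟨t, ht, hi.1.1⟩, hi.1.2⟩, hi.2⟩

lemma tailProb_le_quietProb_add_farProb (A : Set (Site k)) (l : ℕ) (L : Finset (Site k))
    (hA : A ⊆ farDifferences prec l L) (x : ℝ) :
    tailProb P X x ≤ quietProb P X A x + farProb P X prec l L x := by
  refine (measureReal_mono ?_ (measure_ne_top _ _)).trans (measureReal_union_le _ _)
  intro ω hω
  by_cases h : ∀ s ∈ A, ‖X s ω‖ ≤ x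
  · exact Or.inl ⟨hω, h⟩
  · push Not at h
    obtain ⟨s, hs, hlt⟩ := h
    exact Or.inr ⟨hω, s, hA hs, hlt⟩

/-- When the field is quiet on the local pattern but not on all later sites, the offending site lies
outside `K_p` and therefore among the far differences. -/
lemma quietProb_local_le {L : Finset (Site k)} {t : Site k} (ht : t ∈ L) (p : ℕ) (x : ℝ) :
    quietProb P X (localPattern prec L t p) x ≤
      quietProb P X (upperPart prec (shiftBack L t)) x + farProb P X prec p L x := by
  refine (measureReal_mono ?_ (measure_ne_top _ _)).trans (measureReal_union_le _ _)
  intro ω hω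
  by_cases h : ∀ s ∈ upperPart prec (shiftBack L t), ‖X s ω‖ ≤ x
  · exact Or.inl ⟨hω.1, h⟩
  · push Not at h
    obtain ⟨s, hs, hlt⟩ := h
    refine Or.inr ⟨hω.1, s, upperPart_diff_cube_subset ht p ⟨hs, fun hc => ?_⟩, hlt⟩
    exact absurd (hω.2 s ⟨⟨hs.1, hc⟩, hs.2⟩) (not_le.2 hlt)

lemma quietProb_upperPart_le (L : Finset (Site k)) (t : Site k) (p : ℕ) (x : ℝ) :
    quietProb P X (upperPart prec (shiftBack L t)) x ≤
      quietProb P X (localPattern prec L t p) x := by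
  refine quietProb_anti (fun s hs => ?_) x
  exact ⟨hs.1.1, hs.2⟩

/-- A lower bound for the probability of an exceedance in `L`: the exceedances that are followed
by no exceedance at distance more than `l` number at most `|K_l|`. -/
lemma card_mul_tailProb_le (hprec : InvariantOrder prec) (hXm : ∀ t, Measurable (X t))
    (hXs : IsStationaryField P X) (L : Finset (Site k)) (l : ℕ) (x : ℝ)
    (hfar : farProb P X prec l L x ≤ 1 / 2 * tailProb P X x) :
    (L.card : ℝ) * (1 / 2 * tailProb P X x) ≤
      (cube k l).ncard * P.real {ω | ∃ t ∈ L, x < ‖X t ω‖} := by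
  classical
  set G : Site k → Set Ω := fun t =>
    {ω | x < ‖X t ω‖ ∧ ∀ s ∈ upperPart prec (shiftBack L t) \ cube k l, ‖X (s + t) ω‖ ≤ x} with hG
  have hGm : ∀ t, MeasurableSet (G t) := fun t =>
    (measurableSet_tail hXm t x).inter (measurableSet_quiet (fun s => hXm (s + t)) _ x)
  have hEm : MeasurableSet {ω | ∃ t ∈ L, x < ‖X t ω‖} := measurableSet_loud hXm (↑L) x
  have hGp : ∀ t ∈ L, 1 / 2 * tailProb P X x ≤ P.real (G t) := by
    intro t ht
    rw [hG, hXs.quiet_shift hXm]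
    have := tailProb_le_quietProb_add_farProb (P := P) (X := X) _ l L
      (upperPart_diff_cube_subset (prec := prec) ht l) x
    linarith
  have hpt : ∀ ω, ∑ t ∈ L, (G t).indicator (1 : Ω → ℝ) ω ≤
      (cube k l).ncard * ({ω | ∃ t ∈ L, x < ‖X t ω‖}.indicator (1 : Ω → ℝ) ω) := by
    intro ω
    have hsum : ∑ t ∈ L, (G t).indicator (1 : Ω → ℝ) ω = ((L.filter fun t => ω ∈ G t).card : ℝ) := by
      rw [Finset.card_filter]
      push_cast
      refine Finset.sum_congr rfl fun t _ => ?_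
      by_cases h : ω ∈ G t <;> simp [h]
    rw [hsum]
    rcases (L.filter fun t => ω ∈ G t).eq_empty_or_nonempty with h0 | hne
    · rw [h0]
      simp only [Finset.card_empty, Nat.cast_zero]
      exact mul_nonneg (Nat.cast_nonneg _) (Set.indicator_nonneg (fun _ _ => zero_le_one) _)
    -- Take the first site counted. All others are later exceedances, and `t₀` has no later
    -- exceedance outside `t₀ + K_l`, so they all lie in this translate of the cube.
    · obtain ⟨t₀, ht₀, hfirst⟩ := hprec.exists_first (Finset.finite_toSet _) hne
      have ht₀ := Finset.mem_filter.1 ht₀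
      have hmem : ω ∈ {ω | ∃ t ∈ L, x < ‖X t ω‖} := ⟨t₀, ht₀.1, ht₀.2.1⟩
      rw [Set.indicator_of_mem hmem, Pi.one_apply, mul_one, Nat.cast_le,
        ← Set.ncard_coe_finset]
      refine Set.ncard_le_ncard_of_injOn (fun t => t - t₀) ?_ (fun _ _ _ _ h => sub_left_inj.1 h)
        (cube_finite k l)
      intro t ht
      rcases hfirst t ht with rfl | hlt
      · simpa using zero_mem_cube k l
      · by_contra hc
        have ht := Finset.mem_filter.1 ht
        have := ht₀.2.2 (t - t₀) ⟨⟨by simpa [shiftBack] using ht.1, hprec.sub_pos.2 hlt⟩, hc⟩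
        rw [sub_add_cancel] at this
        exact absurd ht.2.1 (not_lt.2 this)
  have hint : ∀ {S : Set Ω}, MeasurableSet S → Integrable (S.indicator (1 : Ω → ℝ)) P :=
    fun hS => (integrable_const 1).indicator hS
  calc (L.card : ℝ) * (1 / 2 * tailProb P X x) = ∑ t ∈ L, 1 / 2 * tailProb P X x := by simp
    _ ≤ ∑ t ∈ L, P.real (G t) := Finset.sum_le_sum hGp
    _ = ∫ ω, ∑ t ∈ L, (G t).indicator (1 : Ω → ℝ) ω ∂P := by
      rw [integral_finsetSum _ fun t _ => hint (hGm t)]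
      exact Finset.sum_congr rfl fun t _ => (integral_indicator_one (hGm t)).symm
    _ ≤ ∫ ω, (cube k l).ncard * ({ω | ∃ t ∈ L, x < ‖X t ω‖}.indicator (1 : Ω → ℝ) ω) ∂P :=
      integral_mono (integrable_finsetSum _ fun t _ => hint (hGm t))
        ((hint hEm).const_mul _) hpt
    _ = (cube k l).ncard * P.real {ω | ∃ t ∈ L, x < ‖X t ω‖} := by
      rw [integral_const_mul, integral_indicator_one hEm]

end Block

/-! ### Levels and anti-clustering along arbitrary levels -/

section Levels

variable {k d : ℕ} {Ω : Type*} [MeasurableSpace Ω] {P : Measure Ω} [IsProbabilityMeasure P]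
  {X : Site k → Ω → Vec d} {α : ℝ} {prec : Site k → Site k → Prop} {Λ : ℕ → Finset (Site k)}

/-- The tail probability at `u_n` tends to `0` but is positive at every fixed `M`, so `u_n` must
pass `M`. -/
lemma IsLevel.tendsto_atTop (hXrv : IsRegularlyVarying P X α)
    (hΛ : Tendsto (fun n => (Λ n).card) atTop atTop) {τ : ℝ} {u : ℕ → ℝ}
    (hu : IsLevel P X Λ τ u) : Tendsto u atTop atTop := by
  have hN : Tendsto (fun n => ((Λ n).card : ℝ)) atTop atTop :=
    tendsto_natCast_atTop_atTop.comp hΛ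
  have h0 : Tendsto (fun n => tailProb P X (u n)) atTop (𝓝 0) := by
    have := hu.mul hN.inv_tendsto_atTop
    rw [mul_zero] at this
    refine this.congr' ?_
    filter_upwards [hN.eventually_gt_atTop 0] with n hn
    simp only [Pi.inv_apply]
    rw [mul_comm, inv_mul_cancel_left₀ hn.ne']
    rfl
  refine Filter.tendsto_atTop.2 fun M => ?_
  filter_upwards [h0.eventually_lt_const (tailProb_pos hXrv M)] with n hn
  by_contra hM
  exact absurd (tailProb_antitone (P := P) (X := X) (not_le.1 hM).le) (not_le.2 hn)

lemma IsLevel.mul_const (hXm : ∀ t, Measurable (X t)) (hXs : IsStationaryField P X)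
    (hXrv : IsRegularlyVarying P X α) (hΛ : Tendsto (fun n => (Λ n).card) atTop atTop)
    {a : ℕ → ℝ} (ha : IsLevel P X Λ 1 a) {c : ℝ} (hc : 0 < c) :
    IsLevel P X Λ (c ^ (-α)) (fun n => a n * c) := by
  have h := ha.mul ((tendsto_tailProb_ratio hXm hXs hXrv hc).comp (ha.tendsto_atTop hXrv hΛ))
  rw [one_mul] at h
  refine h.congr fun n => ?_
  have := (tailProb_pos hXrv (a n)).ne'
  change _ * tailProb P X (a n) * (tailProb P X (c * a n) / tailProb P X (a n)) =
    _ * tailProb P X (a n * c)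
  rw [mul_comm c, mul_assoc, mul_div_cancel₀ _ this]

lemma exists_isLevel (hXm : ∀ t, Measurable (X t)) (hXs : IsStationaryField P X)
    (hXrv : IsRegularlyVarying P X α) (hα : 0 < α)
    (hΛ : Tendsto (fun n => (Λ n).card) atTop atTop) {a : ℕ → ℝ} (ha : IsLevel P X Λ 1 a)
    {τ : ℝ} (hτ : 0 < τ) : ∃ c : ℝ, 0 < c ∧ IsLevel P X Λ τ (fun n => a n * c) := by
  refine ⟨τ ^ (-α⁻¹), by positivity, ?_⟩
  have := ha.mul_const hXm hXs hXrv hΛ (c := τ ^ (-α⁻¹)) (by positivity)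
  rwa [← Real.rpow_mul hτ.le, neg_mul_neg, inv_mul_cancel₀ hα.ne', Real.rpow_one] at this

/-- The hypothesis speaks only of the levels `a_n x`. A general level is compared with a lower one
of this form, whose tail probability is larger by a bounded factor. -/
lemma AntiClustering.eventually_farProb_le (hXm : ∀ t, Measurable (X t))
    (hXs : IsStationaryField P X) (hXrv : IsRegularlyVarying P X α) (hα : 0 < α)
    (hΛ : Tendsto (fun n => (Λ n).card) atTop atTop) {a : ℕ → ℝ} (ha : IsLevel P X Λ 1 a)
    {r : ℕ → ℕ} (hAC : AntiClustering P X prec Λ a r) {τ : ℝ} (hτ : 0 < τ) {u : ℕ → ℝ}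
    (hu : IsLevel P X Λ τ u) {ε : ℝ} (hε : 0 < ε) :
    ∀ᶠ l in atTop, ∀ᶠ n in atTop,
      farProb P X prec l (Λ (r n)) (u n) ≤ ε * tailProb P X (u n) := by
  -- With the intensity `2 τ` the tail ratio tends to `2`. Being eventually above `1` it gives `a_n
  -- c < u_n`; being below `3` it accounts for the `ε / 3` below.
  obtain ⟨c, hc, hac⟩ := exists_isLevel hXm hXs hXrv hα hΛ ha (τ := 2 * τ) (by positivity)
  have hratio : Tendsto (fun n => tailProb P X (a n * c) / tailProb P X (u n)) atTop (𝓝 2) := by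
    have h := hac.div hu hτ.ne'
    rw [mul_div_cancel_right₀ _ hτ.ne'] at h
    refine h.congr' ?_
    filter_upwards [hΛ.eventually_gt_atTop 0] with n hn
    exact mul_div_mul_left _ _ (by exact_mod_cast hn.ne')
  filter_upwards [(hAC.tendsto_prob c hc).eventually_lt_const
    (ENNReal.ofReal_pos.2 (show 0 < ε / 3 by positivity))] with l hl
  filter_upwards [Filter.eventually_lt_of_limsup_lt hl, hratio.eventually_const_lt one_lt_two,
    hratio.eventually_lt_const (show (2 : ℝ) < 3 by norm_num)] with n h1 h2 h3
  have hT := tailProb_pos hXrv (u n)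
  have hTa := tailProb_pos hXrv (a n * c)
  rw [one_lt_div hT] at h2
  rw [div_lt_iff₀ hT] at h3
  have hlt : a n * c < u n := by
    by_contra hcon
    exact absurd (tailProb_antitone (P := P) (X := X) (not_lt.1 hcon)) (not_le.2 h2)
  have h4 : farProb P X prec l (Λ (r n)) (a n * c) ≤ ε / 3 * tailProb P X (a n * c) := by
    rw [cond_apply (measurableSet_tail hXm 0 _)] at h1
    have h5 := (ENNReal.toReal_lt_toReal h1.ne_top ENNReal.ofReal_ne_top).2 h1
    rw [ENNReal.toReal_mul, ENNReal.toReal_inv, ENNReal.toReal_ofReal (by positivity)] at h5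
    change (tailProb P X (a n * c))⁻¹ * farProb P X prec l (Λ (r n)) (a n * c) < ε / 3 at h5
    rw [inv_mul_lt_iff₀ hTa] at h5
    linarith
  have h5 : farProb P X prec l (Λ (r n)) (u n) ≤ farProb P X prec l (Λ (r n)) (a n * c) :=
    measureReal_mono fun ω hω => ⟨hlt.trans hω.1, hω.2.imp fun i hi => ⟨hi.1, hlt.trans hi.2⟩⟩
  have h6 : ε / 3 * tailProb P X (a n * c) ≤ ε / 3 * (3 * tailProb P X (u n)) := by gcongr
  linarith

end Levels

/-! ### Existence and positivity of the block extremal index -/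

section Index

variable {k d : ℕ} {Ω : Type*} [MeasurableSpace Ω] {P : Measure Ω} [IsProbabilityMeasure P]
  {X : Site k → Ω → Vec d} {α : ℝ} {prec : Site k → Site k → Prop} {Λ : ℕ → Finset (Site k)}

lemma card_mul_patternFrequency (L : Finset (Site k)) (hL : 0 < L.card) (D : Set (Site k)) (p : ℕ)
    [DecidablePred fun t => localPattern prec (↑L) t p = D ∩ cube k p] :
    L.card * patternFrequency prec L D p =
      (L.filter fun t => localPattern prec (↑L) t p = D ∩ cube k p).card := by
  rw [patternFrequency, mul_div_cancel₀ _ (by exact_mod_cast hL.ne'), ← Set.ncard_coe_finset,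
    Finset.coe_filter]

/-- Averages over `L` of a function of the local pattern, compared with the frequencies of finitely
many patterns. -/
lemma pattern_average_bounds {ι : Type*} {D : ι → Set (Site k)} (L : Finset (Site k))
    (hL : 0 < L.card) (J : Finset ι) (p : ℕ)
    (hinj : ∀ i ∈ J, ∀ j ∈ J, i ≠ j → D i ∩ cube k p ≠ D j ∩ cube k p)
    (g : Set (Site k) → ℝ) (hg0 : ∀ A, 0 ≤ g A) (hg1 : ∀ A, g A ≤ 1) :
    ∑ j ∈ J, patternFrequency prec L (D j) p * g (D j ∩ cube k p) ≤
        (∑ t ∈ L, g (localPattern prec L t p)) / L.card ∧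
      (∑ t ∈ L, g (localPattern prec L t p)) / L.card ≤
        ∑ j ∈ J, patternFrequency prec L (D j) p * g (D j ∩ cube k p) +
          (1 - ∑ j ∈ J, patternFrequency prec L (D j) p) := by
  classical
  have hN : (0 : ℝ) < L.card := by exact_mod_cast hL
  set S : ι → Finset (Site k) := fun j =>
    L.filter fun t => localPattern prec (↑L) t p = D j ∩ cube k p with hS
  have hcard : ∀ j, (L.card : ℝ) * patternFrequency prec L (D j) p = (S j).card := fun j =>
    card_mul_patternFrequency L hL (D j) p
  have hdisj : Set.PairwiseDisjoint (↑J) S := by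
    intro i hi j hj hij
    refine Finset.disjoint_left.2 fun t ht ht' => hinj i hi j hj hij ?_
    exact (Finset.mem_filter.1 ht).2.symm.trans (Finset.mem_filter.1 ht').2
  have hsub : J.biUnion S ⊆ L := Finset.biUnion_subset.2 fun j _ => Finset.filter_subset _ _
  have hsplit := Finset.sum_sdiff (f := fun t => g (localPattern prec L t p)) hsub
  have hcov : ∑ t ∈ J.biUnion S, g (localPattern prec L t p) =
      ∑ j ∈ J, L.card * (patternFrequency prec L (D j) p * g (D j ∩ cube k p)) := by
    rw [Finset.sum_biUnion hdisj]
    refine Finset.sum_congr rfl fun j _ => ?_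
    rw [← mul_assoc, hcard, ← nsmul_eq_mul]
    refine Finset.sum_eq_card_nsmul fun t ht => ?_
    rw [(Finset.mem_filter.1 ht).2]
  have hrest : ((L \ J.biUnion S).card : ℝ) =
      L.card - ∑ j ∈ J, L.card * patternFrequency prec L (D j) p := by
    rw [Finset.cast_card_sdiff hsub, Finset.card_biUnion fun i hi j hj hij => hdisj hi hj hij]
    push_cast
    simp only [hcard]
  rw [← Finset.mul_sum] at hcov hrest
  have h0 : 0 ≤ ∑ t ∈ L \ J.biUnion S, g (localPattern prec L t p) :=
    Finset.sum_nonneg fun t _ => hg0 _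
  have h1 : ∑ t ∈ L \ J.biUnion S, g (localPattern prec L t p) ≤ (L \ J.biUnion S).card := by
    refine (Finset.sum_le_sum fun t _ => hg1 _).trans (by simp)
  rw [le_div_iff₀ hN, div_le_iff₀ hN]
  constructor
  · linarith
  · nlinarith

lemma eventually_patterns_ne {ι : Type*} {D : ι → Set (Site k)} (hD : Function.Injective D)
    (J : Finset ι) : ∀ᶠ p in atTop, ∀ i ∈ J, ∀ j ∈ J, i ≠ j →
      D i ∩ cube k p ≠ D j ∩ cube k p := by
  rw [eventually_all_finset]
  intro i _
  rw [eventually_all_finset]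
  intro j _
  by_cases hij : i = j
  · exact Eventually.of_forall fun p h => absurd hij h
  · have : ∃ u, ¬ (u ∈ D i ↔ u ∈ D j) := by
      by_contra hcon
      push Not at hcon
      exact hij (hD (Set.ext fun u => by have := hcon u; tauto))
    obtain ⟨u, hu⟩ := this
    filter_upwards [eventually_mem_cube u] with p hp _ heq
    have := Set.ext_iff.1 heq u
    simp only [Set.mem_inter_iff, hp, and_true] at this
    exact hu this

/-- The block ratio and the average over the block of the normalized local functional. -/
lemma blockRatio_bounds (hprec : InvariantOrder prec) (hXm : ∀ t, Measurable (X t))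
    (hXs : IsStationaryField P X) (hXrv : IsRegularlyVarying P X α) (L : Finset (Site k))
    (hL : 0 < L.card) (p : ℕ) (x : ℝ) {ε : ℝ}
    (hfar : farProb P X prec p L x ≤ ε * tailProb P X x) :
    P.real {ω | ∃ t ∈ L, x < ‖X t ω‖} / (L.card * tailProb P X x) ≤
        (∑ t ∈ L, quietProb P X (localPattern prec L t p) x / tailProb P X x) / L.card ∧
      (∑ t ∈ L, quietProb P X (localPattern prec L t p) x / tailProb P X x) / L.card - ε ≤
        P.real {ω | ∃ t ∈ L, x < ‖X t ω‖} / (L.card * tailProb P X x) := by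
  have hN : (0 : ℝ) < L.card := by exact_mod_cast hL
  have hT := tailProb_pos hXrv x
  rw [measureReal_exists_eq_sum hprec hXm hXs, ← Finset.sum_div, div_div, mul_comm (tailProb P X x)]
  constructor
  · gcongr with t _
    exact quietProb_upperPart_le L t p x
  · rw [sub_le_iff_le_add, div_add' _ _ _ (by positivity)]
    gcongr
    calc ∑ t ∈ L, quietProb P X (localPattern prec L t p) x
        ≤ ∑ t ∈ L, (quietProb P X (upperPart prec (shiftBack L t)) x + ε * tailProb P X x) :=
          Finset.sum_le_sum fun t ht => (quietProb_local_le ht p x).trans (by gcongr)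
      _ = _ := by
        rw [Finset.sum_add_distrib]
        simp only [Finset.sum_const, nsmul_eq_mul]
        ring

/-- The block extremal index exists and is the weighted sum of the limits `π j`. -/
theorem exists_blockExtremalIndex (hXm : ∀ t, Measurable (X t))
    (hα : 0 < α) (hXs : IsStationaryField P X) (hXrv : IsRegularlyVarying P X α)
    (hprec : InvariantOrder prec)
    (hΛ : Tendsto (fun n => (Λ n).card) atTop atTop)
    {ι : Type*} {D : ι → Set (Site k)} {lam : ι → ℝ} (hD : PatternCondition prec Λ D lam)
    {a : ℕ → ℝ} (ha : IsLevel P X Λ 1 a) {r : ℕ → ℕ} (hAC : AntiClustering P X prec Λ a r)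
    {ρ : Set (Site k) → ℝ} (hρ : ∀ A : Set (Site k), A.Finite →
      Tendsto (fun x : ℝ => quietProb P X A x / tailProb P X x) atTop (𝓝 (ρ A))) :
    ∃ (π : ι → ℝ) (θ : ℝ), (∀ j, 0 ≤ π j) ∧
      (∀ j, Tendsto (fun p => ρ (D j ∩ cube k p)) atTop (𝓝 (π j))) ∧
      HasSum (fun j => lam j * π j) θ ∧ 0 < θ ∧ θ ≤ 1 ∧
      ∀ τ : ℝ, 0 < τ → ∀ u : ℕ → ℝ, IsLevel P X Λ τ u →
        Tendsto (blockRatio P X Λ r u) atTop (𝓝 θ) := by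
  have hfinD : ∀ j p, (D j ∩ cube k p).Finite := fun j p => (cube_finite k p).inter_of_right _
  have hg0 : ∀ (A : Set (Site k)) x, 0 ≤ quietProb P X A x / tailProb P X x := fun A x =>
    div_nonneg (quietProb_nonneg A x) (tailProb_pos hXrv x).le
  have hg1 : ∀ (A : Set (Site k)) x, quietProb P X A x / tailProb P X x ≤ 1 := fun A x =>
    div_le_one_of_le₀ (quietProb_le_tailProb A x) (tailProb_pos hXrv x).le
  have hρ0 : ∀ A : Set (Site k), A.Finite → 0 ≤ ρ A := fun A hA =>
    ge_of_tendsto (hρ A hA) (Eventually.of_forall (hg0 A))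
  have hρ1 : ∀ A : Set (Site k), A.Finite → ρ A ≤ 1 := fun A hA =>
    le_of_tendsto (hρ A hA) (Eventually.of_forall (hg1 A))
  have hanti : ∀ j, Antitone fun p => ρ (D j ∩ cube k p) := by
    intro j p q hpq
    refine le_of_tendsto_of_tendsto (hρ _ (hfinD j q)) (hρ _ (hfinD j p))
      (Eventually.of_forall fun x => ?_)
    have := (tailProb_pos hXrv x).le
    dsimp only
    gcongr
    exact quietProb_anti (Set.inter_subset_inter_right _ (cube_mono hpq)) x
  -- A larger cube asks for more quiet, so the limits decrease in `p`.
  set π : ι → ℝ := fun j => ⨅ p, ρ (D j ∩ cube k p) with hπdef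
  have hπ : ∀ j, Tendsto (fun p => ρ (D j ∩ cube k p)) atTop (𝓝 (π j)) := fun j =>
    tendsto_atTop_ciInf (hanti j) ⟨0, by rintro _ ⟨p, rfl⟩; exact hρ0 _ (hfinD j p)⟩
  have hπ0 : ∀ j, 0 ≤ π j := fun j =>
    ge_of_tendsto (hπ j) (Eventually.of_forall fun p => hρ0 _ (hfinD j p))
  have hπ1 : ∀ j, π j ≤ 1 := fun j =>
    le_of_tendsto (hπ j) (Eventually.of_forall fun p => hρ1 _ (hfinD j p))
  obtain ⟨lamp, hlamp, hlam⟩ := hD.exists_limits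
  have hlam0 : ∀ j, 0 ≤ lam j := fun j => (hD.weight_pos j).le
  have hle : ∀ j, lam j * π j ≤ lam j := fun j => mul_le_of_le_one_right (hlam0 j) (hπ1 j)
  have hsummable : Summable fun j => lam j * π j :=
    Summable.of_nonneg_of_le (fun j => mul_nonneg (hlam0 j) (hπ0 j)) hle hD.hasSum_weight.summable
  obtain ⟨θ, hθ⟩ := hsummable
  have hN : Tendsto (fun n => (Λ (r n)).card) atTop atTop := hΛ.comp hAC.tendsto_r
  have hlim : ∀ τ : ℝ, 0 < τ → ∀ u : ℕ → ℝ, IsLevel P X Λ τ u →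
      Tendsto (blockRatio P X Λ r u) atTop (𝓝 θ) := by
    intro τ hτ u hu
    have huinf := hu.tendsto_atTop hXrv hΛ
    have hkey : ∀ ε : ℝ, 0 < ε → ∃ b : ℕ → ℝ, ∃ b' : ℕ → ℝ, ∃ β β' : ℝ,
        Tendsto b atTop (𝓝 β) ∧ Tendsto b' atTop (𝓝 β') ∧ θ - 3 * ε ≤ β ∧ β' ≤ θ + 2 * ε ∧
        (∀ᶠ n in atTop, b n ≤ blockRatio P X Λ r u n) ∧
        (∀ᶠ n in atTop, blockRatio P X Λ r u n ≤ b' n) := by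
      intro ε hε
      -- The finite set `J` leaves out at most `ε` of the weight and of `θ`. The lower bound loses
      -- `ε` each to `J`, to `p` and to the far exceedances; the upper bound loses `ε` each to the
      -- patterns outside `J` and to `p`.
      obtain ⟨J, hJ1, hJ2⟩ := ((hD.hasSum_weight.eventually_const_lt (show 1 - ε < 1 by linarith)).and
        (hθ.eventually_const_lt (show θ - ε < θ by linarith))).exists
      have hJ3 : ∑ j ∈ J, lam j * π j ≤ θ :=
        sum_le_hasSum J (fun j _ => mul_nonneg (hlam0 j) (hπ0 j)) hθ
      have hA : Tendsto (fun p => ∑ j ∈ J, lamp j p * ρ (D j ∩ cube k p)) atTop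
          (𝓝 (∑ j ∈ J, lam j * π j)) := tendsto_finsetSum _ fun j _ => (hlam j).mul (hπ j)
      have hB : Tendsto (fun p => ∑ j ∈ J, lamp j p * ρ (D j ∩ cube k p) +
          (1 - ∑ j ∈ J, lamp j p)) atTop
          (𝓝 (∑ j ∈ J, lam j * π j + (1 - ∑ j ∈ J, lam j))) :=
        hA.add ((tendsto_finsetSum _ fun j _ => hlam j).const_sub 1)
      obtain ⟨p, ⟨⟨hpA, hpB⟩, hpinj⟩, hpfar⟩ := (((hA.eventually_const_lt
        (show ∑ j ∈ J, lam j * π j - ε < _ by linarith)).and (hB.eventually_lt_const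
        (show _ < ∑ j ∈ J, lam j * π j + (1 - ∑ j ∈ J, lam j) + ε by linarith))).and
        (eventually_patterns_ne hD.injective J)).and
        (hAC.eventually_farProb_le hXm hXs hXrv hα hΛ ha hτ hu hε) |>.exists
      have hfreq : ∀ j, Tendsto (fun n => patternFrequency prec (Λ (r n)) (D j) p) atTop
          (𝓝 (lamp j p)) := fun j => (hlamp j p).comp hAC.tendsto_r
      have hgl : ∀ j, Tendsto (fun n => quietProb P X (D j ∩ cube k p) (u n) / tailProb P X (u n))
          atTop (𝓝 (ρ (D j ∩ cube k p))) := fun j => (hρ _ (hfinD j p)).comp huinf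
      have hsum : Tendsto (fun n => ∑ j ∈ J, patternFrequency prec (Λ (r n)) (D j) p *
          (quietProb P X (D j ∩ cube k p) (u n) / tailProb P X (u n))) atTop
          (𝓝 (∑ j ∈ J, lamp j p * ρ (D j ∩ cube k p))) :=
        tendsto_finsetSum _ fun j _ => (hfreq j).mul (hgl j)
      refine ⟨_, _, _, _, hsum.sub_const ε,
        hsum.add ((tendsto_finsetSum _ fun j _ => hfreq j).const_sub 1), by linarith,
        by linarith, ?_, ?_⟩
      · filter_upwards [hpfar, hN.eventually_gt_atTop 0] with n hn hn0
        have h1 := (blockRatio_bounds hprec hXm hXs hXrv _ hn0 p (u n) hn).2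
        have h2 := (pattern_average_bounds (prec := prec) _ hn0 J p hpinj
          (fun A => quietProb P X A (u n) / tailProb P X (u n)) (fun A => hg0 A _)
          (fun A => hg1 A _)).1
        exact (sub_le_sub_right h2 ε).trans h1
      · filter_upwards [hpfar, hN.eventually_gt_atTop 0] with n hn hn0
        have h1 := (blockRatio_bounds hprec hXm hXs hXrv _ hn0 p (u n) hn).1
        have h2 := (pattern_average_bounds (prec := prec) _ hn0 J p hpinj
          (fun A => quietProb P X A (u n) / tailProb P X (u n)) (fun A => hg0 A _)
          (fun A => hg1 A _)).2
        exact h1.trans h2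
    rw [tendsto_order]
    constructor
    · intro y hy
      obtain ⟨b, -, β, -, hb, -, hβ, -, hle, -⟩ := hkey ((θ - y) / 4) (by linarith)
      filter_upwards [hle, hb.eventually_const_lt (show y < β by linarith)] with n h1 h2
      exact h2.trans_le h1
    · intro y hy
      obtain ⟨-, b, -, β, -, hb, -, hβ, -, hle⟩ := hkey ((y - θ) / 4) (by linarith)
      filter_upwards [hle, hb.eventually_lt_const (show β < y by linarith)] with n h1 h2
      exact h1.trans_lt h2
  refine ⟨π, θ, hπ0, hπ, hθ, ?_, ?_, hlim⟩
  -- With far exceedances of conditional probability at most `1/2`, the count keeps the block ratio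
  -- above `1 / (2 |K_l|)`.
  · obtain ⟨l, hl⟩ := (hAC.eventually_farProb_le hXm hXs hXrv hα hΛ ha one_pos ha
      (show (0 : ℝ) < 1 / 2 by norm_num)).exists
    have hc : (0 : ℝ) < (cube k l).ncard := by
      exact_mod_cast (Set.ncard_pos (cube_finite k l)).2 ⟨0, zero_mem_cube k l⟩
    refine (show (0 : ℝ) < 1 / 2 / (cube k l).ncard by positivity).trans_le
      (ge_of_tendsto (hlim 1 one_pos a ha) ?_)
    filter_upwards [hl, hN.eventually_gt_atTop 0] with n hn hn0
    have hn0' : (0 : ℝ) < (Λ (r n)).card := by exact_mod_cast hn0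
    have hT := tailProb_pos hXrv (a n)
    have h := card_mul_tailProb_le hprec hXm hXs (Λ (r n)) l (a n) hn
    change _ ≤ _ / (((Λ (r n)).card : ℝ) * tailProb P X (a n))
    rw [div_le_div_iff₀ hc (by positivity)]
    linarith
  · exact (hasSum_le hle hθ hD.hasSum_weight)

end Index

/-! ### From blocks to the extremal index -/

section Mixing

variable {k d : ℕ} {Ω : Type*} [MeasurableSpace Ω] {P : Measure Ω} [IsProbabilityMeasure P]
  {X : Site k → Ω → Vec d} {α : ℝ} {Λ : ℕ → Finset (Site k)}

/-- For `m < 1` one has `exp(-m / (1 - m)) ≤ 1 - m ≤ exp(-m)`, and `m_n → 0`. No sign condition on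
`m_n` is needed. -/
lemma tendsto_one_sub_pow_exp {κ : ℕ → ℕ} {m : ℕ → ℝ} {t : ℝ}
    (hκ : Tendsto κ atTop atTop) (hm : Tendsto (fun n => κ n * m n) atTop (𝓝 t)) :
    Tendsto (fun n => (1 - m n) ^ κ n) atTop (𝓝 (Real.exp (-t))) := by
  have hκ' : Tendsto (fun n => (κ n : ℝ)) atTop atTop := tendsto_natCast_atTop_atTop.comp hκ
  have hm0 : Tendsto m atTop (𝓝 0) := by
    have := hm.mul hκ'.inv_tendsto_atTop
    rw [mul_zero] at this
    refine this.congr' ?_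
    filter_upwards [hκ'.eventually_gt_atTop 0] with n hn
    simp only [Pi.inv_apply]
    field_simp
  have hlt : ∀ᶠ n in atTop, m n < 1 := hm0.eventually_lt_const one_pos
  have hlow : Tendsto (fun n => Real.exp (-(κ n * m n) / (1 - m n))) atTop (𝓝 (Real.exp (-t))) := by
    have := hm.neg.div (hm0.const_sub 1) (by simp)
    rw [sub_zero, div_one] at this
    exact (Real.continuous_exp.tendsto _).comp this
  have hup : Tendsto (fun n => Real.exp (-(κ n * m n))) atTop (𝓝 (Real.exp (-t))) :=
    (Real.continuous_exp.tendsto _).comp hm.neg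
  refine tendsto_of_tendsto_of_tendsto_of_le_of_le' hlow hup ?_ ?_
  · filter_upwards [hlt] with n hn
    have h1 : 0 < 1 - m n := by linarith
    have h2 : Real.exp (-(m n) / (1 - m n)) ≤ 1 - m n := by
      rw [← Real.le_log_iff_exp_le h1]
      refine le_trans (le_of_eq ?_) (Real.one_sub_inv_le_log_of_pos h1)
      field_simp
      ring
    calc Real.exp (-(κ n * m n) / (1 - m n)) = Real.exp (-(m n) / (1 - m n)) ^ κ n := by
          rw [← Real.exp_nat_mul]; congr 1; ring
      _ ≤ _ := by gcongr
  · filter_upwards [hlt] with n hn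
    have h1 : 0 ≤ 1 - m n := by linarith
    calc (1 - m n) ^ κ n ≤ Real.exp (-(m n)) ^ κ n := by
          gcongr
          have := Real.add_one_le_exp (-(m n))
          linarith
      _ = _ := by rw [← Real.exp_nat_mul]; congr 1; ring

/-- Rounding down loses less than one block, which is at most the fraction `1 / k_n` of the whole.
-/
lemma tendsto_blockCount_mul_div {N M : ℕ → ℕ} (hM : ∀ᶠ n in atTop, 0 < M n)
    (hk : Tendsto (fun n => N n / M n) atTop atTop) :
    Tendsto (fun n => ((N n / M n : ℕ) : ℝ) * M n / N n) atTop (𝓝 1) := by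
  have hk' : Tendsto (fun n => ((N n / M n : ℕ) : ℝ)) atTop atTop :=
    tendsto_natCast_atTop_atTop.comp hk
  have hlow : Tendsto (fun n => 1 - (((N n / M n : ℕ) : ℝ))⁻¹) atTop (𝓝 1) := by
    simpa using hk'.inv_tendsto_atTop.const_sub 1
  have hpos : ∀ᶠ n in atTop, 0 < M n ∧ 0 < N n / M n := hM.and (hk.eventually_gt_atTop 0)
  refine tendsto_of_tendsto_of_tendsto_of_le_of_le' hlow tendsto_const_nhds ?_ ?_
  · filter_upwards [hpos] with n ⟨h1, h2⟩
    have h3 : N n / M n * M n ≤ N n := Nat.div_mul_le_self _ _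
    have h4 : N n < N n / M n * M n + M n := by
      have := Nat.div_add_mod' (N n) (M n)
      have := Nat.mod_lt (N n) h1
      omega
    have h0 : 0 < N n := lt_of_lt_of_le (Nat.mul_pos h2 h1) h3
    generalize N n / M n = K at *
    have h0' : (0 : ℝ) < N n := by exact_mod_cast h0
    have h2' : (0 : ℝ) < K := by exact_mod_cast h2
    have h3' : (K : ℝ) * M n ≤ N n := by exact_mod_cast h3
    have h4' : (N n : ℝ) < K * M n + M n := by exact_mod_cast h4
    rw [le_div_iff₀ h0', sub_mul, one_mul, inv_mul_eq_div]
    have : (M n : ℝ) ≤ N n / K := by rw [le_div_iff₀ h2']; linarith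
    linarith
  · filter_upwards [hpos] with n ⟨h1, h2⟩
    have h3 : N n / M n * M n ≤ N n := Nat.div_mul_le_self _ _
    have h3' : ((N n / M n : ℕ) : ℝ) * M n ≤ N n := by exact_mod_cast h3
    exact div_le_one_of_le₀ h3' (Nat.cast_nonneg _)

/-- The product of `k_n` and the exceedance probability of a block factors into `k_n |Λ_{r_n}| /
|Λ_n| → 1`, the level intensity and the block ratio. The levels are taken of the form `a_n c`
because mixing is assumed along these only. -/
lemma MaxMixing.isExtremalIndex (hXm : ∀ t, Measurable (X t)) (hα : 0 < α)
    (hXs : IsStationaryField P X) (hXrv : IsRegularlyVarying P X α)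
    (hΛ : Tendsto (fun n => (Λ n).card) atTop atTop) {a : ℕ → ℝ} (ha : IsLevel P X Λ 1 a)
    {r : ℕ → ℕ} (hr : Tendsto r atTop atTop) (hk : Tendsto (blockCount Λ r) atTop atTop)
    (hmix : MaxMixing P X Λ a r) {θ : ℝ} (hθ0 : 0 ≤ θ) (hθ1 : θ ≤ 1)
    (hθ : ∀ τ : ℝ, 0 < τ → ∀ u : ℕ → ℝ, IsLevel P X Λ τ u →
      Tendsto (blockRatio P X Λ r u) atTop (𝓝 θ)) : IsExtremalIndex P X Λ θ := by
  refine ⟨⟨hθ0, hθ1⟩, fun τ hτ => ?_⟩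
  obtain ⟨c, hc, hu⟩ := exists_isLevel hXm hXs hXrv hα hΛ ha hτ
  refine ⟨_, hu, ?_⟩
  have hM : ∀ᶠ n in atTop, 0 < (Λ (r n)).card := (hΛ.comp hr).eventually_gt_atTop 0
  have h1 := tendsto_blockCount_mul_div hM hk
  have h2 := ((h1.mul hu).mul (hθ τ hτ _ hu))
  have h3 : Tendsto (fun n => (blockCount Λ r n : ℝ) *
      P.real {ω | ∃ t ∈ Λ (r n), a n * c < ‖X t ω‖}) atTop (𝓝 (θ * τ)) := by
    rw [one_mul, mul_comm τ] at h2
    refine h2.congr' ?_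
    filter_upwards [hM, hΛ.eventually_gt_atTop 0] with n hn hn'
    have hT : P.real {ω | a n * c < ‖X 0 ω‖} ≠ 0 := (tailProb_pos hXrv (a n * c)).ne'
    have h5 : ((Λ n).card : ℝ) ≠ 0 := by exact_mod_cast hn'.ne'
    have h6 : ((Λ (r n)).card : ℝ) ≠ 0 := by exact_mod_cast hn.ne'
    simp only [blockRatio, blockCount]
    field_simp
  have h4 := tendsto_one_sub_pow_exp hk h3
  have h5 := (hmix c hc).add h4
  rw [zero_add, ← neg_mul] at h5
  refine h5.congr fun n => ?_
  have : P.real {ω | ∀ t ∈ Λ (r n), ‖X t ω‖ ≤ a n * c} =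
      1 - P.real {ω | ∃ t ∈ Λ (r n), a n * c < ‖X t ω‖} := by
    refine Eq.trans ?_ (probReal_compl_eq_one_sub (measurableSet_loud hXm (Λ (r n)) (a n * c)))
    congr 1
    ext ω
    simp
  rw [this]
  ring

end Mixing

/-! ### Shifted configurations and tail laws -/

/-- The configuration `x` moved by `t`. -/
def shiftConf {k d : ℕ} (t : Site k) (x : Site k → Vec d) : Site k → Vec d := fun s => x (s - t)

/-- The law of a tail field: a probability measure with Pareto distributed norm at the origin that
satisfies the time change formula. -/
structure IsTailLaw {k d : ℕ} (α : ℝ) (M : Measure (Site k → Vec d)) : Prop where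
  prob : IsProbabilityMeasure M
  pareto : ∀ y : ℝ, 1 ≤ y → M {x | y < ‖x 0‖} = ENNReal.ofReal (y ^ (-α))
  change : ∀ (t : Site k) (y : ℝ), 0 < y →
    M.restrict {x | 1 < ‖x 0‖ ∧ y < ‖x t‖} = ENNReal.ofReal (y ^ (-α)) •
      (M.map fun x => y • shiftConf t x).restrict {x | 1 < ‖x 0‖ ∧ y < ‖x t‖}

section Shift

variable {k d : ℕ}

lemma measurable_shiftConf (t : Site k) : Measurable (shiftConf (d := d) t) :=
  measurable_pi_lambda _ fun _ => measurable_pi_apply _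

lemma measurable_smul_shiftConf (y : ℝ) (t : Site k) :
    Measurable fun x : Site k → Vec d => y • shiftConf t x :=
  measurable_pi_lambda _ fun _ => (measurable_pi_apply _).const_smul y

lemma measurable_norm_site (t : Site k) : Measurable fun x : Site k → Vec d => ‖x t‖ :=
  (measurable_pi_apply t).norm

lemma measurable_enorm_site (t : Site k) : Measurable fun x : Site k → Vec d => ‖x t‖ₑ :=
  (measurable_pi_apply t).enorm

lemma tendsto_ramp {a : ℝ} (r : ℝ) :
    Tendsto (fun n : ℕ => ramp a (a + 1 / ((n : ℝ) + 1)) r) atTop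
      (𝓝 ((Set.Ioi a).indicator 1 r)) := by
  have hlt : ∀ n : ℕ, a < a + 1 / ((n : ℝ) + 1) := fun n => by
    have : (0 : ℝ) < 1 / ((n : ℝ) + 1) := by positivity
    linarith
  by_cases h : a < r
  · rw [Set.indicator_of_mem (Set.mem_Ioi.2 h)]
    refine tendsto_const_nhds.congr' ?_
    filter_upwards [tendsto_one_div_add_atTop_nhds_zero_nat.eventually_lt_const (sub_pos.2 h)]
      with n hn
    exact (ramp_of_ge (hlt n) (by linarith)).symm
  · rw [Set.indicator_of_notMem (by simpa using h)]
    exact tendsto_const_nhds.congr fun n => (ramp_of_le (hlt n) (not_lt.1 h)).symm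

end Shift

/-! ### The time change formula for a tail field -/

section TailField

variable {k d : ℕ} {Ω : Type*} [MeasurableSpace Ω] {P : Measure Ω} [IsProbabilityMeasure P]
  {X : Site k → Ω → Vec d} {α : ℝ} {Ω' : Type*} [MeasurableSpace Ω'] {P' : Measure Ω'}
  [IsProbabilityMeasure P'] {Y : Site k → Ω' → Vec d}

omit [IsProbabilityMeasure P] [IsProbabilityMeasure P'] in
-- Since `g` vanishes unless the origin exceeds, conditioning on `|X_0| > x` amounts to division by
-- its probability.
lemma IsTailField.tendsto_integral_div (hY : IsTailField P X α P' Y)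
    {F : Finset (Site k)} (h0 : 0 ∈ F) (g : (F → Vec d) →ᵇ ℝ)
    (hg : ∀ z, ‖z ⟨0, h0⟩‖ ≤ 1 → g z = 0) :
    Tendsto (fun x : ℝ => (∫ ω, g (fun t => x⁻¹ • X t ω) ∂P) / tailProb P X x) atTop
      (𝓝 (∫ ω, g (fun t => Y t ω) ∂P')) := by
  refine (hY.tendsto_fdd F g).congr' ?_
  filter_upwards [eventually_gt_atTop 0] with x hx
  rw [ProbabilityTheory.cond, integral_smul_measure, setIntegral_eq_integral_of_forall_compl_eq_zero]
  · rw [smul_eq_mul, ENNReal.toReal_inv, inv_mul_eq_div]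
    rfl
  · intro ω hω
    refine hg _ ?_
    have hω : ‖X 0 ω‖ ≤ x := not_lt.1 hω
    change ‖x⁻¹ • X 0 ω‖ ≤ 1
    rw [norm_smul, norm_inv, Real.norm_of_nonneg hx.le, inv_mul_le_one₀ hx]
    exact hω

omit [IsProbabilityMeasure P'] in
-- The same expectation of the field is read in two ways: at threshold `x` around the origin, and,
-- after a shift by stationarity, at threshold `y x` around `t`. The normalizations differ by the
-- tail ratio, which tends to `y^(-α)`.
lemma IsTailField.integral_time_change (hY : IsTailField P X α P' Y)
    (hXm : ∀ t, Measurable (X t)) (hXs : IsStationaryField P X)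
    (hXrv : IsRegularlyVarying P X α) {F : Finset (Site k)} (h0 : 0 ∈ F) {t : Site k} (ht : t ∈ F)
    {y : ℝ} (hy : 0 < y) (g : (F → Vec d) →ᵇ ℝ)
    (hg : ∀ z, ‖z ⟨0, h0⟩‖ ≤ 1 → g z = 0) (hgt : ∀ z, ‖z ⟨t, ht⟩‖ ≤ y → g z = 0) :
    ∫ ω, g (fun s => Y s ω) ∂P' = y ^ (-α) * ∫ ω, g (fun s => y • Y (s - t) ω) ∂P' := by
  classical
  set F' : Finset (Site k) := F.image fun s => s - t with hF'
  have h0' : (0 : Site k) ∈ F' := Finset.mem_image.2 ⟨t, ht, sub_self t⟩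
  have hmem : ∀ s : F, (s : Site k) - t ∈ F' := fun s => Finset.mem_image_of_mem _ s.2
  have hcont : Continuous fun (z : F' → Vec d) (s : F) => y • z ⟨s - t, hmem s⟩ := by fun_prop
  let g' : (F' → Vec d) →ᵇ ℝ := g.compContinuous ⟨_, hcont⟩
  have hg' : ∀ z, ‖z ⟨0, h0'⟩‖ ≤ 1 → g' z = 0 := by
    intro z hz
    refine hgt _ ?_
    have : (⟨t - t, hmem ⟨t, ht⟩⟩ : F') = ⟨0, h0'⟩ := Subtype.ext (sub_self t)
    change ‖y • z ⟨t - t, hmem ⟨t, ht⟩⟩‖ ≤ y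
    rw [this, norm_smul, Real.norm_of_nonneg hy.le]
    exact mul_le_of_le_one_right hy.le hz
  have h1 := hY.tendsto_integral_div h0 g hg
  have h2 := (hY.tendsto_integral_div h0' g' hg').comp (tendsto_id.const_mul_atTop hy)
  have h3 := (tendsto_tailProb_ratio hXm hXs hXrv hy).mul h2
  refine tendsto_nhds_unique (h1.congr' ?_) h3
  filter_upwards [eventually_gt_atTop 0] with x hx
  have hT := (tailProb_pos hXrv (y * x)).ne'
  simp only [Function.comp_apply, id]
  rw [div_mul_div_comm, mul_comm (tailProb P X x), mul_div_mul_left _ _ hT]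
  congr 1
  have hmeas : Measurable fun z : Site k → Vec d => g fun s : F => x⁻¹ • z s :=
    g.continuous.measurable.comp
      (measurable_pi_lambda _ fun s => (measurable_pi_apply (s : Site k)).const_smul x⁻¹)
  have h4 := congrArg (fun μ => ∫ z, g (fun s : F => x⁻¹ • z s) ∂μ) (hXs (-t))
  rw [integral_map (measurable_pi_lambda _ fun s => hXm _).aemeasurable
      hmeas.aestronglyMeasurable,
    integral_map (measurable_pi_lambda _ fun s => hXm _).aemeasurable
      hmeas.aestronglyMeasurable] at h4
  rw [← h4]
  refine integral_congr_ae (Eventually.of_forall fun ω => ?_)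
  refine congrArg g (funext fun s => ?_)
  change x⁻¹ • X (s + -t) ω = y • (y * x)⁻¹ • X (s - t) ω
  rw [smul_smul, ← sub_eq_add_neg, mul_inv, mul_inv_cancel_left₀ hy.ne']

/-- The law of a random field. -/
noncomputable def fieldLaw (P' : Measure Ω') (Y : Site k → Ω' → Vec d) :
    Measure (Site k → Vec d) := P'.map fun ω t => Y t ω

/-- The formula for continuous functions passes to the discontinuous restriction by multiplying an
arbitrary test function with ramps that increase to the indicators of `|x_0| > 1` and `|x_t| > y`.
-/
lemma IsTailField.restrict_map_eq (hY : IsTailField P X α P' Y)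
    (hXm : ∀ t, Measurable (X t)) (hXs : IsStationaryField P X)
    (hXrv : IsRegularlyVarying P X α) {F : Finset (Site k)} (h0 : 0 ∈ F) {t : Site k} (ht : t ∈ F)
    {y : ℝ} (hy : 0 < y) :
    ((fieldLaw P' Y).restrict {x | 1 < ‖x 0‖ ∧ y < ‖x t‖}).map F.restrict =
      (ENNReal.ofReal (y ^ (-α)) • ((fieldLaw P' Y).map fun x => y • shiftConf t x).restrict
        {x | 1 < ‖x 0‖ ∧ y < ‖x t‖}).map F.restrict := by
  have hYm : Measurable fun ω t => Y t ω := measurable_pi_lambda _ hY.measurable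
  have : IsProbabilityMeasure (fieldLaw P' Y) :=
    Measure.isProbabilityMeasure_map hYm.aemeasurable
  have hpm := measurable_smul_shiftConf (d := d) y t
  have : IsProbabilityMeasure ((fieldLaw P' Y).map fun x => y • shiftConf t x) :=
    Measure.isProbabilityMeasure_map hpm.aemeasurable
  have hres : Measurable (F.restrict : (Site k → Vec d) → F → Vec d) :=
    measurable_pi_lambda _ fun _ => measurable_pi_apply _
  have hS : MeasurableSet {x : Site k → Vec d | 1 < ‖x 0‖ ∧ y < ‖x t‖} :=
    (measurableSet_lt measurable_const (measurable_norm_site 0)).inter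
      (measurableSet_lt measurable_const (measurable_norm_site t))
  have hfin : IsFiniteMeasure (ENNReal.ofReal (y ^ (-α)) •
      ((fieldLaw P' Y).map fun x => y • shiftConf t x).restrict {x | 1 < ‖x 0‖ ∧ y < ‖x t‖}) :=
    Measure.smul_finite _ ENNReal.ofReal_ne_top
  refine ext_of_forall_integral_eq_of_IsFiniteMeasure fun f => ?_
  rw [integral_map hres.aemeasurable f.continuous.measurable.aestronglyMeasurable,
    integral_map hres.aemeasurable f.continuous.measurable.aestronglyMeasurable,
    integral_smul_measure, ENNReal.toReal_ofReal (by positivity), smul_eq_mul]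
  let φ : ℕ → ℝ → ℝ := fun n => ramp 1 (1 + 1 / ((n : ℝ) + 1))
  let ψ : ℕ → ℝ → ℝ := fun n => ramp y (y + 1 / ((n : ℝ) + 1))
  let w : ℕ → (F → Vec d) → ℝ := fun n z => φ n ‖z ⟨0, h0⟩‖ * ψ n ‖z ⟨t, ht⟩‖
  have hw0 : ∀ n z, 0 ≤ w n z := fun n z => mul_nonneg (ramp_nonneg _ _ _) (ramp_nonneg _ _ _)
  have hw1 : ∀ n z, w n z ≤ 1 := fun n z =>
    mul_le_one₀ (ramp_le_one _ _ _) (ramp_nonneg _ _ _) (ramp_le_one _ _ _)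
  have hwc : ∀ n, Continuous (w n) := fun n => by
    have h1 : Continuous (φ n) := continuous_ramp _ _
    have h2 : Continuous (ψ n) := continuous_ramp _ _
    fun_prop
  have hbd : ∀ n z, ‖w n z * f z‖ ≤ ‖f‖ := fun n z => by
    rw [norm_mul, Real.norm_of_nonneg (hw0 n z)]
    exact (mul_le_of_le_one_left (norm_nonneg _) (hw1 n z)).trans (f.norm_coe_le_norm z)
  let g : ℕ → (F → Vec d) →ᵇ ℝ := fun n => BoundedContinuousFunction.ofNormedAddCommGroup
    (fun z => w n z * f z) ((hwc n).mul f.continuous) ‖f‖ (hbd n)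
  have hlt : ∀ (a : ℝ) (n : ℕ), a < a + 1 / ((n : ℝ) + 1) := fun a n => by
    have : (0 : ℝ) < 1 / ((n : ℝ) + 1) := by positivity
    linarith
  have hlim : ∀ (μ : Measure (Site k → Vec d)) [IsProbabilityMeasure μ],
      Tendsto (fun n => ∫ x, g n (F.restrict x) ∂μ) atTop
        (𝓝 (∫ x in {x | 1 < ‖x 0‖ ∧ y < ‖x t‖}, f (F.restrict x) ∂μ)) := by
    intro μ _
    rw [← integral_indicator hS]
    refine tendsto_integral_of_dominated_convergence (fun _ => ‖f‖)
      (fun n => ((g n).continuous.measurable.comp hres).aestronglyMeasurable)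
      (integrable_const _) (fun n => Eventually.of_forall fun x => hbd n _)
      (Eventually.of_forall fun x => ?_)
    have h1 : Tendsto (fun n => g n (F.restrict x)) atTop
        (𝓝 ((Set.Ioi (1 : ℝ)).indicator 1 ‖x 0‖ * (Set.Ioi y).indicator 1 ‖x t‖ *
          f (F.restrict x))) :=
      ((tendsto_ramp _).mul (tendsto_ramp _)).mul_const _
    convert h1 using 2
    by_cases hx0 : 1 < ‖x 0‖ <;> by_cases hxt : y < ‖x t‖ <;> simp [hx0, hxt, Set.indicator]
  have heq : ∀ n, ∫ x, g n (F.restrict x) ∂(fieldLaw P' Y) =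
      y ^ (-α) * ∫ x, g n (F.restrict x) ∂((fieldLaw P' Y).map fun x => y • shiftConf t x) := by
    intro n
    have hgm : Measurable fun x : Site k → Vec d => g n (F.restrict x) :=
      (g n).continuous.measurable.comp hres
    rw [integral_map hpm.aemeasurable hgm.aestronglyMeasurable, fieldLaw,
      integral_map hYm.aemeasurable hgm.aestronglyMeasurable,
      integral_map hYm.aemeasurable (f := fun x => g n (F.restrict (y • shiftConf t x)))
        (hgm.comp hpm).aestronglyMeasurable]
    refine hY.integral_time_change hXm hXs hXrv h0 ht hy (g n) ?_ ?_
    · intro z hz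
      change φ n _ * _ * _ = 0
      simp only [φ, ramp_of_le (hlt 1 n) hz, zero_mul]
    · intro z hz
      change _ * ψ n _ * _ = 0
      simp only [ψ, ramp_of_le (hlt y n) hz, mul_zero, zero_mul]
  refine tendsto_nhds_unique (hlim (fieldLaw P' Y)) ?_
  simp only [heq]
  exact (hlim _).const_mul _

theorem IsTailField.isTailLaw (hY : IsTailField P X α P' Y)
    (hXm : ∀ t, Measurable (X t)) (hXs : IsStationaryField P X)
    (hXrv : IsRegularlyVarying P X α) : IsTailLaw α (fieldLaw P' Y) := by
  classical
  have hYm : Measurable fun ω t => Y t ω := measurable_pi_lambda _ hY.measurable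
  have hprob : IsProbabilityMeasure (fieldLaw P' Y) :=
    Measure.isProbabilityMeasure_map hYm.aemeasurable
  refine ⟨hprob, fun y hy => ?_, fun t y hy => ?_⟩
  · rw [fieldLaw, Measure.map_apply hYm
      (measurableSet_lt measurable_const (measurable_norm_site 0)), ← hY.pareto y hy,
      ofReal_measureReal]
    rfl
  · have hpm := measurable_smul_shiftConf (d := d) y t
    have : IsProbabilityMeasure ((fieldLaw P' Y).map fun x => y • shiftConf t x) :=
      Measure.isProbabilityMeasure_map hpm.aemeasurable
    have hfin : IsFiniteMeasure (ENNReal.ofReal (y ^ (-α)) •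
        ((fieldLaw P' Y).map fun x => y • shiftConf t x).restrict {x | 1 < ‖x 0‖ ∧ y < ‖x t‖}) :=
      Measure.smul_finite _ ENNReal.ofReal_ne_top
    set μ := (fieldLaw P' Y).restrict {x | 1 < ‖x 0‖ ∧ y < ‖x t‖} with hμ
    -- Finite measures on the product are determined by their finite-dimensional marginals. The
    -- sites `0` and `t` are added to `I` because the restricting event depends on them.
    refine IsProjectiveLimit.unique (P := fun I => μ.map I.restrict) (fun I => rfl) fun I => ?_
    set F : Finset (Site k) := insert 0 (insert t I) with hF
    have hIF : I ⊆ F := fun s hs => by simp [hF, hs]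
    have h := hY.restrict_map_eq hXm hXs hXrv (F := F) (t := t) (by simp [hF]) (by simp [hF]) hy
    have hcomp := congrArg (fun ν => ν.map (Finset.restrict₂ (π := fun _ => Vec d) hIF)) h
    have hr2 : Measurable (Finset.restrict₂ (π := fun _ : Site k => Vec d) hIF) :=
      measurable_pi_lambda _ fun _ => measurable_pi_apply _
    have hres : Measurable (F.restrict : (Site k → Vec d) → F → Vec d) :=
      measurable_pi_lambda _ fun _ => measurable_pi_apply _
    rw [Measure.map_map hr2 hres, Measure.map_map hr2 hres, Finset.restrict₂_comp_restrict] at hcomp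
    exact hcomp.symm

lemma measurableSet_confQuiet (A : Set (Site k)) (y : ℝ) :
    MeasurableSet {x : Site k → Vec d | ∀ s ∈ A, ‖x s‖ ≤ y} :=
  measurableSet_quiet (X := fun s (z : Site k → Vec d) => z s) measurable_pi_apply A y

/-- Quiet on `A` means that the rescaled vector lies in the closed unit ball of the maximum norm.
Its frontier is null when no norm has an atom at `1`, so weak convergence applies. -/
lemma IsTailField.tendsto_quietProb (hY : IsTailField P X α P' Y)
    (hXm : ∀ t, Measurable (X t)) (hXrv : IsRegularlyVarying P X α)
    (hnull : ∀ t, fieldLaw P' Y {x | ‖x t‖ = 1} = 0) {A : Set (Site k)} (hA : A.Finite) :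
    Tendsto (fun x => quietProb P X A x / tailProb P X x) atTop
      (𝓝 ((fieldLaw P' Y).real {x | ∀ s ∈ A, ‖x s‖ ≤ 1})) := by
  lift A to Finset (Site k) using hA
  have hYm : Measurable fun ω t => Y t ω := measurable_pi_lambda _ hY.measurable
  have hYA : Measurable fun ω (t : A) => Y t ω := measurable_pi_lambda _ fun t => hY.measurable t
  have hXA : ∀ x : ℝ, Measurable fun ω (t : A) => x⁻¹ • X t ω := fun x =>
    measurable_pi_lambda _ fun t => (hXm t).const_smul x⁻¹
  have hcond : ∀ x, IsProbabilityMeasure (P[|{ω | x < ‖X 0 ω‖}]) := fun x =>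
    cond_isProbabilityMeasure fun h => (tailProb_pos hXrv x).ne' (by
      rw [tailProb, measureReal_def, h, ENNReal.toReal_zero])
  let μs : ℝ → ProbabilityMeasure (A → Vec d) := fun x =>
    ⟨(P[|{ω | x < ‖X 0 ω‖}]).map fun ω (t : A) => x⁻¹ • X t ω,
      Measure.isProbabilityMeasure_map (hXA x).aemeasurable⟩
  let μ : ProbabilityMeasure (A → Vec d) :=
    ⟨P'.map fun ω (t : A) => Y t ω, Measure.isProbabilityMeasure_map hYA.aemeasurable⟩
  have hlim : Tendsto μs atTop (𝓝 μ) := by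
    rw [ProbabilityMeasure.tendsto_iff_forall_integral_tendsto]
    intro f
    refine (hY.tendsto_fdd A f).congr (fun x => ?_) |>.trans (le_of_eq ?_)
    · exact (integral_map (hXA x).aemeasurable
        f.continuous.measurable.aestronglyMeasurable).symm
    · congr 1
      exact (integral_map hYA.aemeasurable f.continuous.measurable.aestronglyMeasurable).symm
  have hfr : (μ : Measure (A → Vec d)) (frontier (Metric.closedBall 0 1)) = 0 := by
    have hsub : frontier (Metric.closedBall (0 : A → Vec d) 1) ⊆ ⋃ t : A, {z | ‖z t‖ = 1} := by
      refine Metric.frontier_closedBall_subset_sphere.trans fun z hz => ?_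
      rw [mem_sphere_zero_iff_norm] at hz
      by_contra hcon
      simp only [Set.mem_iUnion, Set.mem_ofPred_eq, not_exists] at hcon
      have : ‖z‖ < 1 := (pi_norm_lt_iff one_pos).2 fun t =>
        lt_of_le_of_ne (hz ▸ norm_le_pi_norm z t) (hcon t)
      linarith
    refine measure_mono_null hsub (measure_iUnion_null fun t => ?_)
    have h1 : MeasurableSet {z : A → Vec d | ‖z t‖ = 1} :=
      measurableSet_eq_fun (measurable_pi_apply t).norm measurable_const
    have h2 : MeasurableSet {z : Site k → Vec d | ‖z t‖ = 1} :=
      measurableSet_eq_fun (measurable_norm_site _) measurable_const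
    have h3 := hnull t
    rw [fieldLaw, Measure.map_apply hYm h2] at h3
    change (P'.map fun ω (t : A) => Y t ω) _ = 0
    rw [Measure.map_apply hYA h1]
    exact h3
  have h := (ENNReal.tendsto_toReal (measure_ne_top _ _)).comp
    (ProbabilityMeasure.tendsto_measure_of_null_frontier_of_tendsto' hlim hfr)
  have hball : MeasurableSet (Metric.closedBall (0 : A → Vec d) 1) := measurableSet_closedBall
  refine (h.congr' ?_).trans (le_of_eq ?_)
  · filter_upwards [eventually_gt_atTop 0] with x hx
    simp only [Function.comp_apply]
    change ((P[|{ω | x < ‖X 0 ω‖}]).map (fun ω (t : A) => x⁻¹ • X t ω) _).toReal = _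
    rw [Measure.map_apply (hXA x) hball, cond_apply (measurableSet_tail hXm 0 x),
      ENNReal.toReal_mul, ENNReal.toReal_inv, inv_mul_eq_div]
    change P.real _ / P.real _ = P.real _ / P.real _
    congr 2
    ext ω
    simp only [Set.mem_inter_iff, Set.mem_ofPred_eq, Set.mem_preimage, mem_closedBall_zero_iff,
      pi_norm_le_iff_of_nonneg zero_le_one, norm_smul, norm_inv, Real.norm_of_nonneg hx.le,
      inv_mul_le_one₀ hx, Subtype.forall, Finset.mem_coe]
  · congr 1
    change ((P'.map fun ω (t : A) => Y t ω) _).toReal = _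
    rw [Measure.map_apply hYA hball, measureReal_def, fieldLaw,
      Measure.map_apply hYm (measurableSet_confQuiet _ _)]
    congr 2
    ext ω
    simp [pi_norm_le_iff_of_nonneg]

end TailField

/-! ### Scaling, absence of atoms and independence of radius and direction -/

section TailLaw

variable {k d : ℕ} {α : ℝ} {M : Measure (Site k → Vec d)}

lemma measurableSet_norm_gt (t : Site k) (y : ℝ) :
    MeasurableSet {x : Site k → Vec d | y < ‖x t‖} :=
  measurableSet_lt measurable_const (measurable_norm_site t)

lemma IsTailLaw.measure_zero_gt_one (h : IsTailLaw α M) : M {x | 1 < ‖x 0‖} = 1 := by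
  rw [h.pareto 1 le_rfl]; simp

lemma IsTailLaw.ae_one_lt (h : IsTailLaw α M) : ∀ᵐ x ∂M, 1 < ‖x 0‖ := by
  have := h.prob
  exact (mem_ae_iff_prob_eq_one (measurableSet_norm_gt 0 1)).2 h.measure_zero_gt_one

/-- One condition of the time change formula is free on each side: `|x_0| > 1` holds almost surely,
and after the change it becomes the condition at `t`. -/
lemma IsTailLaw.setLIntegral_change (h : IsTailLaw α M) {F : (Site k → Vec d) → ℝ≥0∞}
    (hF : Measurable F) (t : Site k) {y : ℝ} (hy : 0 < y) :
    ∫⁻ x in {x | y < ‖x t‖}, F x ∂M = ENNReal.ofReal (y ^ (-α)) *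
      ∫⁻ x in {x | 1 < ‖y • x (-t)‖}, F (y • shiftConf t x) ∂M := by
  have hS : MeasurableSet {x : Site k → Vec d | 1 < ‖x 0‖ ∧ y < ‖x t‖} :=
    (measurableSet_norm_gt 0 1).inter (measurableSet_norm_gt t y)
  have h1 : ∫⁻ x in {x | y < ‖x t‖}, F x ∂M = ∫⁻ x in {x | 1 < ‖x 0‖ ∧ y < ‖x t‖}, F x ∂M := by
    refine setLIntegral_congr ?_
    filter_upwards [h.ae_one_lt] with x hx
    exact propext ⟨fun hxt => ⟨hx, hxt⟩, fun hxt => hxt.2⟩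
  rw [h1, h.change t y hy, lintegral_smul_measure, smul_eq_mul,
    setLIntegral_map hS hF (measurable_smul_shiftConf y t)]
  congr 1
  refine setLIntegral_congr ?_
  filter_upwards [h.ae_one_lt] with x hx
  refine propext ⟨fun hxt => ?_, fun hxt => ⟨?_, ?_⟩⟩
  · have : 1 < ‖y • x (0 - t)‖ := hxt.1
    rwa [zero_sub] at this
  · change 1 < ‖y • x (0 - t)‖
    rw [zero_sub]; exact hxt
  · change y < ‖y • x (t - t)‖
    rw [sub_self, norm_smul, Real.norm_of_nonneg hy.le]
    exact lt_mul_of_one_lt_right hy hx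

lemma IsTailLaw.setLIntegral_shift (h : IsTailLaw α M) {F : (Site k → Vec d) → ℝ≥0∞}
    (hF : Measurable F) (t : Site k) :
    ∫⁻ x in {x | 1 < ‖x t‖}, F x ∂M = ∫⁻ x in {x | 1 < ‖x (-t)‖}, F (shiftConf t x) ∂M := by
  simpa using h.setLIntegral_change hF t one_pos

lemma IsTailLaw.measure_shift (h : IsTailLaw α M) {E : Set (Site k → Vec d)}
    (hE : MeasurableSet E) (t : Site k) :
    M (E ∩ {x | 1 < ‖x t‖}) = M (shiftConf t ⁻¹' E ∩ {x | 1 < ‖x (-t)‖}) := by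
  have := h.setLIntegral_shift (F := E.indicator 1) (measurable_one.indicator hE) t
  rw [lintegral_indicator_one hE, Measure.restrict_apply hE] at this
  rw [this]
  have h2 : (fun x => E.indicator (1 : (Site k → Vec d) → ℝ≥0∞) (shiftConf t x)) =
      (shiftConf t ⁻¹' E).indicator 1 := rfl
  rw [h2, lintegral_indicator_one (measurable_shiftConf t hE),
    Measure.restrict_apply (measurable_shiftConf t hE)]

/-- The shifted law is absolutely continuous where the new origin exceeds, so almost sure properties
may be transported there. -/
lemma IsTailLaw.ae_shift (h : IsTailLaw α M) {p : (Site k → Vec d) → Prop} (hp : ∀ᵐ x ∂M, p x)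
    (t : Site k) : ∀ᵐ x ∂M, 1 < ‖x (-t)‖ → p (shiftConf t x) := by
  obtain ⟨s, hs, hsm, hs0⟩ := exists_measurable_superset_of_null (ae_iff.1 hp)
  have h1 := h.measure_shift hsm t
  rw [measure_mono_null Set.inter_subset_left hs0] at h1
  refine ae_iff.2 (measure_mono_null (fun x hx => ?_) h1.symm)
  simp only [Set.mem_ofPred_eq, Classical.not_imp] at hx
  exact ⟨hs hx.2, hx.1⟩

lemma shiftConf_zero (x : Site k → Vec d) : shiftConf 0 x = x := by
  funext s; simp [shiftConf]

lemma IsTailLaw.setLIntegral_scale (h : IsTailLaw α M) {F : (Site k → Vec d) → ℝ≥0∞}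
    (hF : Measurable F) {y : ℝ} (hy : 1 ≤ y) :
    ∫⁻ x in {x | y < ‖x 0‖}, F x ∂M = ENNReal.ofReal (y ^ (-α)) * ∫⁻ x, F (y • x) ∂M := by
  have hy0 : 0 < y := one_pos.trans_le hy
  rw [h.setLIntegral_change hF 0 hy0]
  simp only [shiftConf_zero, neg_zero]
  rw [← setLIntegral_univ (μ := M)]
  congr 1
  refine setLIntegral_congr ?_
  filter_upwards [h.ae_one_lt] with x hx
  refine propext ⟨fun _ => trivial, fun _ => ?_⟩
  change 1 < ‖y • x 0‖
  rw [norm_smul, Real.norm_of_nonneg hy0.le]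
  exact one_lt_mul_of_le_of_lt hy hx

lemma IsTailLaw.ae_scale (h : IsTailLaw α M) {p : (Site k → Vec d) → Prop} (hp : ∀ᵐ x ∂M, p x)
    {y : ℝ} (hy : 1 ≤ y) : ∀ᵐ x ∂M, p (y • x) := by
  obtain ⟨s, hs, hsm, hs0⟩ := exists_measurable_superset_of_null (ae_iff.1 hp)
  have hym : Measurable fun x : Site k → Vec d => y • x :=
    measurable_pi_lambda _ fun _ => (measurable_pi_apply _).const_smul y
  have h1 := h.setLIntegral_scale (F := s.indicator 1) (measurable_one.indicator hsm) hy
  have h2 : (fun x => s.indicator (1 : (Site k → Vec d) → ℝ≥0∞) (y • x)) =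
      ((fun x => y • x) ⁻¹' s).indicator 1 := rfl
  rw [lintegral_indicator_one hsm, Measure.restrict_apply hsm,
    measure_mono_null Set.inter_subset_left hs0, h2, lintegral_indicator_one (hym hsm)] at h1
  have h3 : M ((fun x => y • x) ⁻¹' s) = 0 := by
    rcases mul_eq_zero.1 h1.symm with h4 | h4
    · have : 0 < y ^ (-α) := Real.rpow_pos_of_pos (one_pos.trans_le hy) _
      exact absurd (ENNReal.ofReal_eq_zero.1 h4) (not_le.2 this)
    · exact h4
  refine ae_iff.2 (measure_mono_null (fun x hx => ?_) h3)
  exact hs hx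

lemma IsTailLaw.measure_norm_zero_eq (h : IsTailLaw α M) {c : ℝ} (hc : 1 < c) :
    M {x | ‖x 0‖ = c} = 0 := by
  have := h.prob
  have hreal : ∀ y : ℝ, 1 ≤ y → M.real {x | y < ‖x 0‖} = y ^ (-α) := fun y hy => by
    rw [measureReal_def, h.pareto y hy, ENNReal.toReal_ofReal (by positivity)]
  have hbd : ∀ y ∈ Set.Ioo 1 c, M.real {x | ‖x 0‖ = c} ≤ y ^ (-α) - c ^ (-α) := by
    intro y hy
    rw [← hreal y hy.1.le, ← hreal c hc.le, le_sub_iff_add_le, ← measureReal_union _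
      (measurableSet_norm_gt 0 c)]
    · refine measureReal_mono ?_
      rintro x (hx | hx)
      · exact hy.2.trans_eq hx.out.symm
      · exact hy.2.trans hx
    · exact Set.disjoint_left.2 fun x hx hx' => (hx.out ▸ hx'.out).false
  have hlim : Tendsto (fun y : ℝ => y ^ (-α) - c ^ (-α)) (𝓝[<] c) (𝓝 0) := by
    have := ((Real.continuousAt_rpow_const c (-α) (Or.inl (by linarith))).tendsto.sub_const
      (c ^ (-α))).mono_left (nhdsWithin_le_nhds (s := Set.Iio c))
    rwa [sub_self] at this
  have : M.real {x | ‖x 0‖ = c} ≤ 0 := by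
    refine ge_of_tendsto hlim ?_
    filter_upwards [Ioo_mem_nhdsLT hc] with y hy using hbd y hy
  exact (measureReal_eq_zero_iff).1 (le_antisymm this measureReal_nonneg)

/-- A time change at `t` with `y = c / 2` turns the event into `|x_0| = 2`, and a Pareto law has no
atom there. -/
lemma IsTailLaw.measure_norm_eq (h : IsTailLaw α M) (t : Site k) {c : ℝ} (hc : 0 < c) :
    M {x | ‖x t‖ = c} = 0 := by
  have hm : ∀ s : Site k, MeasurableSet {x : Site k → Vec d | ‖x s‖ = c} := fun s =>
    measurableSet_eq_fun (measurable_norm_site s) measurable_const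
  have h1 := h.setLIntegral_change (F := {x | ‖x t‖ = c}.indicator 1)
    (measurable_one.indicator (hm t)) t (half_pos hc)
  have h0 : {x : Site k → Vec d | ‖x t‖ = c} ∩ {x | c / 2 < ‖x t‖} = {x | ‖x t‖ = c} := by
    refine Set.inter_eq_left.2 fun x hx => ?_
    exact (half_lt_self hc).trans_eq hx.out.symm
  rw [lintegral_indicator_one (hm t), Measure.restrict_apply (hm t), h0] at h1
  rw [h1]
  refine mul_eq_zero_of_right _ (le_antisymm ((setLIntegral_le_lintegral _ _).trans ?_) zero_le)
  refine le_of_eq (lintegral_eq_zero_of_ae_eq_zero ?_)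
  have h2 : ∀ᵐ x ∂M, ¬ ‖x 0‖ = 2 := by
    rw [ae_iff]; simpa using h.measure_norm_zero_eq one_lt_two
  filter_upwards [h2] with x hx
  refine Set.indicator_of_notMem (fun hmem => hx ?_) _
  have h3 : ‖(c / 2) • x (t - t)‖ = c := hmem
  rw [sub_self, norm_smul, Real.norm_of_nonneg (half_pos hc).le] at h3
  field_simp at h3
  linarith

/-- The direction `x / |x_0|` of a configuration. -/
noncomputable def direction (x : Site k → Vec d) : Site k → Vec d := ‖x 0‖⁻¹ • x

lemma measurable_direction : Measurable (direction : (Site k → Vec d) → _) :=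
  measurable_pi_lambda _ fun t =>
    (measurable_norm_site 0).inv.smul (measurable_pi_apply t)

lemma direction_smul {c : ℝ} (hc : 0 < c) (x : Site k → Vec d) :
    direction (c • x) = direction x := by
  simp only [direction, Pi.smul_apply, norm_smul, Real.norm_of_nonneg hc.le, smul_smul, mul_inv]
  rw [mul_comm c⁻¹, inv_mul_cancel_right₀ hc.ne']

/-- Half-lines suffice for the radius. Above level `1` the scaling formula leaves an event of the
direction unchanged and yields the Pareto factor; below `1` the radius condition is almost sure. -/
lemma IsTailLaw.indepFun (h : IsTailLaw α M) :
    IndepFun (fun x : Site k → Vec d => ‖x 0‖) direction M := by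
  have := h.prob
  rw [IndepFun_iff_Indep]
  refine IndepSets.indep (p1 := Set.preimage (fun x : Site k → Vec d => ‖x 0‖) '' Set.range Set.Ioi)
    (p2 := {s | MeasurableSet[MeasurableSpace.comap direction inferInstance] s})
    (measurable_norm_site 0).comap_le measurable_direction.comap_le ?_ ?_ ?_ ?_ ?_
  · exact (isPiSystem_Ioi (α := ℝ)).comap fun x : Site k → Vec d => ‖x 0‖
  · exact @MeasurableSpace.isPiSystem_measurableSet _ (MeasurableSpace.comap direction inferInstance)
  · rw [← MeasurableSpace.comap_generateFrom, ← borel_eq_generateFrom_Ioi,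
      BorelSpace.measurable_eq (α := ℝ)]
  · exact (@MeasurableSpace.generateFrom_measurableSet _
      (MeasurableSpace.comap direction inferInstance)).symm
  · rw [IndepSets_iff]
    rintro _ _ ⟨_, ⟨y, rfl⟩, rfl⟩ ⟨A, hA, rfl⟩
    have hdA := measurable_direction hA
    change M ({x | y < ‖x 0‖} ∩ direction ⁻¹' A) = M {x | y < ‖x 0‖} * M (direction ⁻¹' A)
    rcases le_or_gt 1 y with hy | hy
    · have h1 := h.setLIntegral_scale (F := (direction ⁻¹' A).indicator 1)
        (measurable_one.indicator hdA) hy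
      have h2 : (fun x => (direction ⁻¹' A).indicator (1 : (Site k → Vec d) → ℝ≥0∞) (y • x)) =
          (direction ⁻¹' A).indicator 1 := by
        funext x
        have hiff : y • x ∈ direction ⁻¹' A ↔ x ∈ direction ⁻¹' A := by
          rw [Set.mem_preimage, Set.mem_preimage, direction_smul (one_pos.trans_le hy)]
        by_cases hx : x ∈ direction ⁻¹' A
        · rw [Set.indicator_of_mem hx, Set.indicator_of_mem (hiff.2 hx)]; rfl
        · rw [Set.indicator_of_notMem hx, Set.indicator_of_notMem (fun h => hx (hiff.1 h))]
      rw [h2, lintegral_indicator_one hdA, lintegral_indicator_one hdA,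
        Measure.restrict_apply hdA] at h1
      rw [Set.inter_comm, h1, h.pareto y hy]
    · have hae : ∀ᵐ x ∂M, y < ‖x 0‖ := h.ae_one_lt.mono fun x hx => hy.trans hx
      have h1 : M {x | y < ‖x 0‖} = 1 :=
        (mem_ae_iff_prob_eq_one (measurableSet_norm_gt 0 y)).1 hae
      rw [h1, one_mul, Set.inter_comm]
      exact measure_inter_conull' (measure_mono_null (fun x hx => hx.2) (ae_iff.1 hae))

lemma IsTailLaw.measure_mul_gt (h : IsTailLaw α M) (hα : 0 < α) (v : ℝ≥0∞) :
    M {x | 1 < ENNReal.ofReal ‖x 0‖ * v} = min 1 (v ^ α) := by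
  have := h.prob
  have hone : ∀ v : ℝ≥0∞, 1 ≤ v → M {x | 1 < ENNReal.ofReal ‖x 0‖ * v} = min 1 (v ^ α) := by
    intro v hv
    rw [min_eq_left (ENNReal.one_le_rpow hv hα)]
    refine le_antisymm prob_le_one (h.measure_zero_gt_one.symm.le.trans (measure_mono ?_))
    intro x hx
    calc (1 : ℝ≥0∞) < ENNReal.ofReal ‖x 0‖ := ENNReal.one_lt_ofReal.2 hx
      _ ≤ _ := le_mul_of_one_le_right' hv
  rcases le_or_gt 1 v with hv | hv
  · exact hone v hv
  · lift v to NNReal using hv.ne_top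
    rcases eq_or_ne v 0 with rfl | hv0
    · simp [hα]
    · have hv0' : (0 : ℝ) < v := by positivity
      have hv1 : (v : ℝ) < 1 := by exact_mod_cast hv
      have hset : {x : Site k → Vec d | 1 < ENNReal.ofReal ‖x 0‖ * v} =
          {x | (v : ℝ)⁻¹ < ‖x 0‖} := by
        ext x
        simp only [Set.mem_ofPred_eq]
        rw [← ENNReal.ofReal_coe_nnreal, ← ENNReal.ofReal_mul (norm_nonneg _),
          ENNReal.one_lt_ofReal, inv_lt_iff_one_lt_mul₀ hv0']
      rw [hset, h.pareto _ (one_le_inv_iff₀.2 ⟨hv0', hv1.le⟩),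
        min_eq_right (ENNReal.rpow_le_one hv.le hα.le), ← ENNReal.ofReal_coe_nnreal,
        ENNReal.ofReal_rpow_of_pos hv0', Real.inv_rpow hv0'.le, Real.rpow_neg hv0'.le, inv_inv]

/-- Integration over the radius, which is independent of the direction. -/
lemma IsTailLaw.setLIntegral_homogeneous (h : IsTailLaw α M) (hα : 0 < α)
    {F V : (Site k → Vec d) → ℝ≥0∞} (hF : Measurable F) (hV : Measurable V)
    (hFh : ∀ c : ℝ, 0 < c → ∀ x, F (c • x) = F x)
    (hVh : ∀ c : ℝ, 0 < c → ∀ x, V (c • x) = ENNReal.ofReal c * V x) :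
    ∫⁻ x in {x | 1 < V x}, F x ∂M = ∫⁻ x, F x * min 1 ((V x / ‖x 0‖ₑ) ^ α) ∂M := by
  have := h.prob
  have hR : Measurable fun x : Site k → Vec d => ‖x 0‖ := measurable_norm_site 0
  have hθ : Measurable (direction : (Site k → Vec d) → _) := measurable_direction
  set G : ℝ × (Site k → Vec d) → ℝ≥0∞ :=
    {p | 1 < ENNReal.ofReal p.1 * V p.2}.indicator fun p => F p.2 with hG
  have hGm : Measurable G := (hF.comp measurable_snd).indicator
    (measurableSet_lt measurable_const
      ((ENNReal.measurable_ofReal.comp measurable_fst).mul (hV.comp measurable_snd)))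
  have hVS : MeasurableSet {x | 1 < V x} := measurableSet_lt measurable_const hV
  calc ∫⁻ x in {x | 1 < V x}, F x ∂M = ∫⁻ x, G (‖x 0‖, direction x) ∂M := by
        rw [← lintegral_indicator hVS]
        refine lintegral_congr_ae ?_
        filter_upwards [h.ae_one_lt] with x hx
        have hx0 : 0 < ‖x 0‖ := one_pos.trans hx
        have h1 : ENNReal.ofReal ‖x 0‖ * V (direction x) = V x := by
          rw [direction, hVh _ (inv_pos.2 hx0), ← mul_assoc, ← ENNReal.ofReal_mul hx0.le,
            mul_inv_cancel₀ hx0.ne', ENNReal.ofReal_one, one_mul]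
        have h2 : F (direction x) = F x := hFh _ (inv_pos.2 hx0) x
        by_cases hx1 : 1 < V x
        · have h3 : (‖x 0‖, direction x) ∈
              {p : ℝ × (Site k → Vec d) | 1 < ENNReal.ofReal p.1 * V p.2} := hx1.trans_eq h1.symm
          rw [Set.indicator_of_mem (by exact hx1), hG, Set.indicator_of_mem h3, h2]
        · have h3 : (‖x 0‖, direction x) ∉
              {p : ℝ × (Site k → Vec d) | 1 < ENNReal.ofReal p.1 * V p.2} := fun h4 =>
            hx1 (h4.out.trans_eq h1)
          rw [Set.indicator_of_notMem (by exact hx1), hG, Set.indicator_of_notMem h3]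
    _ = ∫⁻ p, G p ∂((M.map fun x => ‖x 0‖).prod (M.map direction)) := by
        rw [← (indepFun_iff_map_prod_eq_prod_map_map hR.aemeasurable hθ.aemeasurable).1 h.indepFun,
          lintegral_map hGm (hR.prodMk hθ)]
    _ = ∫⁻ z, ∫⁻ r, G (r, z) ∂(M.map fun x => ‖x 0‖) ∂(M.map direction) := by
        have := Measure.isProbabilityMeasure_map (μ := M) hR.aemeasurable
        have := Measure.isProbabilityMeasure_map (μ := M) hθ.aemeasurable
        exact lintegral_prod_symm _ hGm.aemeasurable
    _ = ∫⁻ z, F z * min 1 (V z ^ α) ∂(M.map direction) := by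
        refine lintegral_congr fun z => ?_
        rw [lintegral_map (f := fun r => G (r, z)) (hGm.comp measurable_prodMk_right) hR, ← h.measure_mul_gt hα]
        have hms : MeasurableSet {x : Site k → Vec d | 1 < ENNReal.ofReal ‖x 0‖ * V z} :=
          measurableSet_lt measurable_const (hR.ennreal_ofReal.mul_const _)
        have : (fun x : Site k → Vec d => G (‖x 0‖, z)) =
            {x | 1 < ENNReal.ofReal ‖x 0‖ * V z}.indicator fun _ => F z := rfl
        rw [this, lintegral_indicator_const hms]
    _ = ∫⁻ x, F x * min 1 ((V x / ‖x 0‖ₑ) ^ α) ∂M := by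
        rw [lintegral_map (f := fun z => F z * min 1 (V z ^ α))
          (hF.mul (measurable_const.min (hV.pow_const α))) hθ]
        refine lintegral_congr_ae ?_
        filter_upwards [h.ae_one_lt] with x hx
        have hx0 : 0 < ‖x 0‖ := one_pos.trans hx
        have h2 : F (direction x) = F x := hFh _ (inv_pos.2 hx0) x
        rw [h2, direction, hVh _ (inv_pos.2 hx0), ENNReal.ofReal_inv_of_pos hx0, ofReal_norm,
          mul_comm, ENNReal.div_eq_inv_mul]
        ring

end TailLaw

/-! ### Last exceedances and anchors -/

section Anchor

variable {k d : ℕ} {prec : Site k → Site k → Prop}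

/-- `t` is the last site of `L` at which the configuration exceeds `1`. -/
def IsLastExceedance (prec : Site k → Site k → Prop) (L : Set (Site k)) (x : Site k → Vec d)
    (t : Site k) : Prop :=
  1 < ‖x t‖ ∧ ∀ s ∈ L, prec t s → ‖x s‖ ≤ 1

lemma InvariantOrder.add_lt_iff (hprec : InvariantOrder prec) {s t u : Site k} :
    prec (s + t) u ↔ prec s (u - t) := by
  rw [← hprec.sub_pos, ← hprec.sub_pos (s := s), sub_sub, add_comm]

lemma InvariantOrder.lt_add_iff (hprec : InvariantOrder prec) {s t u : Site k} :
    prec u (s + t) ↔ prec (u - t) s := by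
  rw [← hprec.sub_pos, ← hprec.sub_pos (t := s), sub_sub_eq_add_sub]

lemma isLastExceedance_shiftConf (hprec : InvariantOrder prec) {H : AddSubgroup (Site k)}
    {t : Site k} (ht : t ∈ H) (s : Site k) (x : Site k → Vec d) :
    IsLastExceedance prec H (shiftConf t x) s ↔ IsLastExceedance prec H x (s - t) := by
  refine and_congr Iff.rfl ⟨fun h v hv hpv => ?_, fun h v hv hpv => ?_⟩
  · simpa [shiftConf] using h (v + t) (H.add_mem hv ht) (hprec.lt_add_iff.2 hpv)
  · exact h (v - t) (H.sub_mem hv ht) (hprec.lt_add_iff.1 (by simpa using hpv))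

lemma IsLastExceedance.unique (hprec : InvariantOrder prec) {L : Set (Site k)}
    {x : Site k → Vec d} {s t : Site k} (hs : s ∈ L) (ht : t ∈ L)
    (h : IsLastExceedance prec L x s) (h' : IsLastExceedance prec L x t) : s = t := by
  by_contra hne
  rcases hprec.total s t hne with hlt | hlt
  · exact absurd h'.1 (not_lt.2 (h.2 t ht hlt))
  · exact absurd h.1 (not_lt.2 (h'.2 s hs hlt))

lemma measurableSet_isLastExceedance (L : Set (Site k)) (t : Site k) :
    MeasurableSet {x : Site k → Vec d | IsLastExceedance prec L x t} := by
  have := (measurableSet_norm_gt (d := d) t 1).inter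
    (measurableSet_confQuiet {s | s ∈ L ∧ prec t s} 1)
  convert this using 1
  ext x
  simp [IsLastExceedance]

lemma iSup_enorm_shiftConf (S : Set (Site k)) (t : Site k) (x : Site k → Vec d) :
    ⨆ s ∈ S, ‖shiftConf t x s‖ₑ = ⨆ s ∈ {s | s + t ∈ S}, ‖x s‖ₑ := by
  refine le_antisymm (iSup₂_le fun s hs => ?_) (iSup₂_le fun s hs => ?_)
  · exact le_iSup₂_of_le (s - t) (by simpa using hs) le_rfl
  · refine le_iSup₂_of_le (s + t) hs ?_
    simp [shiftConf]

lemma isAnchor_shiftConf (hprec : InvariantOrder prec) {H : AddSubgroup (Site k)}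
    {t : Site k} (ht : t ∈ H) (s : Site k) (x : Site k → Vec d) :
    IsAnchor prec H (shiftConf t x) s ↔ IsAnchor prec H x (s - t) := by
  have hmem : ∀ v, v + t ∈ H ↔ v ∈ H := fun v => H.add_mem_cancel_right ht
  have h1 : {v | v + t ∈ {v | v ∈ (H : Set (Site k)) ∧ prec v s}} =
      {v | v ∈ (H : Set (Site k)) ∧ prec v (s - t)} := by
    ext v
    exact and_congr (hmem v) hprec.add_lt_iff
  have h2 : {v | v + t ∈ {v | v ∈ (H : Set (Site k)) ∧ (v = s ∨ prec s v)}} =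
      {v | v ∈ (H : Set (Site k)) ∧ (v = s - t ∨ prec (s - t) v)} := by
    ext v
    exact and_congr (hmem v) (or_congr eq_sub_iff_add_eq.symm hprec.lt_add_iff)
  rw [IsAnchor, IsAnchor, iSup_enorm_shiftConf, iSup_enorm_shiftConf, h1, h2]
  refine and_congr ?_ Iff.rfl
  rw [SetLike.mem_coe, SetLike.mem_coe, ← hmem (s - t), sub_add_cancel]

lemma iSup_enorm_smul (S : Set (Site k)) (c : ℝ) (x : Site k → Vec d) :
    ⨆ s ∈ S, ‖(c • x) s‖ₑ = ‖c‖ₑ * ⨆ s ∈ S, ‖x s‖ₑ := by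
  simp only [Pi.smul_apply, enorm_smul, ENNReal.mul_iSup]

lemma isAnchor_smul {c : ℝ} (hc : 0 < c) (L : Set (Site k)) (t : Site k) (x : Site k → Vec d) :
    IsAnchor prec L (c • x) t ↔ IsAnchor prec L x t := by
  have hc0 : ‖c‖ₑ ≠ 0 := by simpa using hc.ne'
  rw [IsAnchor, IsAnchor, iSup_enorm_smul, iSup_enorm_smul, Pi.smul_apply, enorm_smul,
    ENNReal.mul_lt_mul_iff_right hc0 enorm_ne_top, ENNReal.mul_right_inj hc0 enorm_ne_top]

lemma measurable_biSup_enorm (S : Set (Site k)) :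
    Measurable fun x : Site k → Vec d => ⨆ s ∈ S, ‖x s‖ₑ :=
  Measurable.biSup S S.to_countable fun s _ => measurable_enorm_site s

lemma measurableSet_isAnchor (L : Set (Site k)) (t : Site k) :
    MeasurableSet {x : Site k → Vec d | IsAnchor prec L x t} :=
  (MeasurableSet.const (t ∈ L)).inter
    ((measurableSet_lt (measurable_biSup_enorm _) (measurable_enorm_site t)).inter
      (measurableSet_eq_fun (measurable_enorm_site t) (measurable_biSup_enorm _)))

lemma IsAnchor.enorm_le (hprec : InvariantOrder prec) {L : Set (Site k)} {x : Site k → Vec d}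
    {t : Site k} (h : IsAnchor prec L x t) {s : Site k} (hs : s ∈ L) : ‖x s‖ₑ ≤ ‖x t‖ₑ := by
  by_cases hst : prec s t
  · exact (le_iSup₂_of_le (f := fun s (_ : s ∈ {s | s ∈ L ∧ prec s t}) => ‖x s‖ₑ) s ⟨hs, hst⟩
      le_rfl).trans h.2.1.le
  · have : s = t ∨ prec t s := by
      by_cases heq : s = t
      · exact Or.inl heq
      · exact Or.inr ((hprec.total s t heq).resolve_left hst)
    exact (le_iSup₂_of_le (f := fun s (_ : s ∈ {s | s ∈ L ∧ (s = t ∨ prec t s)}) => ‖x s‖ₑ) s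
      ⟨hs, this⟩ le_rfl).trans_eq h.2.2.symm

lemma IsAnchor.unique (hprec : InvariantOrder prec) {L : Set (Site k)} {x : Site k → Vec d}
    {s t : Site k} (h : IsAnchor prec L x s) (h' : IsAnchor prec L x t) : s = t := by
  have key : ∀ {s t}, IsAnchor prec L x s → IsAnchor prec L x t → ¬ prec s t := by
    intro s t h h' hst
    have h1 : ‖x s‖ₑ < ‖x t‖ₑ :=
      (le_iSup₂_of_le (f := fun s (_ : s ∈ {s | s ∈ L ∧ prec s t}) => ‖x s‖ₑ) s ⟨h.1, hst⟩
        le_rfl).trans_lt h'.2.1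
    exact absurd (h.enorm_le hprec h'.1) (not_le.2 h1)
  by_contra hne
  rcases hprec.total s t hne with hlt | hlt
  · exact key h h' hlt
  · exact key h' h hlt

/-- Only finitely many sites exceed half of `|x_{t₀}|`, so the maximum over `L` is attained, and
finitely often; the anchor is the first site where it is. -/
lemma exists_isAnchor (hprec : InvariantOrder prec) {L : Set (Site k)} {x : Site k → Vec d}
    (hfin : ∀ c : ℝ, 0 < c → {t | t ∈ L ∧ c < ‖x t‖}.Finite) {t₀ : Site k} (ht₀ : t₀ ∈ L)
    (hx : x t₀ ≠ 0) : ∃ t, IsAnchor prec L x t := by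
  have hpos : 0 < ‖x t₀‖ := norm_pos_iff.2 hx
  have hS := hfin (‖x t₀‖ / 2) (half_pos hpos)
  have hmem : t₀ ∈ {t | t ∈ L ∧ ‖x t₀‖ / 2 < ‖x t‖} := ⟨ht₀, half_lt_self hpos⟩
  obtain ⟨m, hm, hmax⟩ := hS.exists_maximalFor (fun t => ‖x t‖) _ ⟨t₀, hmem⟩
  have hmaxL : ∀ s ∈ L, ‖x s‖ ≤ ‖x m‖ := by
    intro s hs
    rcases le_or_gt ‖x s‖ (‖x t₀‖ / 2) with h | h
    · exact h.trans hm.2.le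
    · rcases le_total ‖x s‖ ‖x m‖ with h' | h'
      · exact h'
      · exact hmax ⟨hs, h⟩ h'
  obtain ⟨t, ht, hfirst⟩ := hprec.exists_first
    (S := {t | t ∈ {t | t ∈ L ∧ ‖x t₀‖ / 2 < ‖x t‖} ∧ ‖x t‖ = ‖x m‖})
    (hS.subset fun s hs => hs.1) ⟨m, hm, rfl⟩
  have hle : ∀ s ∈ L, ‖x s‖ₑ ≤ ‖x t‖ₑ := fun s hs => by
    rw [enorm_le_iff_norm_le, ht.2]; exact hmaxL s hs
  refine ⟨t, ht.1.1, ?_, ?_⟩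
  · classical
    -- Strictness of a supremum over infinitely many earlier sites needs a gap: all but finitely
    -- many are at most `c`, and those finitely many are strictly smaller one by one.
    set c : ℝ≥0∞ := ‖‖x t₀‖ / 2‖ₑ with hc
    have hcx : ∀ s, c < ‖x s‖ₑ ↔ ‖x t₀‖ / 2 < ‖x s‖ := fun s => by
      rw [hc, lt_iff_lt_of_le_iff_le enorm_le_iff_norm_le, Real.norm_of_nonneg (half_pos hpos).le]
    have hbound : (⨆ s ∈ {s | s ∈ L ∧ prec s t}, ‖x s‖ₑ) ≤
        c ⊔ (hS.toFinset.filter fun s => prec s t).sup fun s => ‖x s‖ₑ := by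
      refine iSup₂_le fun s hs => ?_
      rcases le_or_gt ‖x s‖ₑ c with h | h
      · exact h.trans le_sup_left
      · refine le_sup_of_le_right (Finset.le_sup (f := fun s => ‖x s‖ₑ) ?_)
        rw [Finset.mem_filter, Set.Finite.mem_toFinset]
        exact ⟨⟨hs.1, (hcx s).1 h⟩, hs.2⟩
    refine hbound.trans_lt (max_lt ((hcx t).2 ht.1.2) ?_)
    rw [Finset.sup_lt_iff (lt_of_le_of_lt bot_le ((hcx t).2 ht.1.2))]
    intro s hs
    rw [Finset.mem_filter, Set.Finite.mem_toFinset] at hs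
    refine lt_of_le_of_ne (hle s hs.1.1) fun heq => ?_
    have heq' : ‖x s‖ = ‖x m‖ := by
      rw [← ht.2, ← toReal_enorm, ← toReal_enorm, heq]
    rcases hfirst s ⟨hs.1, heq'⟩ with h | h
    · exact hprec.irrefl _ (h ▸ hs.2)
    · exact hprec.asymm h hs.2
  · refine le_antisymm ?_ (iSup₂_le fun s hs => hle s hs.1)
    exact le_iSup₂_of_le (f := fun s (_ : s ∈ {s | s ∈ L ∧ (s = t ∨ prec t s)}) => ‖x s‖ₑ) t
      ⟨ht.1.1, Or.inl rfl⟩ le_rfl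

lemma IsAnchor.iSup_eq (hprec : InvariantOrder prec) {L : Set (Site k)} {x : Site k → Vec d}
    {t : Site k} (h : IsAnchor prec L x t) : ⨆ s ∈ L, ‖x s‖ₑ = ‖x t‖ₑ :=
  le_antisymm (iSup₂_le fun _ hs => h.enorm_le hprec hs)
    (le_iSup₂_of_le (f := fun s (_ : s ∈ L) => ‖x s‖ₑ) t h.1 le_rfl)

end Anchor

/-! ### Mass transport on a subgroup -/

section Lattice

variable {k d : ℕ} {α : ℝ} {M : Measure (Site k → Vec d)} {prec : Site k → Site k → Prop}
  {H : AddSubgroup (Site k)}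

lemma lintegral_eq_tsum_of_partition {W ι : Type*} [MeasurableSpace W] [Countable ι]
    {μ : Measure W} {A : ι → Set W} (hA : ∀ i, MeasurableSet (A i))
    (hd : Pairwise (Function.onFun Disjoint A)) (hcov : ∀ᵐ w ∂μ, ∃ i, w ∈ A i) (f : W → ℝ≥0∞) :
    ∫⁻ w, f w ∂μ = ∑' i, ∫⁻ w in A i, f w ∂μ := by
  rw [← lintegral_iUnion hA hd, ← setLIntegral_univ]
  refine setLIntegral_congr ?_
  filter_upwards [hcov] with w hw
  exact propext ⟨fun _ => Set.mem_iUnion.2 hw, fun _ => trivial⟩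

lemma measure_eq_tsum_of_partition {W ι : Type*} [MeasurableSpace W] [Countable ι]
    {μ : Measure W} {A : ι → Set W} (hA : ∀ i, MeasurableSet (A i))
    (hd : Pairwise (Function.onFun Disjoint A)) (hcov : ∀ᵐ w ∂μ, ∃ i, w ∈ A i) {E : Set W}
    (hE : MeasurableSet E) : μ E = ∑' i, μ (E ∩ A i) := by
  have := lintegral_eq_tsum_of_partition hA hd hcov (E.indicator 1)
  simpa only [lintegral_indicator_one hE, Measure.restrict_apply hE] using this

lemma indicator_congr_point {W W' : Type*} {S : Set W} {S' : Set W'} {f : W → ℝ≥0∞}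
    {g : W' → ℝ≥0∞} {w : W} {w' : W'} (hiff : w ∈ S ↔ w' ∈ S') (hfg : f w = g w') :
    S.indicator f w = S'.indicator g w' := by
  by_cases hw : w ∈ S
  · rw [Set.indicator_of_mem hw, Set.indicator_of_mem (hiff.1 hw), hfg]
  · rw [Set.indicator_of_notMem hw, Set.indicator_of_notMem fun h => hw (hiff.2 h)]

lemma one_lt_enorm_iff {E : Type*} [NormedAddCommGroup E] (v : E) : 1 < ‖v‖ₑ ↔ 1 < ‖v‖ := by
  rw [← ofReal_norm, ENNReal.one_lt_ofReal]

/-- The configuration on `H` exceeds every positive level only finitely often, if this holds for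
the level `1` on the positive part of `H`. -/
lemma IsTailLaw.ae_finite_exceedances (h : IsTailLaw α M) (hprec : InvariantOrder prec)
    (hfin : ∀ᵐ x ∂M, {t | t ∈ H ∧ prec 0 t ∧ 1 < ‖x t‖}.Finite) :
    (∀ᵐ x ∂M, ∃ t : H, IsLastExceedance prec H x t) ∧
      ∀ᵐ x ∂M, ∀ c : ℝ, 0 < c → {t | t ∈ (H : Set (Site k)) ∧ c < ‖x t‖}.Finite := by
  have := h.prob
  -- The origin itself exceeds, so the search is limited to it and to the finitely many exceedances
  -- after it.
  have hlast : ∀ᵐ x ∂M, ∃ t : H, IsLastExceedance prec H x t := by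
    filter_upwards [hfin, h.ae_one_lt] with x hx hx0
    obtain ⟨t, ht, hmax⟩ := hprec.exists_last (S := insert 0 {t | t ∈ H ∧ prec 0 t ∧ 1 < ‖x t‖})
      (hx.insert 0) (Set.insert_nonempty _ _)
    have htH : t ∈ H ∧ (t = 0 ∨ prec 0 t) ∧ 1 < ‖x t‖ := by
      rcases ht with rfl | ht
      · exact ⟨H.zero_mem, Or.inl rfl, hx0⟩
      · exact ⟨ht.1, Or.inr ht.2.1, ht.2.2⟩
    refine ⟨⟨t, htH.1⟩, htH.2.2, fun s hs hts => not_lt.1 fun hlt => ?_⟩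
    have h0s : prec 0 s := by
      rcases htH.2.1 with h0 | h0
      · exact h0 ▸ hts
      · exact hprec.trans _ _ _ h0 hts
    rcases hmax s (Or.inr ⟨hs, h0s, hlt⟩) with h' | h'
    · exact hprec.irrefl _ (h' ▸ hts)
    · exact hprec.asymm h' hts
  refine ⟨hlast, ?_⟩
  have hLm : ∀ t, MeasurableSet {x : Site k → Vec d | IsLastExceedance prec H x t} :=
    measurableSet_isLastExceedance _
  -- A shift by `t` sends these events into the events that the last exceedance is at `-t`. The
  -- latter are disjoint, so the sum is at most `1` and Borel–Cantelli applies.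
  have hsum : ∑' t : H, M ({x | IsLastExceedance prec H x 0} ∩ {x | 1 < ‖x t‖}) ≠ ⊤ := by
    refine ne_top_of_le_ne_top (measure_ne_top M Set.univ) ?_
    calc ∑' t : H, M ({x | IsLastExceedance prec H x 0} ∩ {x | 1 < ‖x t‖})
        ≤ ∑' t : H, M {x | IsLastExceedance prec H x (-t)} := by
          refine ENNReal.tsum_le_tsum fun t => ?_
          rw [h.measure_shift (hLm 0)]
          refine measure_mono fun x hx => ?_
          have := (isLastExceedance_shiftConf hprec t.2 0 x).1 hx.1
          rwa [zero_sub] at this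
      _ ≤ M Set.univ := tsum_measure_le_measure_univ (fun t => (hLm _).nullMeasurableSet)
          fun s t hst => Disjoint.aedisjoint (Set.disjoint_left.2 fun x hx hx' => hst
            (neg_injective (Subtype.ext (hx.out.unique hprec (H.neg_mem s.2) (H.neg_mem t.2) hx'))))
  have hzero : ∀ᵐ x ∂M, IsLastExceedance prec H x 0 →
      {t | t ∈ (H : Set (Site k)) ∧ 1 < ‖x t‖}.Finite := by
    filter_upwards [ae_finite_setOfPred_mem hsum] with x hx hx0
    refine (hx.image Subtype.val).subset fun t ht => ⟨⟨t, ht.1⟩, ⟨hx0, ht.2⟩, rfl⟩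
  have hone : ∀ᵐ x ∂M, {t | t ∈ (H : Set (Site k)) ∧ 1 < ‖x t‖}.Finite := by
    -- A last exceedance at `t` is moved to the origin; the shift is allowed because `t` exceeds.
    have hall : ∀ᵐ x ∂M, ∀ t : H, IsLastExceedance prec H x t →
        {t | t ∈ (H : Set (Site k)) ∧ 1 < ‖x t‖}.Finite := by
      rw [ae_all_iff]
      intro t
      filter_upwards [h.ae_shift hzero (-t)] with x hx hxt
      rw [neg_neg] at hx
      have h1 := hx hxt.1 ((isLastExceedance_shiftConf hprec (H.neg_mem t.2) 0 x).2
        (by simpa using hxt))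
      refine (Set.Finite.image (fun s => s + (t : Site k)) h1).subset fun s hs => ?_
      refine ⟨s - t, ⟨H.sub_mem hs.1 t.2, ?_⟩, sub_add_cancel _ _⟩
      simpa [shiftConf] using hs.2
    filter_upwards [hall, hlast] with x hx ⟨t, ht⟩ using hx t ht
  -- Exceedances of level `1` by `(n + 1) x` are exceedances of level `1 / (n + 1)` by `x`.
  have hscale : ∀ᵐ x ∂M, ∀ n : ℕ, {t | t ∈ (H : Set (Site k)) ∧ 1 < ‖(((n : ℝ) + 1) • x) t‖}.Finite := by
    rw [ae_all_iff]
    exact fun n => h.ae_scale hone (by simp)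
  filter_upwards [hscale] with x hx c hc
  obtain ⟨n, hn⟩ := exists_nat_one_div_lt hc
  refine (hx n).subset fun t ht => ⟨ht.1, ?_⟩
  have hn0 : (0 : ℝ) < n + 1 := by positivity
  rw [Pi.smul_apply, norm_smul, Real.norm_of_nonneg hn0.le]
  rw [div_lt_iff₀ hn0] at hn
  have := mul_lt_mul_of_pos_left ht.2 hn0
  linarith

lemma IsTailLaw.ae_existsUnique_isAnchor (h : IsTailLaw α M) (hprec : InvariantOrder prec)
    (hfin : ∀ᵐ x ∂M, {t | t ∈ H ∧ prec 0 t ∧ 1 < ‖x t‖}.Finite) :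
    ∀ᵐ x ∂M, ∃! t, IsAnchor prec H x t := by
  filter_upwards [(h.ae_finite_exceedances hprec hfin).2, h.ae_one_lt] with x hx hx0
  obtain ⟨t, ht⟩ := exists_isAnchor hprec hx H.zero_mem
    (norm_pos_iff.1 (one_pos.trans hx0))
  exact ⟨t, ht, fun s hs => hs.unique hprec ht⟩

lemma measurable_tsum_enorm_rpow (S : Set (Site k)) :
    Measurable fun x : Site k → Vec d => ∑' t : S, ‖x t‖ₑ ^ α :=
  Measurable.tsum fun _ => (measurable_enorm_site _).pow_const α

lemma tsum_enorm_shiftConf {t : Site k} (ht : t ∈ H) (x : Site k → Vec d) :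
    ∑' s : H, ‖shiftConf t x s‖ₑ ^ α = ∑' s : H, ‖x s‖ₑ ^ α :=
  (Equiv.subRight (⟨t, ht⟩ : H)).tsum_eq fun s : H => ‖x s‖ₑ ^ α

lemma iSup_enorm_shiftConf_lattice {t : Site k} (ht : t ∈ H) (x : Site k → Vec d) :
    ⨆ s ∈ (H : Set (Site k)), ‖shiftConf t x s‖ₑ = ⨆ s ∈ (H : Set (Site k)), ‖x s‖ₑ := by
  rw [iSup_enorm_shiftConf]
  congr! 3 with s
  exact H.add_mem_cancel_right ht

variable (h : IsTailLaw α M) (hα : 0 < α) (hprec : InvariantOrder prec)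
  (hfin : ∀ᵐ x ∂M, {t | t ∈ H ∧ prec 0 t ∧ 1 < ‖x t‖}.Finite)
include h hprec hfin

lemma IsTailLaw.ae_exists_isAnchor : ∀ᵐ x ∂M, ∃ t : H, x ∈ {x | IsAnchor prec H x t} := by
  filter_upwards [h.ae_existsUnique_isAnchor hprec hfin] with x hx
  obtain ⟨t, ht, -⟩ := hx
  exact ⟨⟨t, ht.1⟩, ht⟩

omit h hfin in
lemma pairwise_disjoint_isAnchor : Pairwise (Function.onFun Disjoint
    fun t : H => {x : Site k → Vec d | IsAnchor prec H x t}) := fun _ _ hst =>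
  Set.disjoint_left.2 fun _ hx hx' => hst (Subtype.ext (hx.out.unique hprec hx'))

/-- No exceedance on the positive part of the lattice is as likely as an anchor at the origin. -/
lemma IsTailLaw.measure_quiet_eq_measure_isAnchor :
    M {x | ∀ s ∈ {s | s ∈ H ∧ prec 0 s}, ‖x s‖ ≤ 1} = M {x | IsAnchor prec H x 0} := by
  have hLm : ∀ t, MeasurableSet {x : Site k → Vec d | IsLastExceedance prec H x t} :=
    measurableSet_isLastExceedance _
  have hAm : ∀ t, MeasurableSet {x : Site k → Vec d | IsAnchor prec H x t} :=
    measurableSet_isAnchor _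
  have h1 : M {x | ∀ s ∈ {s | s ∈ H ∧ prec 0 s}, ‖x s‖ ≤ 1} =
      M {x | IsLastExceedance prec H x 0} := by
    refine measure_congr ?_
    filter_upwards [h.ae_one_lt] with x hx
    exact propext ⟨fun hq => ⟨hx, fun s hs hps => hq s ⟨hs, hps⟩⟩, fun hq s hs => hq.2 s hs.1 hs.2⟩
  -- Shifting the anchor from `t` to the origin moves the last exceedance from the origin to `-t`.
  -- Summation over `t` then removes the position of the other site on both sides.
  have hterm : ∀ t : H, M ({x | IsLastExceedance prec H x 0} ∩ {x | IsAnchor prec H x t}) =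
      M ({x | IsAnchor prec H x 0} ∩ {x | IsLastExceedance prec H x (-t)}) := by
    intro t
    -- The anchor dominates the origin, which exceeds; the condition needed for the shift is
    -- therefore free.
    have h2 : M ({x | IsLastExceedance prec H x 0} ∩ {x | IsAnchor prec H x t}) =
        M (({x | IsLastExceedance prec H x 0} ∩ {x | IsAnchor prec H x t}) ∩ {x | 1 < ‖x t‖}) := by
      refine measure_congr ?_
      filter_upwards [h.ae_one_lt] with x hx
      refine propext ⟨fun hq => ⟨hq, ?_⟩, fun hq => hq.1⟩
      have := hq.2.out.enorm_le hprec H.zero_mem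
      exact hx.trans_le (enorm_le_iff_norm_le.1 this)
    rw [h2, h.measure_shift ((hLm 0).inter (hAm t))]
    congr 1
    ext x
    have e1 := isLastExceedance_shiftConf hprec t.2 0 x
    have e2 := isAnchor_shiftConf hprec t.2 t x
    rw [zero_sub] at e1
    rw [sub_self] at e2
    simp only [Set.mem_inter_iff, Set.mem_preimage, Set.mem_ofPred_eq, e1, e2]
    exact ⟨fun hq => ⟨hq.1.2, hq.1.1⟩, fun hq => ⟨⟨hq.2, hq.1⟩, hq.2.1⟩⟩
  rw [h1, measure_eq_tsum_of_partition (fun t : H => hAm t) (pairwise_disjoint_isAnchor hprec)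
    (h.ae_exists_isAnchor hprec hfin) (hLm 0), tsum_congr hterm,
    measure_eq_tsum_of_partition (A := fun t : H => {x | IsLastExceedance prec H x t})
      (fun t : H => hLm t) (fun s t hst => Set.disjoint_left.2 fun x hx hx' =>
        hst (Subtype.ext (hx.out.unique hprec s.2 t.2 hx')))
      (h.ae_finite_exceedances hprec hfin).1 (hAm 0)]
  exact (Equiv.neg H).tsum_eq fun t : H =>
    M ({x | IsAnchor prec H x 0} ∩ {x | IsLastExceedance prec H x t})

include hα

/-- Expectations of scale and translation invariant functions, in terms of the configurations with
anchor at the origin. -/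
lemma IsTailLaw.lintegral_invariant {G : (Site k → Vec d) → ℝ≥0∞} (hG : Measurable G)
    (hGs : ∀ c : ℝ, 0 < c → ∀ x, G (c • x) = G x) (hGt : ∀ t ∈ H, ∀ x, G (shiftConf t x) = G x) :
    ∫⁻ x, G x ∂M = ∫⁻ x in {x | IsAnchor prec H x 0},
      G x * ∑' t : H, (‖x t‖ₑ / ‖x 0‖ₑ) ^ α ∂M := by
  have hAm : ∀ t, MeasurableSet {x : Site k → Vec d | IsAnchor prec H x t} :=
    measurableSet_isAnchor _
  set G₀ : (Site k → Vec d) → ℝ≥0∞ := {x | IsAnchor prec H x 0}.indicator G with hG₀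
  have hG₀m : Measurable G₀ := hG.indicator (hAm 0)
  have hG₀s : ∀ c : ℝ, 0 < c → ∀ x, G₀ (c • x) = G₀ x := by
    intro c hc x
    exact indicator_congr_point (isAnchor_smul hc (H : Set (Site k)) 0 x) (hGs c hc x)
  -- After the anchor is moved to the origin, the old origin sits at `-t` and must exceed.
  -- Integrating out the radius turns this condition into the weight.
  have hterm : ∀ t : H, ∫⁻ x in {x | IsAnchor prec H x t}, G x ∂M =
      ∫⁻ x, G₀ x * (‖x (-t)‖ₑ / ‖x 0‖ₑ) ^ α ∂M := by
    intro t
    calc ∫⁻ x in {x | IsAnchor prec H x t}, G x ∂M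
        = ∫⁻ x in {x | 1 < ‖x t‖}, {x | IsAnchor prec H x t}.indicator G x ∂M := by
          rw [← lintegral_indicator (hAm t), ← lintegral_indicator (measurableSet_norm_gt _ 1)]
          refine lintegral_congr_ae ?_
          filter_upwards [h.ae_one_lt] with x hx
          by_cases hxA : IsAnchor prec H x t
          · have h1 : x ∈ {x : Site k → Vec d | 1 < ‖x t‖} :=
              hx.trans_le (enorm_le_iff_norm_le.1 (hxA.enorm_le hprec H.zero_mem))
            rw [Set.indicator_of_mem h1]
          · rw [Set.indicator_of_notMem (by exact hxA)]
            by_cases h1 : x ∈ {x : Site k → Vec d | 1 < ‖x t‖}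
            · rw [Set.indicator_of_mem h1, Set.indicator_of_notMem (by exact hxA)]
            · rw [Set.indicator_of_notMem h1]
      _ = ∫⁻ x in {x | 1 < ‖x (-t)‖}, G₀ x ∂M := by
          rw [h.setLIntegral_shift (hG.indicator (hAm t))]
          refine lintegral_congr fun x => ?_
          have := isAnchor_shiftConf hprec t.2 t x
          rw [sub_self] at this
          exact indicator_congr_point this (hGt t t.2 x)
      _ = ∫⁻ x in {x | 1 < ‖x (-t)‖ₑ}, G₀ x ∂M := by simp only [one_lt_enorm_iff]
      _ = ∫⁻ x, G₀ x * min 1 ((‖x (-t)‖ₑ / ‖x 0‖ₑ) ^ α) ∂M := by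
          refine h.setLIntegral_homogeneous hα hG₀m (measurable_enorm_site _) hG₀s ?_
          intro c hc x
          rw [Pi.smul_apply, enorm_smul, Real.enorm_of_nonneg hc.le]
      _ = ∫⁻ x, G₀ x * (‖x (-t)‖ₑ / ‖x 0‖ₑ) ^ α ∂M := by
          refine lintegral_congr fun x => ?_
          by_cases hx : IsAnchor prec H x 0
          -- With the anchor at the origin the ratio is at most `1`, and the truncation disappears.
          · rw [min_eq_right]
            exact ENNReal.rpow_le_one (ENNReal.div_le_of_le_mul
              (by simpa using hx.enorm_le hprec (H.neg_mem t.2))) hα.le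
          · rw [hG₀, Set.indicator_of_notMem (by exact hx), zero_mul, zero_mul]
  have hrm : ∀ t : Site k, Measurable fun x : Site k → Vec d => (‖x t‖ₑ / ‖x 0‖ₑ) ^ α := fun t =>
    ((measurable_enorm_site t).div (measurable_enorm_site 0)).pow_const α
  rw [lintegral_eq_tsum_of_partition (fun t : H => hAm t) (pairwise_disjoint_isAnchor hprec)
    (h.ae_exists_isAnchor hprec hfin) G, tsum_congr hterm,
    ← lintegral_tsum (f := fun (t : H) x => G₀ x * (‖x (-t)‖ₑ / ‖x 0‖ₑ) ^ α)
      fun t => (hG₀m.mul (hrm (-t))).aemeasurable, ← lintegral_indicator (hAm 0)]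
  refine lintegral_congr fun x => ?_
  rw [ENNReal.tsum_mul_left]
  have hneg : ∑' t : H, (‖x (-t)‖ₑ / ‖x 0‖ₑ) ^ α = ∑' t : H, (‖x t‖ₑ / ‖x 0‖ₑ) ^ α :=
    (Equiv.neg H).tsum_eq fun t : H => (‖x t‖ₑ / ‖x 0‖ₑ) ^ α
  rw [hneg]
  by_cases hx : IsAnchor prec H x 0
  · rw [hG₀, Set.indicator_of_mem (by exact hx), Set.indicator_of_mem (by exact hx)]
  · rw [hG₀, Set.indicator_of_notMem (by exact hx), Set.indicator_of_notMem (by exact hx),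
      zero_mul]

omit h hprec hfin in
lemma tsum_div_rpow {x : Site k → Vec d} (L : Set (Site k)) :
    ∑' t : L, (‖x t‖ₑ / ‖x 0‖ₑ) ^ α = (∑' t : L, ‖x t‖ₑ ^ α) / ‖x 0‖ₑ ^ α := by
  simp only [ENNReal.div_rpow_of_nonneg _ _ hα.le]
  simp only [div_eq_mul_inv, ENNReal.tsum_mul_right]

/-- With the constant function `1`, the transport formula says that the normalized sum has integral
`1` over configurations anchored at the origin. The other anchors follow by shifts. -/
lemma IsTailLaw.ae_tsum_lt_top : ∀ᵐ x ∂M, ∑' t : H, ‖x t‖ₑ ^ α < ⊤ := by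
  have := h.prob
  have hAm : ∀ t, MeasurableSet {x : Site k → Vec d | IsAnchor prec H x t} :=
    measurableSet_isAnchor _
  have h1 := h.lintegral_invariant hα hprec hfin (G := 1) measurable_one (fun _ _ _ => rfl)
    fun _ _ _ => rfl
  simp only [Pi.one_apply, one_mul, lintegral_const, measure_univ] at h1
  have hm : Measurable fun x : Site k → Vec d => ∑' t : H, (‖x t‖ₑ / ‖x 0‖ₑ) ^ α :=
    Measurable.tsum fun t =>
      ((measurable_enorm_site _).div (measurable_enorm_site 0)).pow_const α
  have h2 : ∀ᵐ x ∂M, IsAnchor prec H x 0 → ∑' t : H, ‖x t‖ₑ ^ α < ⊤ := by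
    have h3 := (ae_restrict_iff' (hAm 0)).1 (ae_lt_top hm (h1 ▸ ENNReal.one_ne_top))
    filter_upwards [h3, h.ae_one_lt] with x hx hx0 hA
    have h4 := hx hA
    have h5 := tsum_div_rpow (α := α) hα (x := x) (H : Set (Site k))
    rw [show ∑' t : H, (‖x t‖ₑ / ‖x 0‖ₑ) ^ α = _ from h5] at h4
    by_contra hcon
    rw [not_lt, top_le_iff] at hcon
    rw [show ∑' t : (H : Set (Site k)), ‖x t‖ₑ ^ α = ⊤ from hcon, ENNReal.top_div_of_ne_top
      (ENNReal.rpow_ne_top_of_nonneg hα.le enorm_ne_top)] at h4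
    exact h4.ne rfl
  have hall : ∀ᵐ x ∂M, ∀ t : H, IsAnchor prec H x t → ∑' t : H, ‖x t‖ₑ ^ α < ⊤ := by
    rw [ae_all_iff]
    intro t
    filter_upwards [h.ae_shift h2 (-t), h.ae_one_lt] with x hx hx0 hA
    rw [neg_neg] at hx
    have h5 := hx (hx0.trans_le (enorm_le_iff_norm_le.1 (hA.enorm_le hprec H.zero_mem)))
      ((isAnchor_shiftConf hprec (H.neg_mem t.2) 0 x).2 (by simpa using hA))
    rwa [tsum_enorm_shiftConf (H.neg_mem t.2)] at h5
  filter_upwards [hall, h.ae_exists_isAnchor hprec hfin] with x hx ⟨t, ht⟩ using hx t ht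

/-- For a configuration anchored at the origin the supremum is `|x_0|`, and the transport weight is
exactly the inverse of the integrand. -/
lemma IsTailLaw.lintegral_sup_div_sum :
    ∫⁻ x, (⨆ t ∈ (H : Set (Site k)), ‖x t‖ₑ) ^ α / ∑' t : H, ‖x t‖ₑ ^ α ∂M =
      M {x | IsAnchor prec H x 0} := by
  have hAm : ∀ t, MeasurableSet {x : Site k → Vec d | IsAnchor prec H x t} :=
    measurableSet_isAnchor _
  rw [h.lintegral_invariant hα hprec hfin, ← setLIntegral_one]
  · refine setLIntegral_congr_fun_ae (hAm 0) ?_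
    filter_upwards [h.ae_tsum_lt_top hα hprec hfin, h.ae_one_lt] with x hx hx0 hA
    have h0 : ‖x 0‖ₑ ^ α ≠ 0 := by
      have : x 0 ≠ 0 := norm_pos_iff.1 (one_pos.trans hx0)
      simpa [ENNReal.rpow_eq_zero_iff_of_pos hα] using this
    have htop : ‖x 0‖ₑ ^ α ≠ ⊤ := ENNReal.rpow_ne_top_of_nonneg hα.le enorm_ne_top
    have h5 := tsum_div_rpow (α := α) hα (x := x) (H : Set (Site k))
    rw [show ∑' t : H, (‖x t‖ₑ / ‖x 0‖ₑ) ^ α = _ from h5, IsAnchor.iSup_eq hprec hA]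
    change _ / _ * ((∑' t : H, ‖x t‖ₑ ^ α) / _) = 1
    have hle : ‖x 0‖ₑ ^ α ≤ ∑' t : H, ‖x t‖ₑ ^ α :=
      ENNReal.le_tsum (f := fun t : H => ‖x t‖ₑ ^ α) (0 : H)
    have hs0 : ∑' t : H, ‖x t‖ₑ ^ α ≠ 0 := fun hz => h0 (le_antisymm (hz ▸ hle) zero_le)
    generalize ∑' t : H, ‖x t‖ₑ ^ α = σ at *
    rw [div_eq_mul_inv, div_eq_mul_inv, mul_assoc, ← mul_assoc σ⁻¹, ENNReal.inv_mul_cancel hs0 hx.ne,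
      one_mul, ENNReal.mul_inv_cancel h0 htop]
  · exact ((measurable_biSup_enorm _).pow_const α).div (measurable_tsum_enorm_rpow _)
  · intro c hc x
    have hc0 : ‖c‖ₑ ^ α ≠ 0 := by
      simpa [ENNReal.rpow_eq_zero_iff_of_pos hα] using hc.ne'
    have hct : ‖c‖ₑ ^ α ≠ ⊤ := ENNReal.rpow_ne_top_of_nonneg hα.le enorm_ne_top
    rw [iSup_enorm_smul, ENNReal.mul_rpow_of_nonneg _ _ hα.le]
    simp only [Pi.smul_apply, enorm_smul, ENNReal.mul_rpow_of_nonneg _ _ hα.le,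
      ENNReal.tsum_mul_left]
    exact ENNReal.mul_div_mul_left _ _ hc0 hct
  · intro t ht x
    rw [iSup_enorm_shiftConf_lattice ht, tsum_enorm_shiftConf ht]

end Lattice

/-! ### Periods of patterns, and patterns that come from lattices -/

section Stabilizer

variable {k : ℕ} {prec : Site k → Site k → Prop} {D : Set (Site k)}

lemma mem_shiftStabilizer_iff {z : Site k} : z ∈ shiftStabilizer prec D ↔
    z ∈ insert 0 D ∧ ∀ u, (u + z ∈ D ∧ prec 0 u) ↔ u ∈ D :=
  and_congr Iff.rfl Set.ext_iff

lemma zero_mem_shiftStabilizer (hpos : ∀ t ∈ D, prec 0 t) : 0 ∈ shiftStabilizer prec D :=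
  mem_shiftStabilizer_iff.2 ⟨Set.mem_insert _ _, fun u => by
    rw [add_zero]; exact ⟨fun h => h.1, fun h => ⟨h, hpos u h⟩⟩⟩

/-- Periods compose because a stabilizing shift is `0` or positive: positive sites stay positive
after translation by `w`. -/
lemma add_mem_shiftStabilizer (hprec : InvariantOrder prec) (hpos : ∀ t ∈ D, prec 0 t)
    {z w : Site k} (hz : z ∈ shiftStabilizer prec D) (hw : w ∈ shiftStabilizer prec D) :
    z + w ∈ shiftStabilizer prec D := by
  rw [mem_shiftStabilizer_iff] at *
  obtain ⟨hz0, hz⟩ := hz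
  obtain ⟨hw0, hw⟩ := hw
  have hwle : ∀ u, prec 0 u → prec 0 (u + w) := fun u hu => by
    rcases hw0 with rfl | hw0
    · rwa [add_zero]
    · exact hprec.add_pos hu (hpos w hw0)
  refine ⟨?_, fun u => ?_⟩
  · rcases hz0 with rfl | hz0
    · rwa [zero_add]
    · exact Or.inr ((hw z).2 hz0).1
  · have h1 := hz (u + w)
    have h2 := hw u
    rw [show u + (z + w) = u + w + z by abel]
    exact ⟨fun h => h2.1 ⟨h1.1 ⟨h.1, hwle u h.2⟩, h.2⟩, fun h =>
      ⟨(h1.2 (h2.2 h).1).1, (h2.2 h).2⟩⟩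

lemma nsmul_mem_shiftStabilizer (hprec : InvariantOrder prec) (hpos : ∀ t ∈ D, prec 0 t)
    {z : Site k} (hz : z ∈ shiftStabilizer prec D) (n : ℕ) : n • z ∈ shiftStabilizer prec D := by
  induction n with
  | zero => simpa using zero_mem_shiftStabilizer hpos
  | succ n ih => rw [succ_nsmul]; exact add_mem_shiftStabilizer hprec hpos ih hz

lemma InvariantOrder.nsmul_pos (hprec : InvariantOrder prec) {g : Site k} (hg : prec 0 g) {n : ℕ}
    (hn : 0 < n) : prec 0 (n • g) := by
  induction n, hn using Nat.le_induction with
  | base => simpa using hg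
  | succ n _ ih => rw [succ_nsmul]; exact hprec.add_pos ih hg

lemma upperPart_pos (S : Set (Site k)) : ∀ t ∈ upperPart prec S, prec 0 t := fun _ ht => ht.2

lemma add_nsmul_mem_insert (hprec : InvariantOrder prec) {z g : Site k} (hz : z ∈ insert 0 D)
    (hg : g ∈ shiftStabilizer prec (upperPart prec (shiftBack D z))) (i : ℕ) :
    z + i • g ∈ insert 0 D := by
  have h := (nsmul_mem_shiftStabilizer hprec (upperPart_pos _) hg i).1
  rcases h with h | h
  · rwa [h, add_zero]
  · exact Or.inr (by simpa [shiftBack, add_comm] using h.1)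

/-- A shift that is not in the stabilizer of `D` cannot relate two points with local pattern `D`. -/
lemma eventually_not_both_pattern (hprec : InvariantOrder prec) (hpos : ∀ t ∈ D, prec 0 t)
    {g : Site k} (hg : prec 0 g) (hgD : g ∉ shiftStabilizer prec D) :
    ∀ᶠ p in atTop, ∀ (L : Set (Site k)) (t : Site k), t + g ∈ L →
      localPattern prec L t p = D ∩ cube k p → ¬ localPattern prec L (t + g) p = D ∩ cube k p := by
  by_cases hmem : g ∈ D
  · have hu : ∃ u, ¬ ((u + g ∈ D ∧ prec 0 u) ↔ u ∈ D) := by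
      by_contra hcon
      push Not at hcon
      exact hgD (mem_shiftStabilizer_iff.2 ⟨Or.inr hmem, fun u => by have := hcon u; tauto⟩)
    obtain ⟨u, hu⟩ := hu
    filter_upwards [eventually_mem_cube u, eventually_mem_cube (u + g)] with p hp hp' L t _ h1 h2
    have hu0 : prec 0 u := by
      by_contra hcon
      exact hu ⟨fun h => absurd h.2 hcon, fun h => absurd (hpos u h) hcon⟩
    have hug0 := hprec.add_pos hu0 hg
    have e1 := Set.ext_iff.1 h1 (u + g)
    have e2 := Set.ext_iff.1 h2 u
    simp only [localPattern, upperPart, shiftBack, Set.mem_ofPred_eq, Set.mem_inter_iff, hp, hp',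
      and_true, hu0, hug0] at e1 e2
    rw [show u + g + t = u + (t + g) by abel] at e1
    exact hu ⟨fun h => e2.1 (e1.2 h.1), fun h => ⟨e1.1 (e2.2 h), hu0⟩⟩
  · filter_upwards [eventually_mem_cube g] with p hp L t htg h1 _
    have e1 := Set.ext_iff.1 h1 g
    exact hmem (e1.1 ⟨⟨by simpa [shiftBack, add_comm] using htg, hp⟩, hg⟩).1

/-- Packing: every site with pattern `D` brings the `m` sites `t + z + i • g` into the block. Two of
these can coincide only if a positive multiple of `g` relates two sites with pattern `D`, which is
excluded. -/
lemma nsmul_patternFrequency_le (hprec : InvariantOrder prec) {z g : Site k}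
    (hz : z ∈ insert 0 D) (hg : g ∈ shiftStabilizer prec (upperPart prec (shiftBack D z)))
    {m p : ℕ} (hcube : ∀ i < m, z + i • g ∈ cube k p)
    (hsep : ∀ n < m, 0 < n → ∀ (L : Set (Site k)) (t : Site k), t + n • g ∈ L →
      localPattern prec L t p = D ∩ cube k p → ¬ localPattern prec L (t + n • g) p = D ∩ cube k p)
    (L : Finset (Site k)) : m * patternFrequency prec L D p ≤ 1 := by
  classical
  rcases Nat.eq_zero_or_pos L.card with h0 | hL
  · simp [patternFrequency, h0]
  have hN : (0 : ℝ) < L.card := by exact_mod_cast hL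
  have hcard := card_mul_patternFrequency (prec := prec) L hL D p
  set S := L.filter fun t => localPattern prec (↑L) t p = D ∩ cube k p with hS
  have hle : (S ×ˢ Finset.range m).card ≤ L.card := by
    refine Finset.card_le_card_of_injOn (fun q => q.1 + (z + q.2 • g)) ?_ ?_
    · rintro ⟨t, i⟩ hq
      rw [Finset.mem_coe, Finset.mem_product, Finset.mem_range] at hq
      have ht := Finset.mem_filter.1 hq.1
      have hc := hcube i hq.2
      rcases add_nsmul_mem_insert hprec hz hg i with h | h
      · simp only [h, add_zero]
        exact ht.1
      · have : z + i • g ∈ localPattern prec (↑L) t p := ht.2 ▸ ⟨h, hc⟩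
        have := this.1.1
        simpa [shiftBack, add_comm] using this
    · have key : ∀ t ∈ S, ∀ t' ∈ S, ∀ i i' : ℕ, i < m → i' < i →
          t + (z + i • g) ≠ t' + (z + i' • g) := by
        intro t ht t' ht' i i' hi hlt heq
        have ht := Finset.mem_filter.1 ht
        have ht' := Finset.mem_filter.1 ht'
        have e : t + (i - i') • g = t' := by
          have h1 : i • g = (i - i') • g + i' • g := by
            rw [← add_nsmul, Nat.sub_add_cancel hlt.le]
          rw [h1, ← add_assoc z, add_comm z, add_assoc, ← add_assoc t] at heq
          exact add_right_cancel heq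
        exact hsep (i - i') (by omega) (by omega) L t (e ▸ ht'.1) ht.2 (e ▸ ht'.2)
      rintro ⟨t, i⟩ hq ⟨t', i'⟩ hq' heq
      rw [Finset.mem_coe, Finset.mem_product, Finset.mem_range] at hq hq'
      rcases lt_trichotomy i i' with h | h | h
      · exact absurd heq.symm (key t' hq'.1 t hq.1 i' i hq'.2 h)
      · subst h
        exact Prod.ext (add_right_cancel heq) rfl
      · exact absurd heq (key t hq.1 t' hq'.1 i i' hq.2 h)
  rw [Finset.card_product, Finset.card_range] at hle
  have hle' : (S.card : ℝ) * m ≤ L.card := by exact_mod_cast hle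
  rw [← hcard] at hle'
  by_contra hcon
  rw [not_le] at hcon
  nlinarith [mul_lt_mul_of_pos_left hcon hN]

/-- In a pattern of positive weight, every period of a tail of the pattern has a multiple that is a
period of the whole pattern. -/
lemma PatternCondition.exists_nsmul_mem {ι : Type*} {Λ : ℕ → Finset (Site k)}
    {D : ι → Set (Site k)} {lam : ι → ℝ} (hD : PatternCondition prec Λ D lam)
    (hprec : InvariantOrder prec) (j : ι) {z g : Site k} (hz : z ∈ insert 0 (D j))
    (hg : g ∈ shiftStabilizer prec (upperPart prec (shiftBack (D j) z))) (hg0 : prec 0 g) :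
    ∃ n : ℕ, 0 < n ∧ n • g ∈ shiftStabilizer prec (D j) := by
  by_contra hcon
  push Not at hcon
  have hpos := hD.subset_pos j
  obtain ⟨lamp, hlamp, hlam⟩ := hD.exists_limits
  -- Without a common period the packing works for every `m`, which contradicts the positive weight.
  have hbound : ∀ m : ℕ, m * lam j ≤ 1 := by
    intro m
    refine le_of_tendsto ((hlam j).const_mul (m : ℝ)) ?_
    have h1 : ∀ᶠ p in atTop, ∀ i ∈ Finset.range m, z + i • g ∈ cube k p :=
      (eventually_all_finset _).2 fun i _ => eventually_mem_cube _
    have h2 : ∀ᶠ p in atTop, ∀ n ∈ Finset.range m, 0 < n → ∀ (L : Set (Site k)) (t : Site k),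
        t + n • g ∈ L → localPattern prec L t p = D j ∩ cube k p →
          ¬ localPattern prec L (t + n • g) p = D j ∩ cube k p := by
      refine (eventually_all_finset _).2 fun n _ => ?_
      rcases Nat.eq_zero_or_pos n with h0 | hn
      · exact Eventually.of_forall fun p hn => absurd h0 hn.ne'
      · filter_upwards [eventually_not_both_pattern hprec hpos (hprec.nsmul_pos hg0 hn) (hcon n hn)]
          with p hp _ using hp
    filter_upwards [h1, h2] with p hp1 hp2
    refine le_of_tendsto ((hlamp j p).const_mul (m : ℝ)) (Eventually.of_forall fun n => ?_)
    exact nsmul_patternFrequency_le hprec hz hg (fun i hi => hp1 i (Finset.mem_range.2 hi))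
      (fun n hn => hp2 n (Finset.mem_range.2 hn)) _
  obtain ⟨m, hm⟩ := exists_nat_gt (1 / lam j)
  rw [div_lt_iff₀ (hD.weight_pos j)] at hm
  exact absurd (hbound m) (not_le.2 hm)

/-- If `Ξ*` is a lattice, then the pattern is the positive part of this lattice. -/
lemma PatternCondition.exists_lattice {ι : Type*} {Λ : ℕ → Finset (Site k)}
    {D : ι → Set (Site k)} {lam : ι → ℝ} (hD : PatternCondition prec Λ D lam)
    (hprec : InvariantOrder prec) (j : ι) (hlat : IsLattice (fullPattern prec (D j))) :
    ∃ H : AddSubgroup (Site k), fullPattern prec (D j) = H ∧ latticeOf prec (D j) = H ∧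
      D j = {s | s ∈ H ∧ prec 0 s} := by
  obtain ⟨H, hH⟩ := hlat
  have hpos := hD.subset_pos j
  have hDeq : D j = {s | s ∈ H ∧ prec 0 s} := by
    ext x
    constructor
    · refine fun hx => ⟨?_, hpos x hx⟩
      rw [← SetLike.mem_coe, hH]
      refine ⟨x, Or.inr hx, Or.inl ?_⟩
      rw [sub_self]
      exact zero_mem_shiftStabilizer (upperPart_pos _)
    · rintro ⟨hxH, hx0⟩
      rw [← SetLike.mem_coe, hH] at hxH
      obtain ⟨z, hz, hxz⟩ := hxH
      have hzD : z = x → x ∈ D j := by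
        rintro rfl
        exact hz.resolve_left fun h => hprec.irrefl _ (h ▸ hx0)
      rcases hxz with hg | hg
      · rcases hg.1 with h | h
        · exact hzD (sub_eq_zero.1 h).symm
        · simpa [shiftBack] using h.1
      · rcases hg.1 with h | h
        · exact hzD (sub_eq_zero.1 (neg_eq_zero.1 h)).symm
        -- Here `x = z - g` precedes the tail of which `g` is a period. For a multiple `n • g` that
        -- is a period of the whole pattern, `x + n • g = z + (n - 1) • g` is in the pattern, and
        -- this period brings `x` back into it.
        · obtain ⟨n, hn, hnD⟩ := hD.exists_nsmul_mem hprec j hz hg h.2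
          have hsum : x + n • -(x - z) = z + (n - 1) • -(x - z) := by
            obtain ⟨m, rfl⟩ := Nat.exists_eq_succ_of_ne_zero hn.ne'
            rw [Nat.succ_sub_one, succ_nsmul]
            abel
          have hmem : x + n • -(x - z) ∈ insert 0 (D j) :=
            hsum ▸ add_nsmul_mem_insert hprec hz hg (n - 1)
          have hxpos : prec 0 (x + n • -(x - z)) :=
            hprec.add_pos hx0 (hprec.nsmul_pos h.2 hn)
          have hmem' := hmem.resolve_left fun h => hprec.irrefl _ (h ▸ hxpos)
          exact ((mem_shiftStabilizer_iff.1 hnD).2 x).1 ⟨hmem', hx0⟩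
  refine ⟨H, hH.symm, ?_, hDeq⟩
  have hstab : ∀ z, z ∈ shiftStabilizer prec (D j) ↔ z ∈ H ∧ (z = 0 ∨ prec 0 z) := by
    intro z
    rw [mem_shiftStabilizer_iff, hDeq]
    constructor
    · rintro ⟨rfl | hz, -⟩
      · exact ⟨H.zero_mem, Or.inl rfl⟩
      · exact ⟨hz.1, Or.inr hz.2⟩
    · rintro ⟨hzH, hz⟩
      refine ⟨hz.imp id fun h => ⟨hzH, h⟩, fun u => ?_⟩
      simp only [Set.mem_ofPred_eq, H.add_mem_cancel_right hzH]
      refine ⟨fun h => ⟨h.1.1, h.2⟩, fun h => ⟨⟨h.1, ?_⟩, h.2⟩⟩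
      rcases hz with rfl | hz
      · rw [add_zero]; exact h.2
      · exact hprec.add_pos h.2 hz
  ext z
  change z ∈ shiftStabilizer prec (D j) ∨ -z ∈ shiftStabilizer prec (D j) ↔ z ∈ H
  rw [hstab, hstab, H.neg_mem_iff, hprec.neg_pos]
  constructor
  · rintro (h | h) <;> exact h.1
  · intro hz
    by_cases h0 : z = 0
    · exact Or.inl ⟨hz, Or.inl h0⟩
    · rcases hprec.total z 0 h0 with h | h
      · exact Or.inr ⟨hz, Or.inr h⟩
      · exact Or.inl ⟨hz, Or.inr h⟩

end Stabilizer

/-! ### Finitely many exceedances of the tail law on a pattern -/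

section FiniteExceedances

variable {k d : ℕ} {Ω : Type*} [MeasurableSpace Ω] {P : Measure Ω} [IsProbabilityMeasure P]
  {X : Site k → Ω → Vec d} {α : ℝ} {prec : Site k → Site k → Prop} {Λ : ℕ → Finset (Site k)}

lemma tendsto_measureReal_quiet_cube (M : Measure (Site k → Vec d)) [IsProbabilityMeasure M]
    (A : Set (Site k)) :
    Tendsto (fun q => M.real {x | ∀ s ∈ A ∩ cube k q, ‖x s‖ ≤ 1}) atTop
      (𝓝 (M.real {x | ∀ s ∈ A, ‖x s‖ ≤ 1})) := by
  have hset : {x : Site k → Vec d | ∀ s ∈ A, ‖x s‖ ≤ 1} =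
      ⋂ q, {x | ∀ s ∈ A ∩ cube k q, ‖x s‖ ≤ 1} := by
    ext x
    simp only [Set.mem_ofPred_eq, Set.mem_iInter]
    refine ⟨fun h q s hs => h s hs.1, fun h s hs => ?_⟩
    obtain ⟨q, hq⟩ := (eventually_mem_cube s).exists
    exact h q s ⟨hs, hq⟩
  rw [hset]
  refine (ENNReal.tendsto_toReal (measure_ne_top _ _)).comp (tendsto_measure_iInter_atTop
    (fun q => (measurableSet_confQuiet _ 1).nullMeasurableSet) ?_ ⟨0, measure_ne_top _ _⟩)
  exact fun p q hpq x hx s hs => hx s ⟨hs.1, cube_mono hpq hs.2⟩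

/-- Under the anti-clustering condition, the tail law has finitely many exceedances on every
pattern. -/
lemma AntiClustering.ae_finite_pattern (hXm : ∀ t, Measurable (X t))
    (hXs : IsStationaryField P X) (hXrv : IsRegularlyVarying P X α) (hα : 0 < α)
    (hΛ : Tendsto (fun n => (Λ n).card) atTop atTop) {ι : Type*} {D : ι → Set (Site k)}
    {lam : ι → ℝ} (hD : PatternCondition prec Λ D lam) {a : ℕ → ℝ} (ha : IsLevel P X Λ 1 a)
    {r : ℕ → ℕ} (hAC : AntiClustering P X prec Λ a r) {M : Measure (Site k → Vec d)}
    [IsProbabilityMeasure M] (hM : ∀ A : Set (Site k), A.Finite →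
      Tendsto (fun x => quietProb P X A x / tailProb P X x) atTop
        (𝓝 (M.real {x | ∀ s ∈ A, ‖x s‖ ≤ 1}))) (j : ι) :
    ∀ᵐ x ∂M, {t | t ∈ D j ∧ 1 < ‖x t‖}.Finite := by
  obtain ⟨lamp, hlamp, hlam⟩ := hD.exists_limits
  have hfin : ∀ ε : ℝ, 0 < ε → M {x | ¬ {t | t ∈ D j ∧ 1 < ‖x t‖}.Finite} ≤ ENNReal.ofReal ε := by
    intro ε hε
    obtain ⟨l, hl⟩ := (hAC.eventually_farProb_le hXm hXs hXrv hα hΛ ha one_pos ha hε).exists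
    have hq : ∀ q, 1 - ε ≤ M.real {x | ∀ s ∈ (D j \ cube k l) ∩ cube k q, ‖x s‖ ≤ 1} := by
      intro q
      -- Positive weight makes the pattern occur in the blocks on some cube at least as large as
      -- `K_q`, so the sites in question are far differences there.
      obtain ⟨p, hp, hqp⟩ := (((hlam j).eventually_const_lt (hD.weight_pos j)).and
        (eventually_ge_atTop q)).exists
      refine ge_of_tendsto ((hM _ ((cube_finite k q).inter_of_right _)).comp
        (ha.tendsto_atTop hXrv hΛ)) ?_
      filter_upwards [hl, ((hlamp j p).comp hAC.tendsto_r).eventually_const_lt hp] with n hn hfreq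
      have hT := tailProb_pos hXrv (a n)
      have hne : {t : Site k | t ∈ Λ (r n) ∧
          localPattern prec (↑(Λ (r n))) t p = D j ∩ cube k p}.Nonempty := by
        by_contra hcon
        rw [Set.not_nonempty_iff_eq_empty] at hcon
        simp [patternFrequency, hcon] at hfreq
      obtain ⟨t, ht, hpat⟩ := hne
      have hsub : (D j \ cube k l) ∩ cube k q ⊆ farDifferences prec l (Λ (r n)) := by
        refine Set.Subset.trans ?_ (upperPart_diff_cube_subset ht l)
        rintro s ⟨⟨hsD, hsl⟩, hsq⟩
        have : s ∈ localPattern prec (↑(Λ (r n))) t p := hpat ▸ ⟨hsD, cube_mono hqp hsq⟩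
        exact ⟨⟨this.1.1, this.2⟩, hsl⟩
      have h1 := tailProb_le_quietProb_add_farProb (P := P) (X := X) _ l _ hsub (a n)
      simp only [Function.comp_apply]
      rw [le_div_iff₀ hT]
      linarith
    have hlim := ge_of_tendsto (tendsto_measureReal_quiet_cube M (D j \ cube k l))
      (Eventually.of_forall hq)
    have hcompl := probReal_compl_eq_one_sub (μ := M) (measurableSet_confQuiet (D j \ cube k l) 1)
    refine (measure_mono (t := {x | ∀ s ∈ D j \ cube k l, ‖x s‖ ≤ 1}ᶜ) ?_).trans ?_
    · intro x hx hquiet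
      refine hx.out ((cube_finite k l).subset fun t ht => ?_)
      by_contra hcon
      exact absurd ht.2 (not_lt.2 (hquiet t ⟨ht.1, hcon⟩))
    · rw [← ofReal_measureReal (h := measure_ne_top _ _), hcompl]
      exact ENNReal.ofReal_le_ofReal (by linarith)
  rw [ae_iff]
  refine le_antisymm (le_of_forall_gt_imp_ge_of_dense fun c hc => ?_) zero_le
  rcases eq_or_ne c ⊤ with rfl | hct
  · exact le_top
  · have h := hfin c.toReal (ENNReal.toReal_pos hc.ne' hct)
    rwa [ENNReal.ofReal_toReal hct] at h

end FiniteExceedances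

/-! ### The representations of the quiet probability -/

section Representations

variable {k d : ℕ} {α : ℝ} {M : Measure (Site k → Vec d)} {prec : Site k → Site k → Prop}

lemma iSup_rpow (hα : 0 < α) (S : Set (Site k)) (f : Site k → ℝ≥0∞) :
    ⨆ t ∈ S, f t ^ α = (⨆ t ∈ S, f t) ^ α :=
  ((ENNReal.orderIsoRpow α hα).map_iSup₂ fun t (_ : t ∈ S) => f t).symm

lemma enorm_direction (x : Site k → Vec d) (t : Site k) (hx : x 0 ≠ 0) :
    ‖direction x t‖ₑ = ‖x t‖ₑ / ‖x 0‖ₑ := by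
  have h0 : 0 < ‖x 0‖ := norm_pos_iff.2 hx
  change ‖‖x 0‖⁻¹ • x t‖ₑ = _
  rw [enorm_smul, Real.enorm_of_nonneg (inv_pos.2 h0).le, ENNReal.ofReal_inv_of_pos h0,
    ofReal_norm, mul_comm, div_eq_mul_inv]

lemma enorm_direction_zero {x : Site k → Vec d} (hx : x 0 ≠ 0) : ‖direction x 0‖ₑ = 1 := by
  rw [enorm_direction x 0 hx, ENNReal.div_self (by simpa using hx) enorm_ne_top]

lemma iSup_enorm_direction {x : Site k → Vec d} (hx : x 0 ≠ 0) (S : Set (Site k)) :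
    ⨆ t ∈ S, ‖direction x t‖ₑ = (⨆ t ∈ S, ‖x t‖ₑ) / ‖x 0‖ₑ := by
  simp only [enorm_direction x _ hx, div_eq_mul_inv, ENNReal.iSup_mul]

lemma IsTailLaw.ae_ne_zero (h : IsTailLaw α M) : ∀ᵐ x ∂M, x 0 ≠ 0 :=
  h.ae_one_lt.mono fun _ hx => norm_pos_iff.1 (one_pos.trans hx)

lemma IsTailLaw.ae_iSup_direction_lt_top (h : IsTailLaw α M) {D : Set (Site k)}
    (hfin : ∀ᵐ x ∂M, {t | t ∈ D ∧ 1 < ‖x t‖}.Finite) :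
    ∀ᵐ x ∂M, ⨆ t ∈ D, ‖direction x t‖ₑ < ⊤ := by
  filter_upwards [hfin, h.ae_ne_zero] with x hx hx0
  rw [iSup_enorm_direction hx0]
  refine ENNReal.div_lt_top (ne_of_lt ?_) (by simpa using hx0)
  have hbound : (⨆ t ∈ D, ‖x t‖ₑ) ≤ 1 ⊔ hx.toFinset.sup fun t => ‖x t‖ₑ := by
    refine iSup₂_le fun t ht => ?_
    rcases le_or_gt ‖x t‖ₑ 1 with h1 | h1
    · exact h1.trans le_sup_left
    · refine le_sup_of_le_right (Finset.le_sup (f := fun t => ‖x t‖ₑ) ?_)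
      rw [Set.Finite.mem_toFinset]
      exact ⟨ht, (one_lt_enorm_iff _).1 h1⟩
  refine hbound.trans_lt (max_lt ENNReal.one_lt_top ?_)
  rw [Finset.sup_lt_iff (by simp)]
  exact fun t _ => enorm_lt_top

lemma iSup_enorm_le_one_iff (D : Set (Site k)) (x : Site k → Vec d) :
    ⨆ t ∈ D, ‖x t‖ₑ ≤ 1 ↔ ∀ t ∈ D, ‖x t‖ ≤ 1 := by
  rw [iSup₂_le_iff]
  refine forall₂_congr fun t _ => ?_
  rw [← not_lt, one_lt_enorm_iff, not_lt]

lemma IsTailLaw.measure_mul_iSup_le (h : IsTailLaw α M) (D : Set (Site k)) :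
    M {x | ‖x 0‖ₑ * (⨆ t ∈ D, ‖direction x t‖ₑ) ≤ 1} = M {x | ∀ t ∈ D, ‖x t‖ ≤ 1} := by
  refine measure_congr ?_
  filter_upwards [h.ae_ne_zero] with x hx
  refine propext ((iff_of_eq ?_).trans (iSup_enorm_le_one_iff D x))
  change (_ * _ ≤ _) = _
  rw [iSup_enorm_direction hx, ENNReal.mul_div_cancel (by simpa using hx) enorm_ne_top]

lemma max_sub_eq_one_sub_min (w : ℝ≥0∞) : 1 ⊔ w - w = 1 - min 1 w := by
  rcases le_total w 1 with h | h
  · rw [sup_eq_left.2 h, min_eq_right h]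
  · rw [sup_eq_right.2 h, min_eq_left h, tsub_self, tsub_self]

/-- The direction has norm `1` at the origin, so the difference is `1 - min(1, w)`, where `w` is the
supremum over `D` to the power `α`. The mean of `min(1, w)` is the probability of an exceedance on
`D`, by integration over the Pareto radius. -/
lemma IsTailLaw.lintegral_sup_sub_sup (h : IsTailLaw α M) (hα : 0 < α) (D : Set (Site k)) :
    ∫⁻ x, ((⨆ t ∈ insert 0 D, ‖direction x t‖ₑ ^ α) - ⨆ t ∈ D, ‖direction x t‖ₑ ^ α) ∂M =
      M {x | ∀ t ∈ D, ‖x t‖ ≤ 1} := by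
  have := h.prob
  have hV := measurable_biSup_enorm (d := d) D
  have hVS : MeasurableSet {x : Site k → Vec d | 1 < ⨆ t ∈ D, ‖x t‖ₑ} :=
    measurableSet_lt measurable_const hV
  have h1 := h.setLIntegral_homogeneous hα (F := 1) measurable_one hV (fun _ _ _ => rfl)
    fun c hc x => by rw [iSup_enorm_smul, Real.enorm_of_nonneg hc.le]
  simp only [Pi.one_apply, one_mul, setLIntegral_one] at h1
  have hset : {x : Site k → Vec d | ∀ t ∈ D, ‖x t‖ ≤ 1} = {x | 1 < ⨆ t ∈ D, ‖x t‖ₑ}ᶜ := by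
    ext x
    simp only [Set.mem_ofPred_eq, Set.mem_compl_iff, not_lt, iSup_enorm_le_one_iff]
  have hfin : ∫⁻ x, min 1 (((⨆ t ∈ D, ‖x t‖ₑ) / ‖x 0‖ₑ) ^ α) ∂M ≠ ⊤ := h1 ▸ measure_ne_top _ _
  have h2 : ∫⁻ x, (1 - min 1 (((⨆ t ∈ D, ‖x t‖ₑ) / ‖x 0‖ₑ) ^ α)) ∂M =
      1 - ∫⁻ x, min 1 (((⨆ t ∈ D, ‖x t‖ₑ) / ‖x 0‖ₑ) ^ α) ∂M := by
    have h3 := lintegral_sub' (μ := M) (f := fun _ => 1)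
      (measurable_const.min ((hV.div (measurable_enorm_site 0)).pow_const α)).aemeasurable hfin
      (Eventually.of_forall fun x => min_le_left 1 _)
    rw [lintegral_const, measure_univ, one_mul] at h3
    exact h3
  rw [hset, prob_compl_eq_one_sub hVS, h1, ← h2]
  refine lintegral_congr_ae ?_
  filter_upwards [h.ae_ne_zero] with x hx
  rw [iSup_insert, enorm_direction_zero hx, ENNReal.one_rpow, iSup_rpow hα, iSup_enorm_direction hx]
  exact max_sub_eq_one_sub_min _

lemma summable_norm_direction {S : Set (Site k)} {x : Site k → Vec d}
    (hx : ∑' t : S, ‖x t‖ₑ ^ α < ⊤) : Summable fun t : S => ‖direction x t‖ ^ α := by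
  have h1 := (ENNReal.summable_toReal hx.ne).mul_left (‖‖x 0‖⁻¹‖ ^ α)
  refine h1.congr fun t => ?_
  change _ = ‖‖x 0‖⁻¹ • x t‖ ^ α
  rw [norm_smul, Real.mul_rpow (norm_nonneg _) (norm_nonneg _), ← ENNReal.toReal_rpow, toReal_enorm]

/-- Summability guarantees that the real series in the cluster norm is the true sum and not the
default value `0`. -/
lemma iSup_enorm_spectralCluster (hα : 0 < α) {S : Set (Site k)} (h0 : 0 ∈ S)
    {z : Site k → Vec d} (hz : z 0 ≠ 0) (hs : Summable fun t : S => ‖z t‖ ^ α) :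
    ⨆ t ∈ S, ‖spectralCluster S α z t‖ₑ ^ α =
      (⨆ t ∈ S, ‖z t‖ₑ ^ α) / ∑' t : S, ‖z t‖ₑ ^ α := by
  have hnn : ∀ t : S, 0 ≤ ‖z t‖ ^ α := fun t => by positivity
  have hpos : 0 < ∑' t : S, ‖z t‖ ^ α :=
    hs.tsum_pos hnn ⟨0, h0⟩ (Real.rpow_pos_of_pos (norm_pos_iff.2 hz) _)
  have hnorm : ∀ t, ‖z t‖ₑ ^ α = ENNReal.ofReal (‖z t‖ ^ α) := fun t => by
    rw [← ofReal_norm, ENNReal.ofReal_rpow_of_nonneg (norm_nonneg _) hα.le]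
  have hsum : ∑' t : S, ‖z t‖ₑ ^ α = ENNReal.ofReal (∑' t : S, ‖z t‖ ^ α) := by
    rw [ENNReal.ofReal_tsum_of_nonneg hnn hs]
    exact tsum_congr fun t => hnorm t
  have hc : 0 < clusterNorm S α z := Real.rpow_pos_of_pos hpos _
  have hscale : ‖(clusterNorm S α z)⁻¹‖ₑ ^ α = (∑' t : S, ‖z t‖ₑ ^ α)⁻¹ := by
    rw [hsum, Real.enorm_of_nonneg (inv_pos.2 hc).le, ENNReal.ofReal_inv_of_pos hc,
      ENNReal.inv_rpow, ENNReal.ofReal_rpow_of_pos hc, clusterNorm, ← Real.rpow_mul hpos.le,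
      one_div_mul_cancel hα.ne', Real.rpow_one]
  simp only [spectralCluster, enorm_smul, ENNReal.mul_rpow_of_nonneg _ _ hα.le, hscale]
  rw [div_eq_mul_inv, mul_comm]
  simp only [ENNReal.mul_iSup]

variable {H : AddSubgroup (Site k)}

lemma sup_div_sum_direction (hα : 0 < α) {S : Set (Site k)} {x : Site k → Vec d} (hx : x 0 ≠ 0) :
    (⨆ t ∈ S, ‖direction x t‖ₑ ^ α) / ∑' t : S, ‖direction x t‖ₑ ^ α =
      (⨆ t ∈ S, ‖x t‖ₑ) ^ α / ∑' t : S, ‖x t‖ₑ ^ α := by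
  have h0 : ‖x 0‖ₑ ^ α ≠ 0 := by simpa [ENNReal.rpow_eq_zero_iff_of_pos hα] using hx
  have htop : ‖x 0‖ₑ ^ α ≠ ⊤ := ENNReal.rpow_ne_top_of_nonneg hα.le enorm_ne_top
  rw [iSup_rpow hα, iSup_enorm_direction hx, ENNReal.div_rpow_of_nonneg _ _ hα.le]
  simp only [enorm_direction x _ hx]
  rw [tsum_div_rpow hα, div_eq_mul_inv, div_eq_mul_inv _ (‖x 0‖ₑ ^ α)]
  exact ENNReal.mul_div_mul_right _ _ (ENNReal.inv_ne_zero.2 htop) (ENNReal.inv_ne_top.2 h0)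

lemma isAnchor_direction_iff {x : Site k → Vec d} (hx : x 0 ≠ 0) (L : Set (Site k)) (t : Site k) :
    IsAnchor prec L (direction x) t ↔ IsAnchor prec L x t :=
  isAnchor_smul (inv_pos.2 (norm_pos_iff.2 hx)) L t x

/-- The representations for a pattern that is the positive part of a lattice. -/
theorem IsTailLaw.lattice_representations (h : IsTailLaw α M) (hα : 0 < α)
    (hprec : InvariantOrder prec) {D : Set (Site k)} (hDH : D = {s | s ∈ H ∧ prec 0 s})
    (hfin : ∀ᵐ x ∂M, {t | t ∈ D ∧ 1 < ‖x t‖}.Finite) :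
    (∀ᵐ x ∂M, Summable (fun t : (H : Set (Site k)) => ‖direction x t‖ ^ α) ∧
      ∃! t, IsAnchor prec H (direction x) t) ∧
    ∫⁻ x, (⨆ t ∈ (H : Set (Site k)), ‖spectralCluster H α (direction x) t‖ₑ ^ α) ∂M =
      M {x | ∀ t ∈ D, ‖x t‖ ≤ 1} ∧
    ∫⁻ x, ((⨆ t ∈ (H : Set (Site k)), ‖direction x t‖ₑ ^ α) /
      ∑' s : (H : Set (Site k)), ‖direction x s‖ₑ ^ α) ∂M = M {x | ∀ t ∈ D, ‖x t‖ ≤ 1} ∧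
    ∫⁻ x, Set.indicator {x | IsAnchor prec H (direction x) 0}
      (fun x => ‖direction x 0‖ₑ ^ α) x ∂M = M {x | ∀ t ∈ D, ‖x t‖ ≤ 1} := by
  have hfin' : ∀ᵐ x ∂M, {t | t ∈ H ∧ prec 0 t ∧ 1 < ‖x t‖}.Finite := by
    filter_upwards [hfin] with x hx
    refine hx.subset fun t ht => ⟨?_, ht.2.2⟩
    rw [hDH]
    exact ⟨ht.1, ht.2.1⟩
  have hsummable : ∀ᵐ x ∂M, Summable (fun t : (H : Set (Site k)) => ‖direction x t‖ ^ α) := by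
    filter_upwards [h.ae_tsum_lt_top hα hprec hfin'] with x hx
    exact summable_norm_direction hx
  have hquot : ∫⁻ x, ((⨆ t ∈ (H : Set (Site k)), ‖direction x t‖ₑ ^ α) /
      ∑' s : (H : Set (Site k)), ‖direction x s‖ₑ ^ α) ∂M = M {x | ∀ t ∈ D, ‖x t‖ ≤ 1} := by
    rw [hDH, h.measure_quiet_eq_measure_isAnchor hprec hfin',
      ← h.lintegral_sup_div_sum hα hprec hfin']
    refine lintegral_congr_ae ?_
    filter_upwards [h.ae_ne_zero] with x hx using sup_div_sum_direction hα hx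
  refine ⟨?_, ?_, hquot, ?_⟩
  · filter_upwards [hsummable, h.ae_existsUnique_isAnchor hprec hfin', h.ae_ne_zero]
      with x hx hA hx0
    exact ⟨hx, by simpa only [isAnchor_direction_iff hx0] using hA⟩
  · rw [← hquot]
    refine lintegral_congr_ae ?_
    filter_upwards [hsummable, h.ae_ne_zero] with x hx hx0
    refine iSup_enorm_spectralCluster hα H.zero_mem ?_ hx
    rw [← enorm_ne_zero, enorm_direction_zero hx0]
    exact one_ne_zero
  · rw [hDH, h.measure_quiet_eq_measure_isAnchor hprec hfin',
      ← lintegral_indicator_one (measurableSet_isAnchor _ _)]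
    refine lintegral_congr_ae ?_
    filter_upwards [h.ae_ne_zero] with x hx0
    refine indicator_congr_point (isAnchor_direction_iff hx0 _ _) ?_
    rw [enorm_direction_zero hx0, ENNReal.one_rpow]
    rfl

lemma measurable_biSup_direction (hα : 0 < α) (S : Set (Site k)) :
    Measurable fun x : Site k → Vec d => ⨆ t ∈ S, ‖direction x t‖ₑ ^ α := by
  simp only [iSup_rpow hα]
  exact ((measurable_biSup_enorm S).comp measurable_direction).pow_const α

/-- A divergent real series has value `0`, as does the real part of an infinite extended sum, so the
two descriptions agree without summability. -/
lemma measurable_clusterNorm (S : Set (Site k)) (α : ℝ) :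
    Measurable fun x : Site k → Vec d => clusterNorm S α x := by
  have hsum : ∀ x : Site k → Vec d,
      (∑' t : S, ENNReal.ofReal (‖x t‖ ^ α)).toReal = ∑' t : S, ‖x t‖ ^ α := fun x => by
    rw [ENNReal.tsum_toReal_eq fun _ => ENNReal.ofReal_ne_top]
    exact tsum_congr fun t => ENNReal.toReal_ofReal (Real.rpow_nonneg (norm_nonneg _) _)
  have hterm : ∀ t : S, Measurable fun x : Site k → Vec d => ENNReal.ofReal (‖x t‖ ^ α) :=
    fun t => ((measurable_pi_apply (t : Site k)).norm.pow_const α).ennreal_ofReal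
  have htsum : Measurable fun x : Site k → Vec d => ∑' t : S, ENNReal.ofReal (‖x t‖ ^ α) :=
    Measurable.tsum hterm
  have hreal : Measurable fun x : Site k → Vec d => ∑' t : S, ‖x t‖ ^ α := by
    simpa only [hsum] using htsum.ennreal_toReal
  exact hreal.pow_const (1 / α)

lemma measurable_spectralCluster (S : Set (Site k)) (α : ℝ) :
    Measurable (spectralCluster (d := d) S α) := by
  refine measurable_pi_lambda _ fun t => ?_
  have ht : Measurable fun x : Site k → Vec d => x t := measurable_pi_apply t
  exact Measurable.smul (measurable_clusterNorm S α).inv ht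

end Representations

end ExtremalField


/-! ### The theorem -/

theorem theorem5p1 {k d : ℕ} {Ω : Type*} [MeasurableSpace Ω] (P : Measure Ω)
    [IsProbabilityMeasure P] (X : Site k → Ω → Vec d) (hXm : ∀ t, Measurable (X t))
    (α : ℝ) (hα : 0 < α) (hXs : IsStationaryField P X) (hXrv : IsRegularlyVarying P X α)
    (prec : Site k → Site k → Prop) (hprec : InvariantOrder prec)
    (Λ : ℕ → Finset (Site k)) (hΛ : Tendsto (fun n => (Λ n).card) atTop atTop)
    {ι : Type*} [Countable ι] (D : ι → Set (Site k)) (lam : ι → ℝ)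
    (hD : PatternCondition prec Λ D lam)
    (a : ℕ → ℝ) (ha : IsLevel P X Λ 1 a)
    (r : ℕ → ℕ) (hAC : AntiClustering P X prec Λ a r) :
    ∃ θ : ℝ, 0 < θ ∧ IsBlockExtremalIndex P X Λ r θ ∧
      -- the representations, for the tail field `Y` of `X` and `Θ = Y / |Y_0|`
      (∀ (Ω' : Type*) [MeasurableSpace Ω'] (P' : Measure Ω') [IsProbabilityMeasure P']
        (Y : Site k → Ω' → Vec d), IsTailField P X α P' Y →
        (∀ j, ∀ᵐ ω ∂P', (⨆ t ∈ D j, ‖spectralField Y ω t‖ₑ) < ⊤) ∧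
        ∑' j, ENNReal.ofReal (lam j) *
            P' {ω | ‖Y 0 ω‖ₑ * (⨆ t ∈ D j, ‖spectralField Y ω t‖ₑ) ≤ 1}
          = ENNReal.ofReal θ ∧
        ∑' j, ENNReal.ofReal (lam j) *
            ∫⁻ ω, ((⨆ t ∈ insert 0 (D j), ‖spectralField Y ω t‖ₑ ^ α)
              - ⨆ t ∈ D j, ‖spectralField Y ω t‖ₑ ^ α) ∂P'
          = ENNReal.ofReal θ ∧
        -- the further representations in the lattice case
        ((∀ j, IsLattice (fullPattern prec (D j))) →
          (∀ j, ∀ᵐ ω ∂P',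
            Summable (fun t : fullPattern prec (D j) => ‖spectralField Y ω t‖ ^ α) ∧
            ∃! t, IsAnchor prec (latticeOf prec (D j)) (spectralField Y ω) t) ∧
          ∑' j, ENNReal.ofReal (lam j) *
              ∫⁻ ω, (⨆ t ∈ fullPattern prec (D j),
                ‖spectralCluster (fullPattern prec (D j)) α (spectralField Y ω) t‖ₑ ^ α) ∂P'
            = ENNReal.ofReal θ ∧
          ∑' j, ENNReal.ofReal (lam j) *
              ∫⁻ ω, ((⨆ t ∈ fullPattern prec (D j), ‖spectralField Y ω t‖ₑ ^ α)
                / ∑' s : fullPattern prec (D j), ‖spectralField Y ω s‖ₑ ^ α) ∂P'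
            = ENNReal.ofReal θ ∧
          ∑' j, ENNReal.ofReal (lam j) *
              ∫⁻ ω, Set.indicator
                {ω | IsAnchor prec (latticeOf prec (D j)) (spectralField Y ω) 0}
                (fun ω => ‖spectralField Y ω 0‖ₑ ^ α) ω ∂P'
            = ENNReal.ofReal θ)) ∧
      -- the extremal index under the mixing condition
      (MaxMixing P X Λ a r → IsExtremalIndex P X Λ θ) := by
  have hρ' : ∀ A : Set (Site k), ∃ ρ : ℝ, A.Finite →
      Tendsto (fun x : ℝ => quietProb P X A x / tailProb P X x) atTop (𝓝 ρ) := by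
    intro A
    by_cases hA : A.Finite
    · obtain ⟨ρ, hρ⟩ := exists_tendsto_quietProb hXm hXs hXrv hA
      exact ⟨ρ, fun _ => hρ⟩
    · exact ⟨0, fun h => absurd h hA⟩
  -- These limits depend on the field alone, so `θ` is fixed before any tail field is chosen;
  -- infinite sets get the unused value `0`.
  choose ρ hρ using hρ'
  obtain ⟨π, θ, hπ0, hπ, hsum, hθ0, hθ1, hlim⟩ :=
    exists_blockExtremalIndex hXm hα hXs hXrv hprec hΛ hD ha hAC hρ
  refine ⟨θ, hθ0, fun τ hτ => ⟨?_, hlim τ hτ⟩, ?_, fun hmix =>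
    hmix.isExtremalIndex hXm hα hXs hXrv hΛ ha hAC.tendsto_r hAC.tendsto_blockCount hθ0.le hθ1 hlim⟩
  · obtain ⟨c, -, hc⟩ := exists_isLevel hXm hXs hXrv hα hΛ ha hτ
    exact ⟨_, hc⟩
  intro Ω' _ P' _ Y hY
  have hYm : Measurable fun ω t => Y t ω := measurable_pi_lambda _ hY.measurable
  have hM := hY.isTailLaw hXm hXs hXrv
  have hMp := hM.prob
  have hquiet : ∀ A : Set (Site k), A.Finite →
      Tendsto (fun x => quietProb P X A x / tailProb P X x) atTop
        (𝓝 ((fieldLaw P' Y).real {x | ∀ s ∈ A, ‖x s‖ ≤ 1})) := fun A hA =>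
    hY.tendsto_quietProb hXm hXrv (fun t => hM.measure_norm_eq t one_pos) hA
  have hfin := hAC.ae_finite_pattern hXm hXs hXrv hα hΛ hD ha hquiet
  -- Uniqueness of limits identifies the two descriptions on each `D j ∩ cube k p`, and then as `p →
  -- ∞`. Every representation below reduces to this probability, one pattern at a time.
  have hprob : ∀ j, fieldLaw P' Y {x | ∀ t ∈ D j, ‖x t‖ ≤ 1} = ENNReal.ofReal (π j) := by
    intro j
    rw [← ofReal_measureReal (h := measure_ne_top _ _)]
    congr 1
    refine tendsto_nhds_unique (tendsto_measureReal_quiet_cube _ (D j)) ((hπ j).congr fun p => ?_)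
    have hf := (cube_finite k p).inter_of_right (D j)
    exact tendsto_nhds_unique (hρ _ hf) (hquiet _ hf)
  have htsum : ∑' j, ENNReal.ofReal (lam j) * fieldLaw P' Y {x | ∀ t ∈ D j, ‖x t‖ ≤ 1} =
      ENNReal.ofReal θ := by
    have hnn : ∀ j, 0 ≤ lam j * π j := fun j => mul_nonneg (hD.weight_pos j).le (hπ0 j)
    rw [← hsum.tsum_eq, ENNReal.ofReal_tsum_of_nonneg hnn hsum.summable]
    exact tsum_congr fun j => by rw [hprob, ENNReal.ofReal_mul (hD.weight_pos j).le]
  have hae : ∀ {p : (Site k → Vec d) → Prop}, (∀ᵐ x ∂(fieldLaw P' Y), p x) →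
      ∀ᵐ ω ∂P', p fun t => Y t ω := fun hp => ae_of_ae_map hYm.aemeasurable hp
  have hint : ∀ {F : (Site k → Vec d) → ℝ≥0∞}, Measurable F →
      ∫⁻ ω, F (fun t => Y t ω) ∂P' = ∫⁻ x, F x ∂(fieldLaw P' Y) := fun hF =>
    (lintegral_map hF hYm).symm
  have hsupm : ∀ S : Set (Site k), Measurable fun x : Site k → Vec d =>
      ⨆ t ∈ S, ‖direction x t‖ₑ := fun S => (measurable_biSup_enorm S).comp measurable_direction
  refine ⟨fun j => hae (hM.ae_iSup_direction_lt_top (hfin j)), ?_, ?_, fun hlat => ?_⟩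
  · rw [← htsum]
    refine tsum_congr fun j => ?_
    have hS : MeasurableSet {x : Site k → Vec d | ‖x 0‖ₑ * (⨆ t ∈ D j, ‖direction x t‖ₑ) ≤ 1} :=
      measurableSet_le ((measurable_enorm_site 0).mul (hsupm _)) measurable_const
    rw [← hM.measure_mul_iSup_le (D j), fieldLaw, Measure.map_apply hYm hS]
    rfl
  · rw [← htsum]
    refine tsum_congr fun j => ?_
    rw [← hM.lintegral_sup_sub_sup hα (D j), ← hint]
    · rfl
    · exact (measurable_biSup_direction hα _).sub (measurable_biSup_direction hα _)
  · choose H hH hL hDH using fun j => hD.exists_lattice hprec j (hlat j)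
    have hrep := fun j => hM.lattice_representations hα hprec (hDH j) (hfin j)
    refine ⟨fun j => by rw [hH j, hL j]; exact hae (hrep j).1, ?_, ?_, ?_⟩
    · rw [← htsum]
      refine tsum_congr fun j => ?_
      rw [hH j, ← (hrep j).2.1, ← hint]
      · rfl
      · simp only [iSup_rpow hα]
        exact ((measurable_biSup_enorm _).comp
          ((measurable_spectralCluster _ α).comp measurable_direction)).pow_const α
    · rw [← htsum]
      refine tsum_congr fun j => ?_
      rw [hH j, ← (hrep j).2.2.1, ← hint]
      · rfl
      · exact (measurable_biSup_direction hα _).div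
          ((measurable_tsum_enorm_rpow _).comp measurable_direction)
    · rw [← htsum]
      refine tsum_congr fun j => ?_
      rw [hL j, ← (hrep j).2.2.2, ← hint]
      · rfl
      · exact (((measurable_enorm_site 0).comp measurable_direction).pow_const α).indicator
          (measurable_direction (measurableSet_isAnchor _ 0))
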